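/- For every integer $r\ge 2$ let $D^*_r\subset S^3$ be the binary dihedral group of order $4r$, i.e. the subgroup of the group $S^3$ of unit quaternions generated by $x=j$ and $y=\cos(\pi/r)+\sin(\pi/r)\,i$ (so that $x^2=(xy)^2=y^r$), and let $P(r)=S^3/D^*_r$ be the prism space, with the quotient topology. Then there is a simplicial complex $P_{12r+3}(r)$ on $12r+3$ vertices such that 1. the geometric realization of $P_{12r+3}(r)$ is homeomorphic to $P(r)$; 2. $P_{12r+3}(r)$ is $\mathbb{Z}_{2r}$-invariant, i.e. the cyclic group $\mathbb{Z}_{2r}$ acts faithfully on $P_{12r+3}(r)$ by simplicial automorphisms; 3. its $f$-vector is $f(P_{12r+3}(r))=(12r+3,\ 84r+3,\ 144r,\ 72r)$, where $f_i$ is the number of $i$-dimensional faces; in particular it is $3$-dimensional. -/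

import Mathlib

open scoped Quaternion

noncomputable section

/-- The Lie group `S³` of unit quaternions, with its subspace topology. -/
abbrev S3 : Type := Metric.sphere (0 : ℍ[ℝ]) 1

theorem mem_S3_of_normSq {q : ℍ[ℝ]} (h : Quaternion.normSq q = 1) :
    q ∈ Metric.sphere (0 : ℍ[ℝ]) 1 := by
  rw [mem_sphere_zero_iff_norm, ← sq_eq_sq₀ (norm_nonneg _) zero_le_one, sq,
    ← Quaternion.normSq_eq_norm_mul_self, h, one_pow]

/-- The quaternion `exp(iπ/r) = cos(π/r) + sin(π/r) i`. -/
def rotQuat (r : ℕ) : ℍ[ℝ] := ⟨Real.cos (Real.pi / r), Real.sin (Real.pi / r), 0, 0⟩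

/-- The quaternion `j`. -/
def quatJ : ℍ[ℝ] := ⟨0, 0, 1, 0⟩

/-- `exp(iπ/r)` as an element of `S³`. -/
def rotGen (r : ℕ) : S3 :=
  ⟨rotQuat r, mem_S3_of_normSq (by rw [Quaternion.normSq_def']; simp [rotQuat])⟩

/-- `j` as an element of `S³`. -/
def jGen : S3 :=
  ⟨quatJ, mem_S3_of_normSq (by rw [Quaternion.normSq_def']; simp [quatJ])⟩

/-- The binary dihedral group `D*_r ⊂ S³` (of order `4r`), generated by `x = j` and
`y = exp(iπ/r)`, which satisfy `x² = (xy)² = y^r`. -/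
def binaryDihedral (r : ℕ) : Subgroup S3 :=
  Subgroup.closure {jGen, rotGen r}

/-- The prism space `P(r) = S³ / D*_r`, with the quotient topology. -/
abbrev PrismSpace (r : ℕ) : Type := S3 ⧸ binaryDihedral r

namespace AbstractSimplicialComplex

variable {V : Type*}

/-- The geometric realization `|K|` of a simplicial complex on a finite vertex set, as a subspace of
`ℝ^V`: the points (in barycentric coordinates) of the closed simplices spanned by the faces. -/
def realization [Fintype V] (K : AbstractSimplicialComplex V) : Set (V → ℝ) :=
  {x | x ∈ stdSimplex ℝ V ∧ ∃ s ∈ K.faces, ∀ v, x v ≠ 0 → v ∈ s}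

/-- The number `f_i` of `i`-dimensional faces (those with `i + 1` vertices). -/
def fNumber (K : AbstractSimplicialComplex V) (i : ℕ) : ℕ :=
  Set.ncard {s : Finset V | s ∈ K.faces ∧ s.card = i + 1}

/-- `K` has `f`-vector `f = (f₀, …, f_d)`; there are no faces of dimension larger than `d`. -/
def HasFVector (K : AbstractSimplicialComplex V) (f : List ℕ) : Prop :=
  ∀ i, K.fNumber i = f.getD i 0

/-- The group of simplicial automorphisms of `K`: the vertex permutations that map faces to faces
and non-faces to non-faces. -/
def automorphismGroup (K : AbstractSimplicialComplex V) : Subgroup (Equiv.Perm V) where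
  carrier := {σ | ∀ s : Finset V, s.map σ.toEmbedding ∈ K.faces ↔ s ∈ K.faces}
  one_mem' := fun s => by
    have : s.map (1 : Equiv.Perm V).toEmbedding = s := by
      ext a; simp [Equiv.Perm.one_def]
    rw [this]
  mul_mem' := fun {σ τ} hσ hτ s => by
    have : s.map (σ * τ).toEmbedding = (s.map τ.toEmbedding).map σ.toEmbedding := by
      rw [Finset.map_map]; rfl
    rw [this, hσ, hτ]
  inv_mem' := fun {σ} hσ s => by
    have : (s.map (σ⁻¹).toEmbedding).map σ.toEmbedding = s := by
      ext a; simp [Equiv.Perm.inv_def]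
    rw [← hσ (s.map (σ⁻¹).toEmbedding), this]

end AbstractSimplicialComplex

end

/-! Write a unit quaternion as cos θ · exp(iα) + sin θ · exp(iβ) j. Right multiplication by
exp(iπ/r) moves (α, β) by (π/r, −π/r), and right multiplication by j exchanges θ with π/2 − θ
(`hopf_mul_circ`, `hopf_mul_jGen`). So P(r) is the solid torus θ ≤ π/4 modulo a cyclic group, again
a solid torus, with its boundary glued to itself by the involution that j induces. The coordinates
are a = rα/π, ρ = 4θ/π and c = ρ · r(α − β)/π. Because the angle is multiplied by the radius, a
rotation is the shear c ↦ c + kρ, and all identifications are affine: (a, ρ, c) ~ (a + q, ρ, c + (2q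
+ 2rl)ρ), and (a, 1, c) ~ (a − c + r, 1, r − c).

The unrolled solid torus is triangulated by the clique complex of `Near`. Its vertices lie on
vertical columns: O on the axis, A at ρ = 1/2, M and B on the boundary, with spacings 1/3, 1/3, 1/2,
1/4. Each sector of the base is cut into four triangles, and over each of them the columns are
joined by a staircase of tetrahedra. That this is a triangulation means two things. Uniqueness,
`LPoint.eq_of_pos_eq`: the weight of each column is a barycentric coordinate of (ρ, c) in the base,
and since edges between two columns do not cross, the height a fixes the distribution inside the
columns. Existence, `exists_lPoint`: the staircases leave no gap.

The map `proj` divides the vertices by the identifications. Faces with equal projection differ by a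
deck transformation (`exists_deck`), so `proj` and `prismMap` identify the same points of the lifted
complex (`mapDomain_proj_eq_iff`). This gives a continuous bijection from the compact realization of
`quotComplex` to the Hausdorff space P(r), hence a homeomorphism.

The complex `quotComplex` has f-vector (12r+3, 82r+3, 140r, 70r). Performing 2r disjoint bistellar
flips, one full orbit of the rotation, replaces two tetrahedra by three each time. This preserves
the realization (`IsFlip.homeomorph`) and the symmetry and reaches the required numbers. For the
count, every face with an A or M vertex has a unique normal form up to rotation (`normal_unique`),
so such faces come in free orbits of size 2r over a finite list that is enumerated by computation.
The faces using only O or only B vertices may have stabilizers and are counted separately. -/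

noncomputable section

namespace Prism

/-! ### The lifted complex, its symmetries, and the projection of its vertices. -/

/-- Vertices of the lifted complex: the axis `O`, the inner columns `A`, and the two kinds of
boundary columns `M`, `B`; the first index is the angular position, the last one the height. -/
inductive LVert : Type
  | O (i : ℤ)
  | A (n j : ℤ)
  | M (n m : ℤ)
  | B (n h : ℤ)
  deriving DecidableEq

open LVert

/-- Two lifted vertices are equal or joined by an edge. -/
def Near : LVert → LVert → Prop
  | O i, O i' => i ≤ i' + 1 ∧ i' ≤ i + 1
  | O i, A _ j => j ≤ i ∧ i ≤ j + 1
  | A _ j, O i => j ≤ i ∧ i ≤ j + 1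
  | O _, M _ _ => False
  | M _ _, O _ => False
  | O _, B _ _ => False
  | B _ _, O _ => False
  | A n j, A k l => (k = n ∧ j ≤ l + 1 ∧ l ≤ j + 1) ∨ (k = n + 1 ∧ j ≤ l ∧ l ≤ j + 1) ∨
      (n = k + 1 ∧ l ≤ j ∧ j ≤ l + 1)
  | A n j, M k m => (k = n ∧ 3 * m - 1 ≤ 2 * j ∧ 2 * j ≤ 3 * m + 3) ∨
      (n = k + 1 ∧ 3 * m + 1 ≤ 2 * j ∧ 2 * j ≤ 3 * m + 5)
  | M k m, A n j => (k = n ∧ 3 * m - 1 ≤ 2 * j ∧ 2 * j ≤ 3 * m + 3) ∨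
      (n = k + 1 ∧ 3 * m + 1 ≤ 2 * j ∧ 2 * j ≤ 3 * m + 5)
  | A n j, B k h => k = n ∧ 3 * h ≤ 4 * j ∧ 4 * j ≤ 3 * h + 6
  | B k h, A n j => k = n ∧ 3 * h ≤ 4 * j ∧ 4 * j ≤ 3 * h + 6
  | M n m, M k l => k = n ∧ m ≤ l + 1 ∧ l ≤ m + 1
  | B n m, B k l => k = n ∧ m ≤ l + 1 ∧ l ≤ m + 1
  | M n m, B k h => (k = n ∧ h ≤ 2 * m ∧ 2 * m ≤ h + 2) ∨
      (k = n + 1 ∧ 2 * m ≤ h ∧ h ≤ 2 * m + 2)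
  | B k h, M n m => (k = n ∧ h ≤ 2 * m ∧ 2 * m ≤ h + 2) ∨
      (k = n + 1 ∧ 2 * m ≤ h ∧ h ≤ 2 * m + 2)

instance : DecidableRel Near := fun u v => by
  cases u <;> cases v <;> unfold Near <;> infer_instance

theorem Near.refl (u : LVert) : Near u u := by
  cases u <;> simp [Near]

theorem Near.symm {u v : LVert} (h : Near u v) : Near v u := by
  cases u <;> cases v <;> simp only [Near] at h ⊢ <;> omega

/-- Faces of the lifted complex. -/
def LFace (T : Finset LVert) : Prop := T.Nonempty ∧ ∀ u ∈ T, ∀ v ∈ T, Near u v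

theorem LFace.mono {S T : Finset LVert} (h : LFace T) (hS : S ⊆ T) (hn : S.Nonempty) : LFace S :=
  ⟨hn, fun u hu v hv => h.2 u (hS hu) v (hS hv)⟩

/-- Rotation by `k` sectors and translation by `q` along the axis. -/
def shift (k q : ℤ) : LVert → LVert
  | O i => O (i + 3 * q)
  | A n j => A (n + k) (j + 3 * q)
  | M n m => M (n + k) (m + 2 * q)
  | B n h => B (n + k) (h + 4 * q)

/-- The glide reflection of the boundary columns along which the boundary is glued to itself. -/
def fold (r : ℤ) : LVert → LVert
  | O i => O i
  | A n j => A n j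
  | M n m => M (r - n - 1) (m - 2 * n - 1 + 2 * r)
  | B n h => B (r - n) (h - 4 * n + 4 * r)

/-- Boundary vertices. -/
def IsBd : LVert → Prop
  | O _ => False
  | A _ _ => False
  | M _ _ => True
  | B _ _ => True

/-- Axis vertices. -/
def IsAx : LVert → Prop
  | O _ => True
  | A _ _ => False
  | M _ _ => False
  | B _ _ => False

/-- Inner vertices. -/
def IsIn : LVert → Prop
  | O _ => False
  | A _ _ => True
  | M _ _ => False
  | B _ _ => False

instance : DecidablePred IsIn := fun u => by cases u <;> unfold IsIn <;> infer_instance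

theorem near_shift (k q : ℤ) (u v : LVert) : Near (shift k q u) (shift k q v) ↔ Near u v := by
  cases u <;> cases v <;> simp only [Near, shift] <;> omega

/-- The restriction to the boundary is essential: `fold` fixes the inner vertices and moves the
boundary, so it destroys edges between the two. It may be applied only to faces contained in the
boundary. -/
theorem near_fold (r : ℤ) {u v : LVert} (hu : IsBd u) (hv : IsBd v) :
    Near (fold r u) (fold r v) ↔ Near u v := by
  cases u <;> cases v <;> simp only [Near, fold, IsBd] at hu hv ⊢ <;> omega

theorem shift_shift (k q k' q' : ℤ) (u : LVert) :
    shift k q (shift k' q' u) = shift (k + k') (q + q') u := by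
  cases u <;> simp only [shift, O.injEq, A.injEq, M.injEq, B.injEq] <;> omega

theorem shift_zero (u : LVert) : shift 0 0 u = u := by
  cases u <;> simp [shift]

theorem shift_injective (k q : ℤ) : Function.Injective (shift k q) := by
  intro u v h
  have := congrArg (shift (-k) (-q)) h
  simpa [shift_shift, shift_zero] using this

theorem fold_injective (r : ℤ) : Function.Injective (fold r) := by
  intro u v h
  cases u <;> cases v <;> simp only [fold, O.injEq, A.injEq, M.injEq, B.injEq, reduceCtorEq] at h ⊢
  <;> omega

/-- Vertices of the quotient complex. -/
abbrev QVert (r : ℕ) : Type :=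
  (ZMod 3 ⊕ ZMod 3 × ZMod (2 * r)) ⊕ (ZMod (2 * r) ⊕ ZMod 4 × ZMod r)

/-- The projection of lifted vertices to vertices of the quotient complex. -/
def proj (r : ℕ) : LVert → QVert r
  | O i => .inl (.inl i)
  | A n j => .inl (.inr (j, (2 * (j / 3) - n : ℤ)))
  | M n m => .inr (.inl (m - n + (if 2 ∣ m then (r : ℤ) else 0) : ℤ))
  | B n h => .inr (.inr (h, (2 * (h / 4) - n : ℤ)))

/-- The cyclic action on the vertices of the quotient complex. -/
def act (r : ℕ) (d : ℤ) : QVert r → QVert r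
  | .inl (.inl i) => .inl (.inl i)
  | .inl (.inr (j, k)) => .inl (.inr (j, k + d))
  | .inr (.inl k) => .inr (.inl (k + d))
  | .inr (.inr (h, k)) => .inr (.inr (h, k + d))

theorem zmod_eq_iff (N : ℕ) (a b : ℤ) : (a : ZMod N) = b ↔ ∃ q : ℤ, b = a + N * q := by
  rw [ZMod.intCast_eq_intCast_iff_dvd_sub]
  constructor
  · rintro ⟨q, hq⟩; exact ⟨q, by omega⟩
  · rintro ⟨q, hq⟩; exact ⟨q, by omega⟩

theorem proj_shift (r : ℕ) (k q : ℤ) (u : LVert) :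
    proj r (shift k q u) = act r (2 * q - k) (proj r u) := by
  rcases u with i | ⟨n, j⟩ | ⟨n, m⟩ | ⟨n, h⟩
  · simp only [proj, shift, act, Sum.inl.injEq]
    exact ((zmod_eq_iff 3 _ _).2 ⟨q, by push_cast; ring⟩).symm
  · simp only [proj, shift, act, Sum.inl.injEq, Sum.inr.injEq, Prod.mk.injEq]
    refine ⟨((zmod_eq_iff 3 _ _).2 ⟨q, by push_cast; ring⟩).symm, ?_⟩
    rw [← Int.cast_add]
    congr 1
    omega
  · simp only [proj, shift, act, Sum.inl.injEq, Sum.inr.injEq]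
    rw [← Int.cast_add]
    congr 1
    have : (2 ∣ m + 2 * q) ↔ 2 ∣ m := by omega
    simp only [this]
    split_ifs <;> ring
  · simp only [proj, shift, act, Sum.inr.injEq, Prod.mk.injEq]
    refine ⟨((zmod_eq_iff 4 _ _).2 ⟨q, by push_cast; ring⟩).symm, ?_⟩
    rw [← Int.cast_add]
    congr 1
    omega

/-- On M columns `fold` reverses the parity of m and adds r to m − n; the summand r for even m in
`proj` absorbs this modulo 2r. On B columns it adds r to a coordinate that is read only modulo r. -/
theorem proj_fold (r : ℕ) (u : LVert) : proj r (fold r u) = proj r u := by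
  rcases u with i | ⟨n, j⟩ | ⟨n, m⟩ | ⟨n, h⟩
  · rfl
  · rfl
  · simp only [proj, fold, Sum.inl.injEq, Sum.inr.injEq]
    by_cases h2 : 2 ∣ m
    · have h3 : ¬ (2 ∣ m - 2 * n - 1 + 2 * (r : ℤ)) := by omega
      rw [if_pos h2, if_neg h3]
      congr 1
      ring
    · have h3 : (2 ∣ m - 2 * n - 1 + 2 * (r : ℤ)) := by omega
      rw [if_neg h2, if_pos h3, zmod_eq_iff]
      exact ⟨-1, by push_cast; ring⟩
  · simp only [proj, fold, Sum.inr.injEq, Prod.mk.injEq]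
    refine ⟨(zmod_eq_iff 4 _ _).2 ⟨n - r, by push_cast; ring⟩, ?_⟩
    rw [zmod_eq_iff]
    refine ⟨-1, ?_⟩
    omega

theorem act_zero (r : ℕ) (x : QVert r) : act r 0 x = x := by
  rcases x with (i | ⟨j, k⟩) | (k | ⟨h, k⟩) <;> simp [act]

theorem act_act (r : ℕ) (d e : ℤ) (x : QVert r) : act r d (act r e x) = act r (d + e) x := by
  rcases x with (i | ⟨j, k⟩) | (k | ⟨h, k⟩) <;> simp [act] <;> ring

theorem act_two_mul (r : ℕ) (l : ℤ) (x : QVert r) : act r (2 * (r * l)) x = x := by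
  have h1 : ((2 * (r * l) : ℤ) : ZMod (2 * r)) = 0 := by
    rw [show ((0 : ZMod (2 * r))) = ((0 : ℤ) : ZMod (2 * r)) by simp, zmod_eq_iff]
    exact ⟨-l, by push_cast; ring⟩
  have h2 : ((2 * (r * l) : ℤ) : ZMod r) = 0 := by
    rw [show ((0 : ZMod r)) = ((0 : ℤ) : ZMod r) by simp, zmod_eq_iff]
    exact ⟨-2 * l, by ring⟩
  rcases x with (i | ⟨j, k⟩) | (k | ⟨h, k⟩) <;> simp only [act, h1, h2, add_zero]

theorem proj_surjective (r : ℕ) : Function.Surjective (proj r) := by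
  rintro ((i | ⟨j, k⟩) | (k | ⟨h, k⟩))
  · obtain ⟨i, rfl⟩ := ZMod.intCast_surjective i
    exact ⟨O i, rfl⟩
  · obtain ⟨j, rfl⟩ := ZMod.intCast_surjective j
    obtain ⟨k, rfl⟩ := ZMod.intCast_surjective k
    exact ⟨A (2 * (j / 3) - k) j, by simp [proj]⟩
  · obtain ⟨k, rfl⟩ := ZMod.intCast_surjective k
    exact ⟨M (1 - k) 1, by simp [proj]⟩
  · obtain ⟨h, rfl⟩ := ZMod.intCast_surjective h
    obtain ⟨k, rfl⟩ := ZMod.intCast_surjective k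
    exact ⟨B (2 * (h / 4) - k) h, by simp [proj]⟩

/-- Lifted vertices with the same projection are related by the deck group. -/
theorem exists_of_proj_eq (r : ℕ) {u v : LVert} (h : proj r u = proj r v) :
    ∃ q l : ℤ, v = shift (2 * q + 2 * (r * l)) q u ∨
      (IsBd u ∧ v = shift (2 * q + 2 * (r * l)) q (fold r u)) := by
  rcases u with i | ⟨n, j⟩ | ⟨n, m⟩ | ⟨n, h'⟩ <;> rcases v with i₁ | ⟨n₁, j₁⟩ | ⟨n₁, m₁⟩ | ⟨n₁, h₁⟩ <;>
    simp only [proj, Sum.inl.injEq, Sum.inr.injEq, Prod.mk.injEq, zmod_eq_iff, reduceCtorEq] at h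
  · obtain ⟨q, hq⟩ := h
    exact ⟨q, 0, Or.inl (by simp only [shift, O.injEq]; push_cast at hq; omega)⟩
  · obtain ⟨⟨q, hq⟩, l, hl⟩ := h
    refine ⟨q, -l, Or.inl ?_⟩
    push_cast at hq hl
    simp only [shift, A.injEq, mul_neg, ← mul_assoc] at hl ⊢
    omega
  · obtain ⟨l, hl⟩ := h
    push_cast at hl
    rw [mul_assoc] at hl
    by_cases h1 : 2 ∣ m <;> by_cases h2 : 2 ∣ m₁ <;> simp only [h1, h2, if_true, if_false] at hl
    · refine ⟨(m₁ - m) / 2, -l, Or.inl ?_⟩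
      simp only [shift, M.injEq, mul_neg]
      omega
    · refine ⟨(m₁ - (m - 2 * n - 1 + 2 * r)) / 2, -l, Or.inr ⟨trivial, ?_⟩⟩
      simp only [shift, fold, M.injEq, mul_neg]
      omega
    · refine ⟨(m₁ - (m - 2 * n - 1 + 2 * r)) / 2, 1 - l, Or.inr ⟨trivial, ?_⟩⟩
      simp only [shift, fold, M.injEq, mul_sub, mul_one]
      omega
    · refine ⟨(m₁ - m) / 2, -l, Or.inl ?_⟩
      simp only [shift, M.injEq, mul_neg]
      omega
  · obtain ⟨⟨q, hq⟩, l, hl⟩ := h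
    push_cast at hq
    rcases Int.even_or_odd' l with ⟨t, rfl | rfl⟩
    · refine ⟨q, -t, Or.inl ?_⟩
      have : (r : ℤ) * (2 * t) = 2 * (r * t) := by ring
      rw [this] at hl
      simp only [shift, B.injEq, mul_neg]
      omega
    · refine ⟨q + n - r, -t, Or.inr ⟨trivial, ?_⟩⟩
      have : (r : ℤ) * (2 * t + 1) = 2 * (r * t) + r := by ring
      rw [this] at hl
      simp only [shift, fold, B.injEq, mul_neg]
      omega

/-- Two lifted vertices in a common star are comparable. -/
def StarType (u v v' : LVert) : Prop := IsIn u ∨ (IsAx u ∧ IsAx v ∧ IsAx v') ∨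
  (IsBd u ∧ IsBd v ∧ IsBd v')

/-- Linearizes the only nonlinear term of a deck transformation: afterwards r · l can be replaced by
an integer variable and handled by `omega`. -/
theorem mul_cases {r : ℕ} (l : ℤ) : (l = 0 ∧ (r : ℤ) * l = 0) ∨ (r : ℤ) ≤ r * l ∨
    (r : ℤ) * l ≤ - r := by
  rcases lt_trichotomy l 0 with h | h | h
  · right; right; nlinarith
  · left; simp [h]
  · right; left; nlinarith

/-- A nontrivial deck transformation moves a vertex too far for both copies to be neighbours of u.
Some condition like `StarType` is needed: an axis vertex is joined to A n j for every n, in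
particular to A n j and A (n + 2r) j, which have the same projection. -/
theorem proj_star_injective {r : ℕ} (hr : 2 ≤ r) {u v v' : LVert} (hv : Near u v) (hv' : Near u v')
    (ht : StarType u v v') (h : proj r v = proj r v') : v = v' := by
  obtain ⟨q, l, h⟩ := exists_of_proj_eq r h
  have hl := mul_cases (r := r) l
  generalize (r : ℤ) * l = x at hl h
  have hr' : (2 : ℤ) ≤ r := by exact_mod_cast hr
  rcases h with rfl | ⟨hb, rfl⟩
  · rcases u with i | ⟨n, j⟩ | ⟨n, m⟩ | ⟨n, h'⟩ <;> rcases v with i₁ | ⟨n₁, j₁⟩ | ⟨n₁, m₁⟩ | ⟨n₁, h₁⟩ <;>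
    simp only [shift, Near, StarType, IsIn, IsAx, IsBd, O.injEq, A.injEq, M.injEq, B.injEq,
      false_and, and_false, or_false, false_or, and_self] at * <;>
    omega
  · rcases u with i | ⟨n, j⟩ | ⟨n, m⟩ | ⟨n, h'⟩ <;> rcases v with i₁ | ⟨n₁, j₁⟩ | ⟨n₁, m₁⟩ | ⟨n₁, h₁⟩ <;>
    simp only [shift, fold, Near, StarType, IsIn, IsAx, IsBd, M.injEq,
      B.injEq, false_and, or_false, false_or, and_self] at * <;>
    omega

theorem proj_near_injective {r : ℕ} (hr : 2 ≤ r) {v v' : LVert} (hv : Near v v')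
    (h : proj r v = proj r v') : v = v' := by
  refine proj_star_injective hr (Near.refl v) hv ?_ h
  cases v <;> cases v' <;> simp_all [StarType, IsIn, IsAx, IsBd, Near, proj]


/-! ### Faces and points with the same projection. -/

open LVert

/-- The deck transformations that can be applied to a set `T` of lifted vertices. -/
def Deck (r : ℕ) (T : Finset LVert) (γ : LVert → LVert) : Prop :=
  ∃ q l : ℤ, γ = shift (2 * q + 2 * (r * l)) q ∨
    ((∀ u ∈ T, IsBd u) ∧ γ = shift (2 * q + 2 * (r * l)) q ∘ fold r)

theorem Deck.proj_eq {r : ℕ} {T : Finset LVert} {γ : LVert → LVert} (h : Deck r T γ) (u : LVert) :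
    proj r (γ u) = proj r u := by
  obtain ⟨q, l, rfl | ⟨-, rfl⟩⟩ := h
  · rw [proj_shift, show 2 * q - (2 * q + 2 * (r * l)) = 2 * (r * (-l)) by ring, act_two_mul]
  · rw [Function.comp_apply, proj_shift,
      show 2 * q - (2 * q + 2 * (r * l)) = 2 * (r * (-l)) by ring, act_two_mul, proj_fold]

theorem Deck.injective {r : ℕ} {T : Finset LVert} {γ : LVert → LVert} (h : Deck r T γ) :
    Function.Injective γ := by
  obtain ⟨q, l, rfl | ⟨-, rfl⟩⟩ := h
  · exact shift_injective _ _
  · exact (shift_injective _ _).comp (fold_injective _)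

theorem Deck.near {r : ℕ} {T : Finset LVert} {γ : LVert → LVert} (h : Deck r T γ) {u v : LVert}
    (hu : u ∈ T) (hv : v ∈ T) : Near (γ u) (γ v) ↔ Near u v := by
  obtain ⟨q, l, rfl | ⟨hb, rfl⟩⟩ := h
  · exact near_shift _ _ _ _
  · exact (near_shift _ _ _ _).trans (near_fold _ (hb u hu) (hb v hv))

theorem Deck.lFace {r : ℕ} {T : Finset LVert} {γ : LVert → LVert} (h : Deck r T γ) (hT : LFace T) :
    LFace (T.image γ) := by
  refine ⟨hT.1.image _, ?_⟩
  simp only [Finset.mem_image]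
  rintro _ ⟨u, hu, rfl⟩ _ ⟨v, hv, rfl⟩
  exact (h.near hu hv).2 (hT.2 u hu v hv)

/-- Axis and boundary vertices are never joined. In `exists_deck` this ensures that a face without
inner vertices is wholly in the boundary whenever `fold` is called for. -/
theorem LFace.isBd_or_isAx {T : Finset LVert} (hT : LFace T) (hA : ∀ u ∈ T, ¬ IsIn u) :
    (∀ u ∈ T, IsBd u) ∨ (∀ u ∈ T, IsAx u) := by
  obtain ⟨u, hu⟩ := hT.1
  have := hA u hu
  rcases u with i | ⟨n, j⟩ | ⟨n, m⟩ | ⟨n, h⟩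
  · right
    intro v hv
    have h1 := hT.2 _ hu _ hv
    have h2 := hA v hv
    cases v <;> simp_all [Near, IsIn, IsAx]
  · simp [IsIn] at this
  all_goals
    left
    intro v hv
    have h1 := hT.2 _ hu _ hv
    have h2 := hA v hv
    cases v <;> simp_all [Near, IsIn, IsBd]

theorem not_isBd_of_isIn {u : LVert} (h : IsIn u) : ¬ IsBd u := by
  cases u <;> simp_all [IsIn, IsBd]

theorem not_isBd_of_isAx {u : LVert} (h : IsAx u) : ¬ IsBd u := by
  cases u <;> simp_all [IsAx, IsBd]

theorem type_of_proj_eq {r : ℕ} {u v : LVert} (h : proj r u = proj r v) :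
    (IsIn u ↔ IsIn v) ∧ (IsBd u ↔ IsBd v) ∧ (IsAx u ↔ IsAx v) := by
  cases u <;> cases v <;> simp_all [proj, IsIn, IsBd, IsAx]

theorem type_shift (k q : ℤ) (u : LVert) :
    (IsIn (shift k q u) ↔ IsIn u) ∧ (IsBd (shift k q u) ↔ IsBd u) ∧
      (IsAx (shift k q u) ↔ IsAx u) := by
  cases u <;> simp [shift, IsIn, IsBd, IsAx]

/-- Two faces of the lifted complex with the same projection are related by the deck group. -/
theorem exists_deck {r : ℕ} (hr : 2 ≤ r) {T T' : Finset LVert} (hT : LFace T) (hT' : LFace T')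
    (h : T.image (proj r) = T'.image (proj r)) : ∃ γ, Deck r T γ ∧ T.image γ = T' := by
  have hex : ∀ u ∈ T, ∃ u' ∈ T', proj r u' = proj r u := fun u hu => by
    have := Finset.mem_image_of_mem (proj r) hu
    rw [h, Finset.mem_image] at this
    exact this
  have hex' : ∀ u' ∈ T', ∃ u ∈ T, proj r u = proj r u' := fun u hu => by
    have := Finset.mem_image_of_mem (proj r) hu
    rw [← h, Finset.mem_image] at this
    exact this
  -- It suffices to move one vertex into the other face.
  have key : ∀ γ, Deck r T γ → ∀ u ∈ T, γ u ∈ T' →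
      (∀ v v', proj r v = proj r v' → v ∈ T.image γ → v' ∈ T' → StarType (γ u) v v') →
      T.image γ = T' := by
    intro γ hγ u hu hu' hs
    apply Finset.Subset.antisymm
    · intro w hw
      obtain ⟨v, hv, rfl⟩ := Finset.mem_image.1 hw
      obtain ⟨v', hv', he⟩ := hex v hv
      have he' : proj r (γ v) = proj r v' := by rw [hγ.proj_eq, he]
      rw [proj_star_injective hr ((hγ.near hu hv).2 (hT.2 u hu v hv)) (hT'.2 _ hu' _ hv')
        (hs _ _ he' hw hv') he']
      exact hv'
    · intro v' hv'
      obtain ⟨v, hv, he⟩ := hex' v' hv'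
      have he' : proj r (γ v) = proj r v' := by rw [hγ.proj_eq, he]
      rw [← proj_star_injective hr ((hγ.near hu hv).2 (hT.2 u hu v hv)) (hT'.2 _ hu' _ hv')
        (hs _ _ he' (Finset.mem_image_of_mem γ hv) hv') he']
      exact Finset.mem_image_of_mem γ hv
  -- An inner vertex excludes `fold`, and as the centre of the star it makes `StarType` automatic.
  by_cases hA : ∃ u ∈ T, IsIn u
  · obtain ⟨u, hu, hui⟩ := hA
    obtain ⟨u', hu', he⟩ := hex u hu
    obtain ⟨q, l, h1 | ⟨hb, -⟩⟩ := exists_of_proj_eq r he.symm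
    · refine ⟨_, ⟨q, l, Or.inl rfl⟩, key _ ⟨q, l, Or.inl rfl⟩ u hu (h1 ▸ hu') ?_⟩
      intro v v' _ _ _
      exact Or.inl ((type_shift _ _ u).1.2 hui)
    · exact absurd hb (not_isBd_of_isIn hui)
  · push Not at hA
    obtain ⟨u, hu⟩ := hT.1
    obtain ⟨u', hu', he⟩ := hex u hu
    obtain ⟨q, l, h1⟩ := exists_of_proj_eq r he.symm
    have hγ : ∃ γ, Deck r T γ ∧ γ u = u' := by
      rcases h1 with h1 | ⟨hb, h1⟩
      · exact ⟨_, ⟨q, l, Or.inl rfl⟩, h1.symm⟩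
      · refine ⟨_, ⟨q, l, Or.inr ⟨?_, rfl⟩⟩, h1.symm⟩
        rcases hT.isBd_or_isAx hA with h2 | h2
        · exact h2
        · exact absurd hb (not_isBd_of_isAx (h2 u hu))
    obtain ⟨γ, hγ, rfl⟩ := hγ
    have t1 := type_of_proj_eq (hγ.proj_eq u)
    refine ⟨γ, hγ, key γ hγ u hu hu' ?_⟩
    intro v v' hvv hv _
    obtain ⟨w, hw, rfl⟩ := Finset.mem_image.1 hv
    have t2 := type_of_proj_eq (hγ.proj_eq w)
    have t3 := type_of_proj_eq hvv
    rcases hT.isBd_or_isAx hA with h2 | h2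
    · have b := t2.2.1.2 (h2 w hw)
      exact Or.inr (Or.inr ⟨t1.2.1.2 (h2 u hu), b, t3.2.1.1 b⟩)
    · have b := t2.2.2.2 (h2 w hw)
      exact Or.inr (Or.inl ⟨t1.2.2.2 (h2 u hu), b, t3.2.2.1 b⟩)

theorem LFace.proj_injOn {r : ℕ} (hr : 2 ≤ r) {T : Finset LVert} (hT : LFace T) :
    Set.InjOn (proj r) T :=
  fun u hu v hv h => proj_near_injective hr (hT.2 u hu v hv) h

/-- Points of the lifted complex, in barycentric coordinates. -/
def LPoint (x : LVert →₀ ℝ) : Prop :=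
  LFace x.support ∧ (∀ v, 0 ≤ x v) ∧ (x.sum fun _ t => t) = 1

/-- Since `proj` is injective on each face, no weights are added up by `mapDomain`; the deck
transformation that matches the carriers therefore matches the weights too. -/
theorem exists_deck_of_mapDomain_eq {r : ℕ} (hr : 2 ≤ r) {x x' : LVert →₀ ℝ} (hx : LPoint x)
    (hx' : LPoint x') (h : x.mapDomain (proj r) = x'.mapDomain (proj r)) :
    ∃ γ, Deck r x.support γ ∧ x' = x.mapDomain γ := by
  have i1 := hx.1.proj_injOn hr
  have i2 := hx'.1.proj_injOn hr
  obtain ⟨γ, hγ, he⟩ := exists_deck hr hx.1 hx'.1 (by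
    rw [← Finsupp.mapDomain_support_of_injOn _ i1, ← Finsupp.mapDomain_support_of_injOn _ i2, h])
  refine ⟨γ, hγ, ?_⟩
  ext w
  by_cases hw : w ∈ x'.support
  · have hw' := hw
    rw [← he] at hw'
    obtain ⟨v, hv, rfl⟩ := Finset.mem_image.1 hw'
    rw [Finsupp.mapDomain_apply hγ.injective,
      ← Finsupp.mapDomain_apply' (↑x'.support) x' subset_rfl i2 hw, ← h, hγ.proj_eq,
      Finsupp.mapDomain_apply' (↑x.support) x subset_rfl i1 hv]
  · rw [Finsupp.notMem_support_iff.1 hw]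
    symm
    rw [← Finsupp.notMem_support_iff]
    intro h'
    exact hw (he ▸ Finsupp.mapDomain_support h')

theorem Deck.lPoint {r : ℕ} {x : LVert →₀ ℝ} {γ : LVert → LVert} (h : Deck r x.support γ)
    (hx : LPoint x) : LPoint (x.mapDomain γ) := by
  refine ⟨?_, ?_, ?_⟩
  · rw [Finsupp.mapDomain_support_of_injective h.injective]
    exact h.lFace hx.1
  · intro v
    by_cases hv : v ∈ Set.range γ
    · obtain ⟨u, rfl⟩ := hv
      rw [Finsupp.mapDomain_apply h.injective]
      exact hx.2.1 u
    · rw [Finsupp.mapDomain_of_notMem_range _ _ hv]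
  · rw [Finsupp.sum_mapDomain_index (fun _ => rfl) (fun _ _ _ => rfl)]
    exact hx.2.2

theorem Deck.mapDomain_proj {r : ℕ} {x : LVert →₀ ℝ} {γ : LVert → LVert}
    (h : Deck r x.support γ) : (x.mapDomain γ).mapDomain (proj r) = x.mapDomain (proj r) := by
  rw [← Finsupp.mapDomain_comp]
  exact Finsupp.mapDomain_congr fun u _ => h.proj_eq u


/-! ### Columns, coordinates of points, and the triangulated base. -/

open LVert

/-- The columns of lifted vertices. -/
inductive Col : Type
  | O
  | A (n : ℤ)
  | M (n : ℤ)
  | B (n : ℤ)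
  deriving DecidableEq

/-- The column of a lifted vertex. -/
def col : LVert → Col
  | O _ => .O
  | A n _ => .A n
  | M n _ => .M n
  | B n _ => .B n

/-- The integral height of a lifted vertex in its column. -/
def ht : LVert → ℤ
  | O i => i
  | A _ j => j
  | M _ m => m
  | B _ h => h

/-- The vertical distance between neighbours in a column. -/
def gap : Col → ℝ
  | .O => 1 / 3
  | .A _ => 1 / 3
  | .M _ => 1 / 2
  | .B _ => 1 / 4

/-- The distance of a column from the axis. -/
def crho : Col → ℝ
  | .O => 0
  | .A _ => 1 / 2
  | .M _ => 1
  | .B _ => 1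

/-- The angular coordinate of a column, multiplied with its distance from the axis. -/
def cang : Col → ℝ
  | .O => 0
  | .A n => n / 2
  | .M n => n + 1 / 2
  | .B n => n

theorem eq_of_col_ht {u v : LVert} (h : col u = col v) (h' : ht u = ht v) : u = v := by
  cases u <;> cases v <;> simp_all [col, ht]

theorem gap_pos (k : Col) : 0 < gap k := by
  cases k <;> norm_num [gap]

/-- The linear extension of a function on lifted vertices. -/
def lin (f : LVert → ℝ) (x : LVert →₀ ℝ) : ℝ := ∑ v ∈ x.support, x v * f v

/-- The total weight on a column. -/
def mass (x : LVert →₀ ℝ) (k : Col) : ℝ := ∑ v ∈ x.support with col v = k, x v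

/-- The total height on a column. -/
def hsum (x : LVert →₀ ℝ) (k : Col) : ℝ := ∑ v ∈ x.support with col v = k, x v * ht v

/-- The height of a point. -/
def posA (x : LVert →₀ ℝ) : ℝ := lin (fun v => gap (col v) * ht v) x

/-- The distance of a point from the axis. -/
def posR (x : LVert →₀ ℝ) : ℝ := lin (fun v => crho (col v)) x

/-- The angular coordinate of a point, multiplied with its distance from the axis. -/
def posC (x : LVert →₀ ℝ) : ℝ := lin (fun v => cang (col v)) x

theorem lin_col (g : Col → ℝ) (x : LVert →₀ ℝ) (K : Finset Col) (h : ∀ v ∈ x.support, col v ∈ K) :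
    lin (fun v => g (col v)) x = ∑ k ∈ K, mass x k * g k := by
  unfold lin mass
  rw [← Finset.sum_fiberwise_of_maps_to h]
  refine Finset.sum_congr rfl fun k _ => ?_
  rw [Finset.sum_mul]
  refine Finset.sum_congr rfl fun v hv => ?_
  simp only [(Finset.mem_filter.1 hv).2]

theorem posA_eq (x : LVert →₀ ℝ) (K : Finset Col) (h : ∀ v ∈ x.support, col v ∈ K) :
    posA x = ∑ k ∈ K, gap k * hsum x k := by
  unfold posA lin hsum
  rw [← Finset.sum_fiberwise_of_maps_to h]
  refine Finset.sum_congr rfl fun k _ => ?_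
  rw [Finset.mul_sum]
  refine Finset.sum_congr rfl fun v hv => ?_
  simp only [(Finset.mem_filter.1 hv).2]
  ring

theorem LPoint.mass_nonneg {x : LVert →₀ ℝ} (hx : LPoint x) (k : Col) : 0 ≤ mass x k :=
  Finset.sum_nonneg fun v _ => hx.2.1 v

theorem mass_eq_zero {x : LVert →₀ ℝ} {k : Col} (h : ∀ v ∈ x.support, col v ≠ k) :
    mass x k = 0 :=
  Finset.sum_eq_zero fun v hv => absurd (Finset.mem_filter.1 hv).2 (h v (Finset.mem_filter.1 hv).1)

/-- The four kinds of base triangles in the sector `n`. -/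
def baseTri (n : ℤ) : Fin 4 → Finset Col
  | 0 => {.O, .A n, .A (n + 1)}
  | 1 => {.A n, .A (n + 1), .M n}
  | 2 => {.A n, .M n, .B n}
  | 3 => {.A (n + 1), .M n, .B (n + 1)}

/-- The outermost kind of column that occurs, B before M before A, selects the triangle; a
neighbouring M or A column decides between the two adjacent sectors. -/
theorem LFace.exists_baseTri {T : Finset LVert} (hT : LFace T) :
    ∃ n τ, ∀ v ∈ T, col v ∈ baseTri n τ := by
  by_cases hB : ∃ n h, B n h ∈ T
  · obtain ⟨n, h, hB⟩ := hB
    by_cases hM : ∃ m, M n m ∈ T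
    · obtain ⟨m, hM⟩ := hM
      refine ⟨n, 2, fun v hv => ?_⟩
      have h1 := hT.2 _ hB _ hv
      have h2 := hT.2 _ hM _ hv
      cases v <;> simp [Near, baseTri, col] at h1 h2 ⊢ <;> omega
    · refine ⟨n - 1, 3, fun v hv => ?_⟩
      have h1 := hT.2 _ hB _ hv
      cases v <;> simp [Near, baseTri, col] at h1 ⊢
      · omega
      · rcases h1 with h1 | h1
        · exact absurd ⟨_, h1.1 ▸ hv⟩ hM
        · omega
      · omega
  by_cases hM : ∃ n m, M n m ∈ T
  · obtain ⟨n, m, hM⟩ := hM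
    refine ⟨n, 1, fun v hv => ?_⟩
    have h1 := hT.2 _ hM _ hv
    cases v <;> simp [Near, baseTri, col] at h1 ⊢
    · omega
    · omega
    · exact hB ⟨_, _, hv⟩
  by_cases hA : ∃ n j, A n j ∈ T
  · obtain ⟨n, j, hA⟩ := hA
    by_cases hA' : ∃ j, A (n + 1) j ∈ T
    · obtain ⟨j', hA'⟩ := hA'
      refine ⟨n, 0, fun v hv => ?_⟩
      have h1 := hT.2 _ hA _ hv
      have h2 := hT.2 _ hA' _ hv
      cases v <;> simp [Near, baseTri, col] at h1 h2 ⊢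
      · omega
      · exact hM ⟨_, _, hv⟩
      · exact hB ⟨_, _, hv⟩
    · refine ⟨n - 1, 0, fun v hv => ?_⟩
      have h1 := hT.2 _ hA _ hv
      cases v <;> simp [Near, baseTri, col] at h1 ⊢
      · rcases h1 with h1 | h1 | h1
        · omega
        · exact absurd ⟨_, h1.1 ▸ hv⟩ hA'
        · omega
      · exact hM ⟨_, _, hv⟩
      · exact hB ⟨_, _, hv⟩
  · refine ⟨0, 0, fun v hv => ?_⟩
    cases v <;> simp [baseTri, col]
    · exact absurd ⟨_, _, hv⟩ hA
    · exact hM ⟨_, _, hv⟩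
    · exact hB ⟨_, _, hv⟩

/-- The weight of a column as a function of the position. -/
def massFun (ρ c : ℝ) : Col → ℝ
  | .O => max 0 (1 - 2 * ρ)
  | .A n => max 0 (min (2 * (ρ - |c - n * ρ|)) (min (1 - 2 * |c - n * ρ|) (2 * (1 - ρ))))
  | .M n => max 0 (min (2 * ρ - 1) (min (2 * (c - n * ρ)) (2 * (ρ - (c - n * ρ)))))
  | .B n => max 0 (2 * ρ - 1 - 2 * |c - n * ρ|)

theorem massFun_A_of_le {ρ c : ℝ} {n : ℤ} (h : ρ ≤ |c - n * ρ|) : massFun ρ c (.A n) = 0 :=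
  max_eq_left (min_le_of_left_le (by linarith))

theorem massFun_B_of_le {ρ c : ℝ} {n : ℤ} (h : ρ ≤ |c - n * ρ|) : massFun ρ c (.B n) = 0 :=
  max_eq_left (by linarith)

theorem massFun_M_of_le {ρ c : ℝ} {n : ℤ} (h : c - n * ρ ≤ 0 ∨ ρ ≤ c - n * ρ) :
    massFun ρ c (.M n) = 0 := by
  rcases h with h | h
  · exact max_eq_left (min_le_of_right_le (min_le_of_left_le (by linarith)))
  · exact max_eq_left (min_le_of_right_le (min_le_of_right_le (by linarith)))

/-- The base point lies in sector n, so every column with another index than n or n + 1 is so far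
away that its coordinate function vanishes by `massFun_A_of_le`, `massFun_M_of_le` or
`massFun_B_of_le`. -/
theorem sub_mul_cases {ρ c : ℝ} {n : ℤ} (hρ : 0 ≤ ρ) (h0 : 0 ≤ c - n * ρ) (h1 : c - n * ρ ≤ ρ)
    (k : ℤ) : k = n ∨ k = n + 1 ∨ (k ≠ n ∧ k ≠ n + 1 ∧ ρ ≤ |c - k * ρ| ∧
      (c - k * ρ ≤ 0 ∨ ρ ≤ c - k * ρ)) := by
  rcases lt_trichotomy k n with h | h | h
  · right; right
    have h2 : (k : ℝ) + 1 ≤ n := by exact_mod_cast h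
    have h3 : ρ ≤ c - k * ρ := by nlinarith
    exact ⟨by omega, by omega, h3.trans (le_abs_self _), Or.inr h3⟩
  · exact Or.inl h
  · right
    rcases eq_or_lt_of_le (show n + 1 ≤ k from h) with h' | h'
    · exact Or.inl h'.symm
    · right
      have h2 : (n : ℝ) + 1 + 1 ≤ k := by exact_mod_cast h'
      have h3 : c - k * ρ ≤ -ρ := by nlinarith
      exact ⟨by omega, by omega, (by linarith : ρ ≤ -(c - k * ρ)).trans (neg_le_abs _),
        Or.inl (by linarith)⟩

theorem LPoint.sum_mass {x : LVert →₀ ℝ} (hx : LPoint x) {K : Finset Col}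
    (h : ∀ v ∈ x.support, col v ∈ K) : ∑ k ∈ K, mass x k = 1 := by
  have := lin_col (fun _ => 1) x K h
  simp only [mul_one] at this
  rw [← this, lin]
  simpa only [mul_one, Finsupp.sum] using hx.2.2

/-- Total mass 1, `posR` and `posC` are three linear equations for the masses of the three columns
of the triangle. Solving them gives the affine piece of `massFun` valid there; all other columns
must be checked to get 0. The remaining three triangles follow the same pattern. -/
theorem LPoint.mass_eq_tri0 {x : LVert →₀ ℝ} (hx : LPoint x) {n : ℤ}
    (h : ∀ v ∈ x.support, col v ∈ baseTri n 0) (k : Col) :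
    mass x k = massFun (posR x) (posC x) k := by
  have h1 := hx.sum_mass h
  have hR : posR x = _ := lin_col crho x _ h
  have hC : posC x = _ := lin_col cang x _ h
  have hz : k ∉ baseTri n 0 → mass x k = 0 := fun hk =>
    mass_eq_zero fun v hv he => hk (he ▸ h v hv)
  have nn := hx.mass_nonneg
  generalize posR x = ρ at *
  generalize posC x = c at *
  have na := nn .O
  have nb := nn (.A n)
  have nc := nn (.A (n + 1))
  simp [baseTri, crho, cang] at h1 hR hC hz
  have hc0 : c - n * ρ = mass x (.A (n + 1)) / 2 := by rw [hR, hC]; ring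
  have hc1 : c - (n + 1) * ρ = - (mass x (.A n) / 2) := by rw [hR, hC]; ring
  have cs := sub_mul_cases (ρ := ρ) (c := c) (n := n) (by linarith) (by linarith) (by linarith)
  have ha0 : |c - n * ρ| = mass x (.A (n + 1)) / 2 := by rw [hc0, abs_of_nonneg (by linarith)]
  have ha1 : |c - (n + 1) * ρ| = mass x (.A n) / 2 := by
    rw [hc1, abs_neg, abs_of_nonneg (by linarith)]
  rcases k with _ | k | k | k
  · simp only [massFun, max_def]; split_ifs <;> linarith
  · rcases cs k with rfl | rfl | ⟨q1, q2, q3, q4⟩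
    · simp only [massFun, ha0, max_def, min_def]; split_ifs <;> linarith
    · simp only [massFun, ha1, Int.cast_add, Int.cast_one, max_def, min_def]
      split_ifs <;> linarith
    · rw [massFun_A_of_le q3, hz (by simp) (by simpa using q1) (by simpa using q2)]
  · rw [hz (by simp) (by simp) (by simp)]
    simp only [massFun, max_def, min_def]; split_ifs <;> linarith
  · rw [hz (by simp) (by simp) (by simp)]
    have := abs_nonneg (c - k * ρ)
    simp only [massFun, max_def]; split_ifs <;> linarith

theorem LPoint.mass_eq_tri1 {x : LVert →₀ ℝ} (hx : LPoint x) {n : ℤ}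
    (h : ∀ v ∈ x.support, col v ∈ baseTri n 1) (k : Col) :
    mass x k = massFun (posR x) (posC x) k := by
  have h1 := hx.sum_mass h
  have hR : posR x = _ := lin_col crho x _ h
  have hC : posC x = _ := lin_col cang x _ h
  have hz : k ∉ baseTri n 1 → mass x k = 0 := fun hk =>
    mass_eq_zero fun v hv he => hk (he ▸ h v hv)
  have nn := hx.mass_nonneg
  generalize posR x = ρ at *
  generalize posC x = c at *
  have na := nn (.A n)
  have nb := nn (.A (n + 1))
  have nc := nn (.M n)
  simp [baseTri, crho, cang] at h1 hR hC hz
  have hc0 : c - n * ρ = mass x (.A (n + 1)) / 2 + mass x (.M n) / 2 := by rw [hR, hC]; ring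
  have hc1 : c - (n + 1) * ρ = - (mass x (.A n) / 2 + mass x (.M n) / 2) := by
    rw [hR, hC]; ring
  have cs := sub_mul_cases (ρ := ρ) (c := c) (n := n) (by linarith) (by linarith) (by linarith)
  have ha0 : |c - n * ρ| = mass x (.A (n + 1)) / 2 + mass x (.M n) / 2 := by
    rw [hc0, abs_of_nonneg (by linarith)]
  have ha1 : |c - (n + 1) * ρ| = mass x (.A n) / 2 + mass x (.M n) / 2 := by
    rw [hc1, abs_neg, abs_of_nonneg (by linarith)]
  rcases k with _ | k | k | k
  · rw [hz (by simp) (by simp) (by simp)]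
    simp only [massFun, max_def]; split_ifs <;> linarith
  · rcases cs k with rfl | rfl | ⟨q1, q2, q3, q4⟩
    · simp only [massFun, ha0, max_def, min_def]; split_ifs <;> linarith
    · simp only [massFun, ha1, Int.cast_add, Int.cast_one, max_def, min_def]
      split_ifs <;> linarith
    · rw [massFun_A_of_le q3, hz (by simpa using q1) (by simpa using q2) (by simp)]
  · rcases cs k with rfl | rfl | ⟨q1, q2, q3, q4⟩
    · simp only [massFun, hc0, max_def, min_def]; split_ifs <;> linarith
    · rw [massFun_M_of_le (Or.inl (by push_cast; linarith)),
        hz (by simp) (by simp) (by simp)]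
    · rw [massFun_M_of_le q4, hz (by simp) (by simp) (by simpa using q1)]
  · rw [hz (by simp) (by simp) (by simp)]
    rcases cs k with rfl | rfl | ⟨q1, q2, q3, q4⟩
    · simp only [massFun, ha0, max_def]; split_ifs <;> linarith
    · simp only [massFun, ha1, Int.cast_add, Int.cast_one, max_def]; split_ifs <;> linarith
    · rw [massFun_B_of_le q3]

theorem LPoint.mass_eq_tri2 {x : LVert →₀ ℝ} (hx : LPoint x) {n : ℤ}
    (h : ∀ v ∈ x.support, col v ∈ baseTri n 2) (k : Col) :
    mass x k = massFun (posR x) (posC x) k := by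
  have h1 := hx.sum_mass h
  have hR : posR x = _ := lin_col crho x _ h
  have hC : posC x = _ := lin_col cang x _ h
  have hz : k ∉ baseTri n 2 → mass x k = 0 := fun hk =>
    mass_eq_zero fun v hv he => hk (he ▸ h v hv)
  have nn := hx.mass_nonneg
  generalize posR x = ρ at *
  generalize posC x = c at *
  have na := nn (.A n)
  have nb := nn (.M n)
  have nc := nn (.B n)
  simp [baseTri, crho, cang] at h1 hR hC hz
  have hc0 : c - n * ρ = mass x (.M n) / 2 := by rw [hR, hC]; ring
  have hc1 : c - (n + 1) * ρ = - (ρ - mass x (.M n) / 2) := by rw [← hc0]; ring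
  have cs := sub_mul_cases (ρ := ρ) (c := c) (n := n) (by linarith) (by linarith) (by linarith)
  have ha0 : |c - n * ρ| = mass x (.M n) / 2 := by
    rw [hc0, abs_of_nonneg (by linarith)]
  have ha1 : |c - (n + 1) * ρ| = ρ - mass x (.M n) / 2 := by
    rw [hc1, abs_neg, abs_of_nonneg (by linarith)]
  rcases k with _ | k | k | k
  · rw [hz (by simp) (by simp) (by simp)]
    simp only [massFun, max_def]; split_ifs <;> linarith
  · rcases cs k with rfl | rfl | ⟨q1, q2, q3, q4⟩
    · simp only [massFun, ha0, max_def, min_def]; split_ifs <;> linarith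
    · rw [hz (by simp) (by simp) (by simp)]
      simp only [massFun, ha1, Int.cast_add, Int.cast_one, max_def, min_def]
      split_ifs <;> linarith
    · rw [massFun_A_of_le q3, hz (by simpa using q1) (by simp) (by simp)]
  · rcases cs k with rfl | rfl | ⟨q1, q2, q3, q4⟩
    · simp only [massFun, hc0, max_def, min_def]; split_ifs <;> linarith
    · rw [massFun_M_of_le (Or.inl (by push_cast; linarith)),
        hz (by simp) (by simp) (by simp)]
    · rw [massFun_M_of_le q4, hz (by simp) (by simpa using q1) (by simp)]
  · rcases cs k with rfl | rfl | ⟨q1, q2, q3, q4⟩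
    · simp only [massFun, ha0, max_def]; split_ifs <;> linarith
    · rw [hz (by simp) (by simp) (by simp)]
      simp only [massFun, ha1, Int.cast_add, Int.cast_one, max_def]; split_ifs <;> linarith
    · rw [massFun_B_of_le q3, hz (by simp) (by simp) (by simpa using q1)]

theorem LPoint.mass_eq_tri3 {x : LVert →₀ ℝ} (hx : LPoint x) {n : ℤ}
    (h : ∀ v ∈ x.support, col v ∈ baseTri n 3) (k : Col) :
    mass x k = massFun (posR x) (posC x) k := by
  have h1 := hx.sum_mass h
  have hR : posR x = _ := lin_col crho x _ h
  have hC : posC x = _ := lin_col cang x _ h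
  have hz : k ∉ baseTri n 3 → mass x k = 0 := fun hk =>
    mass_eq_zero fun v hv he => hk (he ▸ h v hv)
  have nn := hx.mass_nonneg
  generalize posR x = ρ at *
  generalize posC x = c at *
  have na := nn (.A (n + 1))
  have nb := nn (.M n)
  have nc := nn (.B (n + 1))
  simp [baseTri, crho, cang] at h1 hR hC hz
  have hc1 : c - (n + 1) * ρ = - (mass x (.M n) / 2) := by rw [hR, hC]; ring
  have hc0 : c - n * ρ = ρ - mass x (.M n) / 2 := by linarith
  have cs := sub_mul_cases (ρ := ρ) (c := c) (n := n) (by linarith) (by linarith) (by linarith)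
  have ha0 : |c - n * ρ| = ρ - mass x (.M n) / 2 := by
    rw [hc0, abs_of_nonneg (by linarith)]
  have ha1 : |c - (n + 1) * ρ| = mass x (.M n) / 2 := by
    rw [hc1, abs_neg, abs_of_nonneg (by linarith)]
  rcases k with _ | k | k | k
  · rw [hz (by simp) (by simp) (by simp)]
    simp only [massFun, max_def]; split_ifs <;> linarith
  · rcases cs k with rfl | rfl | ⟨q1, q2, q3, q4⟩
    · rw [hz (by simp) (by simp) (by simp)]
      simp only [massFun, ha0, max_def, min_def]; split_ifs <;> linarith
    · simp only [massFun, ha1, Int.cast_add, Int.cast_one, max_def, min_def]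
      split_ifs <;> linarith
    · rw [massFun_A_of_le q3, hz (by simpa using q2) (by simp) (by simp)]
  · rcases cs k with rfl | rfl | ⟨q1, q2, q3, q4⟩
    · simp only [massFun, hc0, max_def, min_def]; split_ifs <;> linarith
    · rw [massFun_M_of_le (Or.inl (by push_cast; linarith)),
        hz (by simp) (by simp) (by simp)]
    · rw [massFun_M_of_le q4, hz (by simp) (by simpa using q1) (by simp)]
  · rcases cs k with rfl | rfl | ⟨q1, q2, q3, q4⟩
    · rw [hz (by simp) (by simp) (by simp)]
      simp only [massFun, ha0, max_def]; split_ifs <;> linarith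
    · simp only [massFun, ha1, Int.cast_add, Int.cast_one, max_def]; split_ifs <;> linarith
    · rw [massFun_B_of_le q3, hz (by simp) (by simp) (by simpa using q2)]

/-- The column weights of a point are determined by its position. -/
theorem LPoint.mass_eq {x : LVert →₀ ℝ} (hx : LPoint x) (k : Col) :
    mass x k = massFun (posR x) (posC x) k := by
  obtain ⟨n, τ, h⟩ := hx.1.exists_baseTri
  fin_cases τ
  · exact hx.mass_eq_tri0 h k
  · exact hx.mass_eq_tri1 h k
  · exact hx.mass_eq_tri2 h k
  · exact hx.mass_eq_tri3 h k


/-! ### A point of the lifted complex is determined by its position. -/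

open LVert

theorem near_col {u v : LVert} (h : Near u v) (hc : col u = col v) :
    ht u ≤ ht v + 1 ∧ ht v ≤ ht u + 1 := by
  cases u <;> cases v <;> simp [Near, col, ht] at h hc ⊢ <;> omega

/-- Edges between two columns do not cross. -/
theorem near_noncrossing {v v' w w' : LVert} (hv : col v = col v') (hw : col w = col w')
    (hne : col v ≠ col w) (h : Near v w) (h' : Near v' w') (hlt : ht v < ht v') :
    ht w ≤ ht w' := by
  cases v <;> cases v' <;> simp only [col, reduceCtorEq, Col.A.injEq, Col.M.injEq, Col.B.injEq] at hv <;>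
  cases w <;> cases w' <;>
    simp only [Near, col, ht, ne_eq, Col.A.injEq, Col.M.injEq, Col.B.injEq, reduceCtorEq,
      not_true_eq_false] at * <;>
    omega

/-- A point is determined by the total weights and heights of the columns. -/
theorem LPoint.apply_eq {x : LVert →₀ ℝ} (hx : LPoint x) (v : LVert) :
    x v = max 0 (mass x (col v) - |hsum x (col v) - ht v * mass x (col v)|) := by
  have e : hsum x (col v) - ht v * mass x (col v) =
      ∑ w ∈ x.support with col w = col v, x w * (ht w - ht v) := by
    simp only [hsum, mass, Finset.mul_sum, ← Finset.sum_sub_distrib]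
    exact Finset.sum_congr rfl fun w _ => by ring
  -- A face meets a column in at most two consecutive vertices, so the support in this column lies
  -- on one side of v, recorded by the sign s. If v carries weight, the only other vertex is at
  -- distance 1 and the difference is exactly x v; otherwise all distances are at least 1, the
  -- difference is not positive, and the maximum returns 0.
  have key : ∀ s : ℝ, (∀ w ∈ x.support, col w = col v → ∀ u ∈ x.support, col u = col v →
      0 ≤ s * (ht w - ht v)) → s = 1 ∨ s = -1 → 
      x v = max 0 (mass x (col v) - |hsum x (col v) - ht v * mass x (col v)|) := by
    intro s hs h1
    have ha : |hsum x (col v) - ht v * mass x (col v)| =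
        ∑ w ∈ x.support with col w = col v, x w * (s * (ht w - ht v)) := by
      have h2 : ∑ w ∈ x.support with col w = col v, x w * (s * (ht w - ht v)) =
          s * (hsum x (col v) - ht v * mass x (col v)) := by
        rw [e, Finset.mul_sum]
        exact Finset.sum_congr rfl fun w _ => by ring
      have h3 : 0 ≤ s * (hsum x (col v) - ht v * mass x (col v)) := by
        rw [← h2]
        refine Finset.sum_nonneg fun w hw => mul_nonneg (hx.2.1 w) ?_
        rw [Finset.mem_filter] at hw
        exact hs w hw.1 hw.2 w hw.1 hw.2
      rw [h2]
      rcases h1 with rfl | rfl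
      · rw [one_mul] at h3 ⊢
        exact abs_of_nonneg h3
      · rw [neg_one_mul] at h3 ⊢
        exact abs_of_nonpos (by linarith)
    rw [ha, mass, ← Finset.sum_sub_distrib]
    by_cases hv : v ∈ x.support
    · rw [Finset.sum_eq_single v]
      · simp [hx.2.1 v]
      · intro w hw hne
        rw [Finset.mem_filter] at hw
        have h4 := near_col (hx.1.2 w hw.1 v hv) hw.2
        have h5 : ht w ≠ ht v := fun h => hne (eq_of_col_ht hw.2 h)
        have h6 := hs w hw.1 hw.2 v hv rfl
        have h7 : s * ((ht w : ℝ) - ht v) = 1 := by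
          rcases h1 with rfl | rfl
          · have : (0 : ℝ) ≤ ((ht w - ht v : ℤ) : ℝ) := by push_cast; linarith
            have h8 : 0 ≤ ht w - ht v := by exact_mod_cast this
            have : ht w = ht v + 1 := by omega
            rw [this]; push_cast; ring
          · have : (0 : ℝ) ≤ ((ht v - ht w : ℤ) : ℝ) := by push_cast; linarith
            have h8 : 0 ≤ ht v - ht w := by exact_mod_cast this
            have : ht w = ht v - 1 := by omega
            rw [this]; push_cast; ring
        rw [h7]; ring
      · intro h; simp [hv] at h
    · rw [Finsupp.notMem_support_iff.1 hv]
      symm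
      refine max_eq_left (Finset.sum_nonpos fun w hw => ?_)
      rw [Finset.mem_filter] at hw
      have h5 : ht w ≠ ht v := fun h => hv (eq_of_col_ht hw.2 h ▸ hw.1)
      have h6 := hs w hw.1 hw.2 w hw.1 hw.2
      have h7 : 1 ≤ s * ((ht w : ℝ) - ht v) := by
        rcases h1 with rfl | rfl
        · have : (0 : ℝ) ≤ ((ht w - ht v : ℤ) : ℝ) := by push_cast; linarith
          have h8 : 0 ≤ ht w - ht v := by exact_mod_cast this
          have : ht v + 1 ≤ ht w := by omega
          have : (ht v : ℝ) + 1 ≤ ht w := by exact_mod_cast this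
          linarith
        · have : (0 : ℝ) ≤ ((ht v - ht w : ℤ) : ℝ) := by push_cast; linarith
          have h8 : 0 ≤ ht v - ht w := by exact_mod_cast this
          have : ht w + 1 ≤ ht v := by omega
          have : (ht w : ℝ) + 1 ≤ ht v := by exact_mod_cast this
          linarith
      nlinarith [hx.2.1 w]
  by_cases hup : ∀ w ∈ x.support, col w = col v → ht v ≤ ht w
  · refine key 1 (fun w hw hc _ _ _ => ?_) (Or.inl rfl)
    have : (ht v : ℝ) ≤ ht w := by exact_mod_cast hup w hw hc
    linarith
  · push Not at hup
    obtain ⟨u, hu, hc, hlt⟩ := hup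
    refine key (-1) (fun w hw hc' _ _ _ => ?_) (Or.inr rfl)
    have h1 := near_col (hx.1.2 w hw u hu) (hc'.trans hc.symm)
    have : (ht w : ℝ) ≤ ht v := by
      have : ht w ≤ ht v := by omega
      exact_mod_cast this
    linarith

/-- If a column has smaller total height, then some vertex lies lower. -/
theorem exists_ht_lt {x x' : LVert →₀ ℝ} (hx : LPoint x) (hx' : LPoint x') {k : Col}
    (hm : mass x k = mass x' k) (h : hsum x k < hsum x' k) :
    ∃ v ∈ x.support, ∃ v' ∈ x'.support, col v = k ∧ col v' = k ∧ ht v < ht v' := by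
  by_contra! hcon
  by_cases he : ∃ v ∈ x.support, col v = k
  · obtain ⟨v₀, hv₀, hc₀⟩ := he
    obtain ⟨v, hv, hmin⟩ := Finset.exists_min_image (x.support.filter fun v => col v = k) ht
      ⟨v₀, by simp only [Finset.mem_filter]; exact ⟨hv₀, hc₀⟩⟩
    rw [Finset.mem_filter] at hv
    have h1 : ht v * mass x k ≤ hsum x k := by
      rw [mass, hsum, Finset.mul_sum]
      refine Finset.sum_le_sum fun w hw => ?_
      have : (ht v : ℝ) ≤ ht w := by exact_mod_cast hmin w hw
      nlinarith [hx.2.1 w]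
    have h2 : hsum x' k ≤ ht v * mass x' k := by
      rw [mass, hsum, Finset.mul_sum]
      refine Finset.sum_le_sum fun w hw => ?_
      rw [Finset.mem_filter] at hw
      have : (ht w : ℝ) ≤ ht v := by exact_mod_cast hcon v hv.1 w hw.1 hv.2 hw.2
      nlinarith [hx'.2.1 w]
    rw [hm] at h1
    linarith
  · push Not at he
    have h0 : mass x k = 0 := mass_eq_zero he
    have h1 : hsum x k = 0 := Finset.sum_eq_zero fun v hv =>
      absurd (Finset.mem_filter.1 hv).2 (he v (Finset.mem_filter.1 hv).1)
    have h2 : hsum x' k = 0 := by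
      refine Finset.sum_eq_zero fun v hv => ?_
      rw [hm] at h0
      rw [(Finset.sum_eq_zero_iff_of_nonneg fun w _ => hx'.2.1 w).1 h0 v hv, zero_mul]
    linarith

/-- A point of the lifted complex is determined by its position. -/
theorem LPoint.eq_of_pos_eq {x x' : LVert →₀ ℝ} (hx : LPoint x) (hx' : LPoint x')
    (hA : posA x = posA x') (hR : posR x = posR x') (hC : posC x = posC x') : x = x' := by
  have hm : ∀ k, mass x k = mass x' k := fun k => by rw [hx.mass_eq, hx'.mass_eq, hR, hC]
  have hh : ∀ k, hsum x k = hsum x' k := by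
    -- If x were lower than x' in one column and higher in another, an edge of the carrier of x and
    -- one of the carrier of x' would cross between these columns. So the column heights are
    -- comparable all at once, and equality of their positively weighted sum `posA` forces equality
    -- in every column.
    have hcomp : (∀ k, hsum x k ≤ hsum x' k) ∨ (∀ k, hsum x' k ≤ hsum x k) := by
      by_contra! hcon
      obtain ⟨⟨k, hk⟩, ⟨l, hl⟩⟩ := hcon
      have hkl : l ≠ k := by rintro rfl; linarith
      obtain ⟨v, hv, v', hv', c1, c2, hlt⟩ := exists_ht_lt hx hx' (hm l) hl
      obtain ⟨w', hw', w, hw, c3, c4, hlt'⟩ := exists_ht_lt hx' hx (hm k).symm hk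
      have := near_noncrossing (c1.trans c2.symm) (c4.trans c3.symm)
        (by rw [c1, c4]; exact hkl) (hx.1.2 v hv w hw) (hx'.1.2 v' hv' w' hw') hlt
      omega
    classical
    let K : Finset Col := x.support.image col ∪ x'.support.image col
    have e1 := posA_eq x K fun v hv => Finset.mem_union_left _ (Finset.mem_image_of_mem col hv)
    have e2 := posA_eq x' K fun v hv => Finset.mem_union_right _ (Finset.mem_image_of_mem col hv)
    have hK : ∀ k ∈ K, gap k * hsum x k = gap k * hsum x' k := by
      rcases hcomp with h | h
      · exact (Finset.sum_eq_sum_iff_of_le fun k _ =>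
          mul_le_mul_of_nonneg_left (h k) (gap_pos k).le).1 (by rw [← e1, ← e2, hA])
      · exact fun k hk => ((Finset.sum_eq_sum_iff_of_le fun k _ =>
          mul_le_mul_of_nonneg_left (h k) (gap_pos k).le).1 (by rw [← e1, ← e2, hA]) k hk).symm
    intro k
    by_cases hk : k ∈ K
    · exact mul_left_cancel₀ (gap_pos k).ne' (hK k hk)
    · have z : ∀ y : LVert →₀ ℝ, y.support.image col ⊆ K → hsum y k = 0 := fun y hy =>
        Finset.sum_eq_zero fun v hv => absurd (hy (Finset.mem_image_of_mem col
          (Finset.mem_filter.1 hv).1)) (by rwa [(Finset.mem_filter.1 hv).2])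
      rw [z x Finset.subset_union_left, z x' Finset.subset_union_right]
  ext v
  rw [hx.apply_eq, hx'.apply_eq, hm, hh]


/-! ### Deck transformations in coordinates, and existence of points at every position. -/

open LVert

theorem lin_eq_sum (f : LVert → ℝ) (x : LVert →₀ ℝ) : lin f x = x.sum fun v t => t * f v := rfl

theorem lin_add (f : LVert → ℝ) (x y : LVert →₀ ℝ) : lin f (x + y) = lin f x + lin f y := by
  simp only [lin_eq_sum]
  exact Finsupp.sum_add_index' (fun _ => zero_mul _) (fun _ _ _ => add_mul _ _ _)

theorem lin_single (f : LVert → ℝ) (v : LVert) (t : ℝ) : lin f (.single v t) = t * f v := by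
  rw [lin_eq_sum]
  exact Finsupp.sum_single_index (zero_mul _)

theorem lin_mapDomain (f : LVert → ℝ) (γ : LVert → LVert) (x : LVert →₀ ℝ) :
    lin f (x.mapDomain γ) = lin (fun v => f (γ v)) x := by
  simp only [lin_eq_sum]
  exact Finsupp.sum_mapDomain_index (fun _ => zero_mul _) (fun _ _ _ => add_mul _ _ _)

theorem lin_one {x : LVert →₀ ℝ} (hx : LPoint x) : lin (fun _ => 1) x = 1 := by
  simpa [lin_eq_sum] using hx.2.2

theorem lin_fun_add (f g : LVert → ℝ) (x : LVert →₀ ℝ) :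
    lin (fun v => f v + g v) x = lin f x + lin g x := by
  simp only [lin, mul_add, Finset.sum_add_distrib]

theorem lin_fun_mul (t : ℝ) (f : LVert → ℝ) (x : LVert →₀ ℝ) :
    lin (fun v => t * f v) x = t * lin f x := by
  simp only [lin, Finset.mul_sum]
  exact Finset.sum_congr rfl fun v _ => by ring

theorem lin_congr {f g : LVert → ℝ} {x : LVert →₀ ℝ} (h : ∀ v ∈ x.support, f v = g v) :
    lin f x = lin g x :=
  Finset.sum_congr rfl fun v hv => by rw [h v hv]

theorem posA_shift {x : LVert →₀ ℝ} (hx : lin (fun _ => 1) x = 1) (k q : ℤ) :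
    posA (x.mapDomain (shift k q)) = posA x + q := by
  have : (fun v => gap (col (shift k q v)) * (ht (shift k q v) : ℝ)) =
      fun v => gap (col v) * ht v + q * 1 := by
    ext v
    cases v <;> simp [shift, col, gap, ht] <;> ring
  rw [posA, lin_mapDomain, this, lin_fun_add, lin_fun_mul, hx, mul_one, posA]

theorem posR_shift (x : LVert →₀ ℝ) (k q : ℤ) : posR (x.mapDomain (shift k q)) = posR x := by
  rw [posR, lin_mapDomain, posR]
  exact lin_congr fun v _ => by cases v <;> rfl

theorem posC_shift (x : LVert →₀ ℝ) (k q : ℤ) :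
    posC (x.mapDomain (shift k q)) = posC x + k * posR x := by
  rw [posC, lin_mapDomain, posC, posR, ← lin_fun_mul, ← lin_fun_add]
  exact lin_congr fun v _ => by cases v <;> simp [shift, col, cang, crho] <;> ring

theorem posR_of_isBd {x : LVert →₀ ℝ} (hx : LPoint x) (hb : ∀ v ∈ x.support, IsBd v) :
    posR x = 1 := by
  rw [posR, ← lin_one hx]
  exact lin_congr fun v hv => by
    have := hb v hv
    cases v <;> simp [IsBd, crho, col] at this ⊢

/-- The integer formulas in `fold` are the affine map a ↦ a − c + r evaluated at the boundary
vertices and divided by the spacing of the column; the rest is linearity. -/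
theorem posA_fold {x : LVert →₀ ℝ} (hx : LPoint x) (hb : ∀ v ∈ x.support, IsBd v) (r : ℤ) :
    posA (x.mapDomain (fold r)) = posA x - posC x + r := by
  have : lin (fun v => gap (col (fold r v)) * (ht (fold r v) : ℝ)) x =
      lin (fun v => gap (col v) * ht v + ((-1) * cang (col v) + r * 1)) x := by
    refine lin_congr fun v hv => ?_
    have := hb v hv
    cases v <;> simp [IsBd, fold, col, gap, ht, cang] at this ⊢ <;> ring
  rw [posA, lin_mapDomain, this, lin_fun_add, lin_fun_add, lin_fun_mul, lin_fun_mul, lin_one hx,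
    posA, posC]
  ring

theorem posC_fold {x : LVert →₀ ℝ} (hx : LPoint x) (hb : ∀ v ∈ x.support, IsBd v) (r : ℤ) :
    posC (x.mapDomain (fold r)) = r - posC x := by
  have : lin (fun v => cang (col (fold r v))) x =
      lin (fun v => (-1) * cang (col v) + r * 1) x := by
    refine lin_congr fun v hv => ?_
    have := hb v hv
    cases v <;> simp [IsBd, fold, col, cang] at this ⊢ <;> ring
  rw [posC, lin_mapDomain, this, lin_fun_add, lin_fun_mul, lin_fun_mul, lin_one hx, posC]
  ring

theorem LPoint.shift {x : LVert →₀ ℝ} (hx : LPoint x) (k q : ℤ) :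
    LPoint (x.mapDomain (shift k q)) := by
  have hi := shift_injective k q
  refine ⟨?_, fun v => ?_, ?_⟩
  · rw [Finsupp.mapDomain_support_of_injective hi]
    refine ⟨hx.1.1.image _, ?_⟩
    simp only [Finset.mem_image]
    rintro _ ⟨u, hu, rfl⟩ _ ⟨v, hv, rfl⟩
    exact (near_shift _ _ _ _).2 (hx.1.2 u hu v hv)
  · by_cases hv : v ∈ Set.range (Prism.shift k q)
    · obtain ⟨u, rfl⟩ := hv
      rw [Finsupp.mapDomain_apply hi]
      exact hx.2.1 u
    · rw [Finsupp.mapDomain_of_notMem_range _ _ hv]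
  · rw [Finsupp.sum_mapDomain_index (fun _ => rfl) (fun _ _ _ => rfl)]
    exact hx.2.2

/-- The height of a lifted vertex. -/
def alt (v : LVert) : ℝ := gap (col v) * ht v

/-- Every point over a given base point, with height between those of two states, is a point of
the lifted complex. -/
def Covers (α β γ : ℝ) (u v w u' v' w' : LVert) : Prop :=
  ∀ a, α * alt u + β * alt v + γ * alt w ≤ a → a ≤ α * alt u' + β * alt v' + γ * alt w' →
    ∃ x, LPoint x ∧ posA x = a ∧
      posR x = α * crho (col u) + β * crho (col v) + γ * crho (col w) ∧
      posC x = α * cang (col u) + β * cang (col v) + γ * cang (col w)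

/-- Lets any of the three columns play the role of the one that `Tet.covers` raises. -/
theorem Covers.perm {α β γ : ℝ} {u v w u' v' w' : LVert} (h : Covers α β γ u v w u' v' w') :
    Covers β γ α v w u v' w' u' := by
  intro a h1 h2
  obtain ⟨x, hx, e1, e2, e3⟩ := h a (by linarith) (by linarith)
  exact ⟨x, hx, e1, by rw [e2]; ring, by rw [e3]; ring⟩

theorem Covers.trans {α β γ : ℝ} {u v w u' v' w' u'' v'' w'' : LVert}
    (h : Covers α β γ u v w u' v' w') (h' : Covers α β γ u' v' w' u'' v'' w'')
    (hc : col u' = col u ∧ col v' = col v ∧ col w' = col w) :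
    Covers α β γ u v w u'' v'' w'' := by
  intro a h1 h2
  rcases le_total a (α * alt u' + β * alt v' + γ * alt w') with h3 | h3
  · exact h a h1 h3
  · have := h' a h3 h2
    rwa [hc.1, hc.2.1, hc.2.2] at this

/-- The tetrahedron with vertices `u`, `v`, `w`, `u'`, where `u'` lies above `u`. -/
def Tet (u u' v w : LVert) : Prop :=
  (col u' = col u ∧ ht u' = ht u + 1) ∧ Near u u' ∧ Near u v ∧ Near u w ∧ Near u' v ∧ Near u' w ∧
    Near v w

instance (u u' v w : LVert) : Decidable (Tet u u' v w) := by unfold Tet; infer_instance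

/-- Over a fixed base point the tetrahedron is a vertical segment: transferring weight t ≤ α from u
to u' raises the height by t times the spacing and leaves `posR` and `posC` unchanged. -/
theorem Tet.covers {α β γ : ℝ} (hβ : 0 ≤ β) (hγ : 0 ≤ γ) (hs : α + β + γ = 1)
    {u u' v w : LVert} (h : Tet u u' v w) : Covers α β γ u v w u' v w := by
  intro a h1 h2
  obtain ⟨⟨hc, hh⟩, n1, n2, n3, n4, n5, n6⟩ := h
  have hg := gap_pos (col u)
  have e : alt u' = alt u + gap (col u) := by
    rw [alt, alt, hc, hh]; push_cast; ring
  let t := (a - (α * alt u + β * alt v + γ * alt w)) / gap (col u)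
  have ht : t * gap (col u) = a - (α * alt u + β * alt v + γ * alt w) :=
    div_mul_cancel₀ _ hg.ne'
  have t0 : 0 ≤ t := div_nonneg (by linarith) hg.le
  have t1 : t ≤ α := by
    rw [e] at h2
    exact (div_le_iff₀ hg).2 (by linarith)
  let x : LVert →₀ ℝ := .single u (α - t) + .single u' t + .single v β + .single w γ
  have hl : ∀ f : LVert → ℝ, lin f x = (α - t) * f u + t * f u' + β * f v + γ * f w := by
    intro f
    simp only [x, lin_add, lin_single]
  have hsub : x.support ⊆ {u, u', v, w} := by
    refine (Finsupp.support_add.trans (Finset.union_subset_union (Finsupp.support_add.trans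
      (Finset.union_subset_union (Finsupp.support_add.trans (Finset.union_subset_union
        Finsupp.support_single_subset Finsupp.support_single_subset))
        Finsupp.support_single_subset)) Finsupp.support_single_subset)).trans ?_
    intro y
    simp only [Finset.mem_union, Finset.mem_singleton, Finset.mem_insert]
    tauto
  have hone : lin (fun _ => 1) x = 1 := by rw [hl]; linarith
  refine ⟨x, ⟨⟨?_, ?_⟩, ?_, ?_⟩, ?_, ?_, ?_⟩
  · rw [Finset.nonempty_iff_ne_empty]
    intro h0
    simp [lin, h0] at hone
  · intro y hy z hz
    have hy := hsub hy
    have hz := hsub hz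
    simp only [Finset.mem_singleton, Finset.mem_insert] at hy hz
    rcases hy with rfl | rfl | rfl | rfl <;> rcases hz with rfl | rfl | rfl | rfl <;>
    first
      | exact Near.refl _
      | assumption
      | (apply Near.symm; assumption)
  · intro y
    have s : ∀ (p : LVert) {s : ℝ}, 0 ≤ s → 0 ≤ (Finsupp.single p s : LVert →₀ ℝ) y :=
      fun p s hs => by
        rw [Finsupp.single_apply]
        split_ifs <;> simp [hs]
    simp only [x, Finsupp.add_apply]
    have := s u (sub_nonneg.2 t1)
    have := s u' t0
    have := s v hβ
    have := s w hγ
    linarith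
  · rw [← hone, lin_eq_sum]
    simp
  · have : posA x = (α - t) * alt u + t * alt u' + β * alt v + γ * alt w := hl alt
    rw [this, e]
    linarith
  · have : posR x = _ := hl (fun v => crho (col v))
    rw [this, hc]
    ring
  · have : posC x = _ := hl (fun v => cang (col v))
    rw [this, hc]
    ring

theorem covers_fst {α β γ : ℝ} (hβ : 0 ≤ β) (hγ : 0 ≤ γ) (hs : α + β + γ = 1)
    {u u' v w : LVert} (h : Tet u u' v w) : Covers α β γ u v w u' v w :=
  h.covers hβ hγ hs

theorem covers_snd {α β γ : ℝ} (hα : 0 ≤ α) (hγ : 0 ≤ γ) (hs : α + β + γ = 1)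
    {u u' v w : LVert} (h : Tet u u' v w) : Covers α β γ w u v w u' v :=
  (h.covers hγ hα (by linarith)).perm.perm

theorem covers_trd {α β γ : ℝ} (hα : 0 ≤ α) (hβ : 0 ≤ β) (hs : α + β + γ = 1)
    {u u' v w : LVert} (h : Tet u u' v w) : Covers α β γ v w u v w u' :=
  (h.covers hα hβ (by linarith)).perm

/-- Each step of the staircase raises one column by one vertex until all three have risen by height
1. The four staircases have 9, 8, 9 and 9 steps, that is 35 tetrahedra per sector and unit of
height. -/
theorem covers_tri0 {α β γ : ℝ} (hα : 0 ≤ α) (hβ : 0 ≤ β) (hγ : 0 ≤ γ) (hs : α + β + γ = 1) :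
    Covers α β γ (O (-1)) (A 0 (-1)) (A 1 (-1)) (O 2) (A 0 2) (A 1 2) := by
  refine Covers.trans (covers_fst hβ hγ hs (by decide : Tet (O (-1)) (O 0) (A 0 (-1)) (A 1 (-1))))
    ?_ (by decide)
  refine Covers.trans (covers_trd hα hβ hs (by decide : Tet (A 1 (-1)) (A 1 0) (O 0) (A 0 (-1))))
    ?_ (by decide)
  refine Covers.trans (covers_snd hα hγ hs (by decide : Tet (A 0 (-1)) (A 0 0) (A 1 0) (O 0)))
    ?_ (by decide)
  refine Covers.trans (covers_fst hβ hγ hs (by decide : Tet (O 0) (O 1) (A 0 0) (A 1 0)))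
    ?_ (by decide)
  refine Covers.trans (covers_trd hα hβ hs (by decide : Tet (A 1 0) (A 1 1) (O 1) (A 0 0)))
    ?_ (by decide)
  refine Covers.trans (covers_snd hα hγ hs (by decide : Tet (A 0 0) (A 0 1) (A 1 1) (O 1)))
    ?_ (by decide)
  refine Covers.trans (covers_fst hβ hγ hs (by decide : Tet (O 1) (O 2) (A 0 1) (A 1 1)))
    ?_ (by decide)
  refine Covers.trans (covers_trd hα hβ hs (by decide : Tet (A 1 1) (A 1 2) (O 2) (A 0 1)))
    ?_ (by decide)
  exact covers_snd hα hγ hs (by decide : Tet (A 0 1) (A 0 2) (A 1 2) (O 2))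

theorem covers_tri1 {α β γ : ℝ} (hα : 0 ≤ α) (hβ : 0 ≤ β) (hγ : 0 ≤ γ) (hs : α + β + γ = 1) :
    Covers α β γ (A 0 0) (A 1 1) (M 0 (-1)) (A 0 3) (A 1 4) (M 0 1) := by
  refine Covers.trans (covers_trd hα hβ hs (by decide : Tet (M 0 (-1)) (M 0 0) (A 0 0) (A 1 1)))
    ?_ (by decide)
  refine Covers.trans (covers_fst hβ hγ hs (by decide : Tet (A 0 0) (A 0 1) (A 1 1) (M 0 0)))
    ?_ (by decide)
  refine Covers.trans (covers_snd hα hγ hs (by decide : Tet (A 1 1) (A 1 2) (M 0 0) (A 0 1)))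
    ?_ (by decide)
  refine Covers.trans (covers_trd hα hβ hs (by decide : Tet (M 0 0) (M 0 1) (A 0 1) (A 1 2)))
    ?_ (by decide)
  refine Covers.trans (covers_fst hβ hγ hs (by decide : Tet (A 0 1) (A 0 2) (A 1 2) (M 0 1)))
    ?_ (by decide)
  refine Covers.trans (covers_snd hα hγ hs (by decide : Tet (A 1 2) (A 1 3) (M 0 1) (A 0 2)))
    ?_ (by decide)
  refine Covers.trans (covers_fst hβ hγ hs (by decide : Tet (A 0 2) (A 0 3) (A 1 3) (M 0 1)))
    ?_ (by decide)
  exact covers_snd hα hγ hs (by decide : Tet (A 1 3) (A 1 4) (M 0 1) (A 0 3))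

theorem covers_tri2 {α β γ : ℝ} (hα : 0 ≤ α) (hβ : 0 ≤ β) (hγ : 0 ≤ γ) (hs : α + β + γ = 1) :
    Covers α β γ (A 0 (-1)) (M 0 (-1)) (B 0 (-2)) (A 0 2) (M 0 1) (B 0 2) := by
  refine Covers.trans (covers_fst hβ hγ hs (by decide : Tet (A 0 (-1)) (A 0 0) (M 0 (-1)) (B 0 (-2))))
    ?_ (by decide)
  refine Covers.trans (covers_snd hα hγ hs (by decide : Tet (M 0 (-1)) (M 0 0) (B 0 (-2)) (A 0 0)))
    ?_ (by decide)
  refine Covers.trans (covers_trd hα hβ hs (by decide : Tet (B 0 (-2)) (B 0 (-1)) (A 0 0) (M 0 0)))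
    ?_ (by decide)
  refine Covers.trans (covers_trd hα hβ hs (by decide : Tet (B 0 (-1)) (B 0 0) (A 0 0) (M 0 0)))
    ?_ (by decide)
  refine Covers.trans (covers_fst hβ hγ hs (by decide : Tet (A 0 0) (A 0 1) (M 0 0) (B 0 0)))
    ?_ (by decide)
  refine Covers.trans (covers_snd hα hγ hs (by decide : Tet (M 0 0) (M 0 1) (B 0 0) (A 0 1)))
    ?_ (by decide)
  refine Covers.trans (covers_trd hα hβ hs (by decide : Tet (B 0 0) (B 0 1) (A 0 1) (M 0 1)))
    ?_ (by decide)
  refine Covers.trans (covers_fst hβ hγ hs (by decide : Tet (A 0 1) (A 0 2) (M 0 1) (B 0 1)))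
    ?_ (by decide)
  exact covers_trd hα hβ hs (by decide : Tet (B 0 1) (B 0 2) (A 0 2) (M 0 1))

theorem covers_tri3 {α β γ : ℝ} (hα : 0 ≤ α) (hβ : 0 ≤ β) (hγ : 0 ≤ γ) (hs : α + β + γ = 1) :
    Covers α β γ (A 1 (-1)) (M 0 (-1)) (B 1 (-2)) (A 1 2) (M 0 1) (B 1 2) := by
  refine Covers.trans (covers_fst hβ hγ hs (by decide : Tet (A 1 (-1)) (A 1 0) (M 0 (-1)) (B 1 (-2))))
    ?_ (by decide)
  refine Covers.trans (covers_trd hα hβ hs (by decide : Tet (B 1 (-2)) (B 1 (-1)) (A 1 0) (M 0 (-1))))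
    ?_ (by decide)
  refine Covers.trans (covers_trd hα hβ hs (by decide : Tet (B 1 (-1)) (B 1 0) (A 1 0) (M 0 (-1))))
    ?_ (by decide)
  refine Covers.trans (covers_fst hβ hγ hs (by decide : Tet (A 1 0) (A 1 1) (M 0 (-1)) (B 1 0)))
    ?_ (by decide)
  refine Covers.trans (covers_snd hα hγ hs (by decide : Tet (M 0 (-1)) (M 0 0) (B 1 0) (A 1 1)))
    ?_ (by decide)
  refine Covers.trans (covers_trd hα hβ hs (by decide : Tet (B 1 0) (B 1 1) (A 1 1) (M 0 0)))
    ?_ (by decide)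
  refine Covers.trans (covers_fst hβ hγ hs (by decide : Tet (A 1 1) (A 1 2) (M 0 0) (B 1 1)))
    ?_ (by decide)
  refine Covers.trans (covers_trd hα hβ hs (by decide : Tet (B 1 1) (B 1 2) (A 1 2) (M 0 0)))
    ?_ (by decide)
  exact covers_snd hα hγ hs (by decide : Tet (M 0 0) (M 0 1) (B 1 2) (A 1 2))

theorem Covers.exists_shift {α β γ : ℝ} {u v w u' v' w' : LVert}
    (h : Covers α β γ u v w u' v' w') (hs : α + β + γ = 1)
    (h' : alt u' = alt u + 1 ∧ alt v' = alt v + 1 ∧ alt w' = alt w + 1) {a ρ c : ℝ} {n : ℤ}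
    (hR : ρ = α * crho (col u) + β * crho (col v) + γ * crho (col w))
    (hC : c - n * ρ = α * cang (col u) + β * cang (col v) + γ * cang (col w)) :
    ∃ x, LPoint x ∧ posA x = a ∧ posR x = ρ ∧ posC x = c := by
  let F := α * alt u + β * alt v + γ * alt w
  have hF : α * alt u' + β * alt v' + γ * alt w' = F + 1 := by
    rw [h'.1, h'.2.1, h'.2.2]
    simp only [F]
    linear_combination hs
  -- The staircase covers the heights from F to F + 1; an integral translation brings a into this
  -- range.
  obtain ⟨x, hx, e1, e2, e3⟩ := h (a - ⌊a - F⌋) (by linarith [Int.floor_le (a - F)])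
    (by rw [hF]; linarith [Int.lt_floor_add_one (a - F)])
  refine ⟨_, hx.shift n ⌊a - F⌋, ?_, ?_, ?_⟩
  · rw [posA_shift (lin_one hx), e1]; ring
  · rw [posR_shift, e2, hR]
  · rw [posC_shift, e3, e2, ← hC, ← hR]; ring

/-- Every position in the solid torus is attained by a point of the lifted complex. -/
theorem exists_lPoint {a ρ c : ℝ} {n : ℤ} (hρ : ρ ≤ 1) (h0 : 0 ≤ c - n * ρ) (h1 : c - n * ρ ≤ ρ) :
    ∃ x, LPoint x ∧ posA x = a ∧ posR x = ρ ∧ posC x = c := by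
  -- The lines where ρ, c − nρ or ρ − (c − nρ) equals 1/2 cut the sector into the four base
  -- triangles; the three summands of each `hs` are the barycentric coordinates in the respective
  -- triangle.
  rcases le_or_gt ρ (1 / 2) with h2 | h2
  · have hs : (1 - 2 * ρ) + 2 * (ρ - (c - n * ρ)) + 2 * (c - n * ρ) = 1 := by ring
    exact (covers_tri0 (by linarith) (by linarith) (by linarith) hs).exists_shift (n := n) hs
      (by norm_num [alt, gap, col, ht]) (by simp [crho, col]; ring)
      (by simp [cang, col]; ring)
  rcases le_or_gt (c - n * ρ) (1 / 2) with h3 | h3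
  · rcases le_or_gt (ρ - (c - n * ρ)) (1 / 2) with h4 | h4
    · have hs : (1 - 2 * (c - n * ρ)) + (1 - 2 * (ρ - (c - n * ρ))) + (2 * ρ - 1) = 1 := by ring
      exact (covers_tri1 (by linarith) (by linarith) (by linarith) hs).exists_shift (n := n) hs
        (by norm_num [alt, gap, col, ht]) (by simp [crho, col]; ring)
        (by simp [cang, col]; ring)
    · have hs : 2 * (1 - ρ) + 2 * (c - n * ρ) + (2 * (ρ - (c - n * ρ)) - 1) = 1 := by ring
      exact (covers_tri2 (by linarith) (by linarith) (by linarith) hs).exists_shift (n := n) hs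
        (by norm_num [alt, gap, col, ht]) (by simp [crho, col]; ring)
        (by simp [cang, col]; ring)
  · have hs : 2 * (1 - ρ) + 2 * (ρ - (c - n * ρ)) + (2 * (c - n * ρ) - 1) = 1 := by ring
    exact (covers_tri3 (by linarith) (by linarith) (by linarith) hs).exists_shift (n := n) hs
      (by norm_num [alt, gap, col, ht]) (by simp [crho, col]; ring) (by simp [cang, col]; ring)


/-! ### Hopf coordinates on the 3-sphere and the binary dihedral group. -/

open Real

/-- The quaternion `cos θ · exp(iα) + sin θ · exp(iβ) j`. -/
def hopfQuat (θ α β : ℝ) : ℍ[ℝ] := ⟨cos θ * cos α, cos θ * sin α, sin θ * cos β, sin θ * sin β⟩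

@[simp] theorem hopfQuat_re (θ α β : ℝ) : (hopfQuat θ α β).re = cos θ * cos α := rfl
@[simp] theorem hopfQuat_imI (θ α β : ℝ) : (hopfQuat θ α β).imI = cos θ * sin α := rfl
@[simp] theorem hopfQuat_imJ (θ α β : ℝ) : (hopfQuat θ α β).imJ = sin θ * cos β := rfl
@[simp] theorem hopfQuat_imK (θ α β : ℝ) : (hopfQuat θ α β).imK = sin θ * sin β := rfl
@[simp] theorem quatJ_re : quatJ.re = 0 := rfl
@[simp] theorem quatJ_imI : quatJ.imI = 0 := rfl
@[simp] theorem quatJ_imJ : quatJ.imJ = 1 := rfl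
@[simp] theorem quatJ_imK : quatJ.imK = 0 := rfl
@[simp] theorem rotQuat_re (r : ℕ) : (rotQuat r).re = cos (π / r) := rfl
@[simp] theorem rotQuat_imI (r : ℕ) : (rotQuat r).imI = sin (π / r) := rfl
@[simp] theorem rotQuat_imJ (r : ℕ) : (rotQuat r).imJ = 0 := rfl
@[simp] theorem rotQuat_imK (r : ℕ) : (rotQuat r).imK = 0 := rfl

/-- `hopfQuat θ α β` as an element of `S³`. -/
def hopf (θ α β : ℝ) : S3 :=
  ⟨hopfQuat θ α β, mem_S3_of_normSq (by
    rw [Quaternion.normSq_def']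
    have h1 := sin_sq_add_cos_sq θ
    have h2 := sin_sq_add_cos_sq α
    have h3 := sin_sq_add_cos_sq β
    simp only [hopfQuat_re, hopfQuat_imI, hopfQuat_imJ, hopfQuat_imK]
    linear_combination h1 + cos θ ^ 2 * h2 + sin θ ^ 2 * h3)⟩

theorem S3_ext {p q : S3} (h0 : p.1.re = q.1.re) (h1 : p.1.imI = q.1.imI) (h2 : p.1.imJ = q.1.imJ)
    (h3 : p.1.imK = q.1.imK) : p = q :=
  Subtype.ext (Quaternion.ext _ _ h0 h1 h2 h3)

/-- The unit quaternion `exp(iφ)`. -/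
def circ (φ : ℝ) : S3 := hopf 0 φ 0

theorem hopf_mul_circ (θ α β φ : ℝ) : hopf θ α β * circ φ = hopf θ (α + φ) (β - φ) := by
  apply S3_ext <;>
    simp [circ, hopf, Quaternion.re_mul, Quaternion.imI_mul, Quaternion.imJ_mul,
      Quaternion.imK_mul, cos_add, sin_add, cos_sub, sin_sub] <;>
    ring

theorem hopf_mul_jGen (θ α β : ℝ) : hopf θ α β * jGen = hopf (π / 2 - θ) (β + π) α := by
  apply S3_ext <;>
    simp [hopf, jGen, Quaternion.re_mul, Quaternion.imI_mul, Quaternion.imJ_mul,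
      Quaternion.imK_mul, cos_add, sin_add, cos_pi_div_two_sub, sin_pi_div_two_sub]

theorem circ_mul_circ (φ ψ : ℝ) : circ φ * circ ψ = circ (φ + ψ) := by
  rw [circ, hopf_mul_circ, circ]
  apply S3_ext <;> simp [hopf]

theorem circ_zero : circ 0 = 1 := by
  apply S3_ext <;> simp [circ, hopf]

theorem circ_mul_jGen (φ : ℝ) : circ φ * jGen = jGen * circ (-φ) := by
  apply S3_ext <;>
    simp [circ, hopf, jGen, Quaternion.re_mul, Quaternion.imI_mul, Quaternion.imJ_mul,
      Quaternion.imK_mul]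

theorem jGen_mul_jGen : jGen * jGen = circ π := by
  apply S3_ext <;>
    simp [circ, hopf, jGen, Quaternion.re_mul, Quaternion.imI_mul, Quaternion.imJ_mul,
      Quaternion.imK_mul]

theorem circ_two_pi_mul (m : ℤ) : circ (2 * π * m) = 1 := by
  have h1 : cos (2 * π * m) = 1 := by rw [mul_comm, cos_int_mul_two_pi]
  have h2 : sin (2 * π * m) = 0 := by
    have := sin_int_mul_pi (2 * m)
    push_cast at this
    rw [← this]; ring_nf
  apply S3_ext <;> simp [circ, hopf, h1, h2]

theorem rotGen_eq (r : ℕ) : rotGen r = circ (π / r) := by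
  apply S3_ext <;> simp [circ, hopf, rotGen]

/-- The binary dihedral group, described by its elements. -/
def dihedralSubgroup (r : ℕ) (hr : r ≠ 0) : Subgroup S3 where
  carrier := {q | ∃ k : ℤ, q = circ (π * k / r) ∨ q = jGen * circ (π * k / r)}
  one_mem' := ⟨0, Or.inl (by simp [circ_zero])⟩
  mul_mem' := by
    have hr' : (r : ℝ) ≠ 0 := Nat.cast_ne_zero.2 hr
    rintro _ _ ⟨k, rfl | rfl⟩ ⟨l, rfl | rfl⟩
    · refine ⟨k + l, Or.inl ?_⟩
      rw [circ_mul_circ]; congr 1; push_cast; ring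
    · refine ⟨-k + l, Or.inr ?_⟩
      rw [← mul_assoc, circ_mul_jGen, mul_assoc, circ_mul_circ]; congr 2; push_cast; ring
    · refine ⟨k + l, Or.inr ?_⟩
      rw [mul_assoc, circ_mul_circ]; congr 2; push_cast; ring
    -- Moving j past exp(iπk/r) inverts it, and j² = exp(iπ) contributes r to the exponent.
    · refine ⟨r - k + l, Or.inl ?_⟩
      rw [mul_assoc, ← mul_assoc (circ _), circ_mul_jGen, ← mul_assoc, ← mul_assoc,
        jGen_mul_jGen, circ_mul_circ, circ_mul_circ]
      congr 1; push_cast; field_simp; ring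
  inv_mem' := by
    have hr' : (r : ℝ) ≠ 0 := Nat.cast_ne_zero.2 hr
    rintro _ ⟨k, rfl | rfl⟩
    · refine ⟨-k, Or.inl (inv_eq_of_mul_eq_one_left ?_)⟩
      rw [circ_mul_circ, ← circ_zero]; congr 1; push_cast; ring
    · refine ⟨k + r, Or.inr (inv_eq_of_mul_eq_one_left ?_)⟩
      rw [mul_assoc, ← mul_assoc (circ _), circ_mul_jGen, ← mul_assoc, ← mul_assoc,
        jGen_mul_jGen, circ_mul_circ, circ_mul_circ, ← circ_zero]
      congr 1; push_cast; field_simp; ring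

theorem circ_mem (r : ℕ) (k : ℤ) : circ (π * k / r) ∈ binaryDihedral r := by
  have h1 : rotGen r ∈ binaryDihedral r := Subgroup.subset_closure (by simp)
  have h2 : ∀ k : ℕ, circ (π * k / r) = rotGen r ^ k := by
    intro k
    induction k with
    | zero => simp [circ_zero]
    | succ k ih =>
      rw [pow_succ, ← ih, rotGen_eq, circ_mul_circ]; congr 1; push_cast; ring
  rcases Int.eq_nat_or_neg k with ⟨n, rfl | rfl⟩
  · rw [Int.cast_natCast, h2]
    exact pow_mem h1 n
  · have : circ (π * ((-n : ℤ) : ℝ) / r) = (circ (π * n / r))⁻¹ := by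
      refine (inv_eq_of_mul_eq_one_left ?_).symm
      rw [circ_mul_circ, ← circ_zero]; congr 1; push_cast; ring
    rw [this, h2]
    exact inv_mem (pow_mem h1 n)

theorem jGen_mem (r : ℕ) : jGen ∈ binaryDihedral r := Subgroup.subset_closure (by simp)

theorem mem_binaryDihedral {r : ℕ} (hr : r ≠ 0) {q : S3} :
    q ∈ binaryDihedral r ↔ ∃ k : ℤ, q = circ (π * k / r) ∨ q = jGen * circ (π * k / r) := by
  constructor
  · intro h
    have : binaryDihedral r ≤ dihedralSubgroup r hr := by
      rw [binaryDihedral, Subgroup.closure_le]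
      rintro _ (rfl | rfl)
      · exact ⟨0, Or.inr (by simp [circ_zero])⟩
      · exact ⟨1, Or.inl (by rw [rotGen_eq]; simp)⟩
    exact this h
  · rintro ⟨k, rfl | rfl⟩
    · exact circ_mem r k
    · exact mul_mem (jGen_mem r) (circ_mem r k)

-- The exponent k matters only modulo 2r. Finiteness makes the subgroup closed, which is what the
-- Hausdorff property of the quotient needs.
open Classical in
theorem finite_binaryDihedral {r : ℕ} (hr : r ≠ 0) : (binaryDihedral r : Set S3).Finite := by
  have hr' : (r : ℝ) ≠ 0 := Nat.cast_ne_zero.2 hr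
  have key : ∀ k : ℤ, ∃ m ∈ Finset.range (2 * r), circ (π * k / r) = circ (π * m / r) := by
    intro k
    have h2 : 0 ≤ k % (2 * r : ℕ) := Int.emod_nonneg _ (by omega)
    have h3 : k % (2 * r : ℕ) < (2 * r : ℕ) := Int.emod_lt_of_pos _ (by omega)
    refine ⟨(k % (2 * r : ℕ)).toNat, by rw [Finset.mem_range]; omega, ?_⟩
    have h4 : (((k % (2 * r : ℕ)).toNat : ℕ) : ℝ) = ((k % (2 * r : ℕ) : ℤ) : ℝ) := by
      exact_mod_cast Int.toNat_of_nonneg h2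
    have h5 : (k : ℝ) = ((k % (2 * r : ℕ) : ℤ) : ℝ) + 2 * r * ((k / (2 * r : ℕ) : ℤ) : ℝ) := by
      exact_mod_cast (Int.emod_add_mul_ediv k (2 * r : ℕ)).symm
    rw [h4]
    conv_lhs => rw [h5]
    rw [show π * (((k % (2 * r : ℕ) : ℤ) : ℝ) + 2 * r * ((k / (2 * r : ℕ) : ℤ) : ℝ)) / r =
      π * ((k % (2 * r : ℕ) : ℤ) : ℝ) / r + 2 * π * ((k / (2 * r : ℕ) : ℤ) : ℝ) by field_simp,
      ← circ_mul_circ, circ_two_pi_mul, mul_one]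
  refine ((Finset.finite_toSet ((Finset.range (2 * r)).image fun m : ℕ => circ (π * m / r))).union
    (Finset.finite_toSet ((Finset.range (2 * r)).image
      fun m : ℕ => jGen * circ (π * m / r)))).subset ?_
  intro q hq
  obtain ⟨k, rfl | rfl⟩ := (mem_binaryDihedral hr).1 hq
  · obtain ⟨m, hm, e⟩ := key k
    left
    rw [e]
    exact Finset.mem_coe.2 (Finset.mem_image_of_mem (fun m : ℕ => circ (π * m / r)) hm)
  · obtain ⟨m, hm, e⟩ := key k
    right
    rw [e]
    exact Finset.mem_coe.2 (Finset.mem_image_of_mem (fun m : ℕ => jGen * circ (π * m / r)) hm)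

theorem t2Space_prismSpace {r : ℕ} (hr : r ≠ 0) : T2Space (PrismSpace r) := by
  rw [t2Space_iff_of_isOpenQuotientMap (QuotientGroup.isOpenQuotientMap_mk (N := binaryDihedral r))]
  have : {q : S3 × S3 | (q.1 : PrismSpace r) = q.2} =
      (fun q : S3 × S3 => q.1⁻¹ * q.2) ⁻¹' (binaryDihedral r : Set S3) := by
    ext q
    exact QuotientGroup.eq
  rw [this]
  exact (finite_binaryDihedral hr).isClosed.preimage (by fun_prop)

/-- The parametrization of the prism space by the solid torus. -/
def prismMap (r : ℕ) (p : ℝ × ℝ × ℝ) : PrismSpace r :=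
  (hopf (π * p.2.1 / 4) (π * p.1 / r) (π * (p.1 - p.2.2 / p.2.1) / r) : S3)


/-! ### The parametrization by the solid torus: identifications, fibres, surjectivity, continuity.
-/

open Real

/-- The alternative sin θ = 0 covers the axis ρ = 0, where β is invisible and the quotient c / ρ in
`prismMap` only has its default value 0. -/
theorem hopf_congr {θ α β α' β' : ℝ} {m m' : ℤ} (h : α' = α + 2 * π * m)
    (h' : sin θ = 0 ∨ β' = β + 2 * π * m') : hopf θ α' β' = hopf θ α β := by
  have e : α + 2 * π * m = α + m * (2 * π) := by ring
  have e' : β + 2 * π * m' = β + m' * (2 * π) := by ring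
  rcases h' with h' | h'
  · apply S3_ext <;> simp [hopf, h, e, h']
  · apply S3_ext <;> simp [hopf, h, e, h', e']

theorem mk_mul_circ (r : ℕ) (q : S3) (k : ℤ) :
    ((q * circ (π * k / r) : S3) : PrismSpace r) = q :=
  QuotientGroup.mk_mul_of_mem q (circ_mem r k)

theorem mk_mul_jGen (r : ℕ) (q : S3) : ((q * jGen : S3) : PrismSpace r) = q :=
  QuotientGroup.mk_mul_of_mem q (jGen_mem r)

theorem prismMap_shift {r : ℕ} (hr : r ≠ 0) (a ρ c : ℝ) (q l : ℤ) :
    prismMap r (a + q, ρ, c + (2 * q + 2 * (r * l) : ℤ) * ρ) = prismMap r (a, ρ, c) := by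
  have hr' : (r : ℝ) ≠ 0 := Nat.cast_ne_zero.2 hr
  unfold prismMap
  rw [← mk_mul_circ r (hopf (π * ρ / 4) (π * a / r) _) q, hopf_mul_circ]
  congr 1
  -- Passing to a + q and c/ρ + 2q changes β by −πq/r, just as `circ` does; the term 2rl amounts to
  -- l full turns.
  refine hopf_congr (m := 0) (m' := -l) (by simp; ring) ?_
  rcases eq_or_ne ρ 0 with h | h
  · left; simp [h]
  · right
    push_cast
    field_simp
    ring

theorem prismMap_fold (r : ℕ) (hr : r ≠ 0) (a c : ℝ) :
    prismMap r (a - c + r, 1, r - c) = prismMap r (a, 1, c) := by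
  have hr' : (r : ℝ) ≠ 0 := Nat.cast_ne_zero.2 hr
  unfold prismMap
  rw [← mk_mul_jGen r (hopf (π * 1 / 4) (π * a / r) _), hopf_mul_jGen]
  -- The boundary ρ = 1 is the torus θ = π/4, which multiplication by j preserves.
  have e : π / 2 - π * 1 / 4 = π * 1 / 4 := by ring
  simp only [e]
  congr 1
  refine hopf_congr (m := 0) (m' := 0) ?_ (Or.inr ?_)
  · simp only [div_one, Int.cast_zero, mul_zero, add_zero]
    field_simp
  · simp only [div_one, Int.cast_zero, mul_zero, add_zero]
    field_simp
    ring

theorem eq_add_of_cos_sin {α β : ℝ} (h : cos α = cos β) (h' : sin α = sin β) :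
    ∃ m : ℤ, α = β + 2 * π * m := by
  obtain ⟨m, hm⟩ := Real.Angle.angle_eq_iff_two_pi_dvd_sub.1 (Real.Angle.cos_sin_inj h h')
  exact ⟨m, by linarith⟩

/-- The modulus of the first complex coordinate gives θ. The strict bound keeps cos θ nonzero, so α
is always recovered, while β is lost exactly when sin θ = 0. -/
theorem hopf_eq {θ α β θ' α' β' : ℝ} (h0 : 0 ≤ θ) (h1 : θ < π / 2) (h0' : 0 ≤ θ')
    (h1' : θ' ≤ π / 2) (h : hopf θ α β = hopf θ' α' β') :
    θ = θ' ∧ (∃ m : ℤ, α = α' + 2 * π * m) ∧ (sin θ = 0 ∨ ∃ m : ℤ, β = β' + 2 * π * m) := by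
  have hq : hopfQuat θ α β = hopfQuat θ' α' β' := congrArg Subtype.val h
  have e0 : cos θ * cos α = cos θ' * cos α' := congrArg QuaternionAlgebra.re hq
  have e1 : cos θ * sin α = cos θ' * sin α' := congrArg QuaternionAlgebra.imI hq
  have e2 : sin θ * cos β = sin θ' * cos β' := congrArg QuaternionAlgebra.imJ hq
  have e3 : sin θ * sin β = sin θ' * sin β' := congrArg QuaternionAlgebra.imK hq
  have hc : cos θ = cos θ' := by
    have c0 : 0 ≤ cos θ := cos_nonneg_of_neg_pi_div_two_le_of_le (by linarith) (by linarith)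
    have c0' : 0 ≤ cos θ' := cos_nonneg_of_neg_pi_div_two_le_of_le (by linarith) (by linarith)
    rw [← sq_eq_sq₀ c0 c0']
    have s1 := sin_sq_add_cos_sq α
    have s2 := sin_sq_add_cos_sq α'
    calc cos θ ^ 2 = (cos θ * cos α) ^ 2 + (cos θ * sin α) ^ 2 := by
          linear_combination - cos θ ^ 2 * s1
      _ = cos θ' ^ 2 := by
          rw [e0, e1]; linear_combination cos θ' ^ 2 * s2
  have hθ : θ = θ' := injOn_cos ⟨h0, by linarith [pi_pos]⟩ ⟨h0', by linarith [pi_pos]⟩ hc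
  subst hθ
  have hp : cos θ ≠ 0 := (cos_pos_of_mem_Ioo ⟨by linarith [pi_pos], h1⟩).ne'
  refine ⟨rfl, eq_add_of_cos_sin (mul_left_cancel₀ hp e0) (mul_left_cancel₀ hp e1), ?_⟩
  rcases eq_or_ne (sin θ) 0 with hs | hs
  · exact Or.inl hs
  · exact Or.inr (eq_add_of_cos_sin (mul_left_cancel₀ hs e2) (mul_left_cancel₀ hs e3))

/-- Points of the solid torus with the same image in the prism space. -/
theorem prismMap_eq {r : ℕ} (hr : r ≠ 0) {a ρ c a' ρ' c' : ℝ} (h0 : 0 ≤ ρ) (h1 : ρ ≤ 1)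
    (h0' : 0 ≤ ρ') (h1' : ρ' ≤ 1) (hc : ρ = 0 → c = 0) (hc' : ρ' = 0 → c' = 0)
    (h : prismMap r (a', ρ', c') = prismMap r (a, ρ, c)) :
    ρ' = ρ ∧ ∃ q l : ℤ, (a' = a + q ∧ c' = c + (2 * q + 2 * (r * l) : ℤ) * ρ) ∨
      (ρ = 1 ∧ a' = a - c + r + q ∧ c' = r - c + (2 * q + 2 * (r * l) : ℤ) * ρ) := by
  have hr' : (r : ℝ) ≠ 0 := Nat.cast_ne_zero.2 hr
  have hπ := pi_pos
  obtain ⟨k, hk⟩ := (mem_binaryDihedral hr).1 (QuotientGroup.eq.1 h.symm)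
  simp only at hk
  rw [inv_mul_eq_iff_eq_mul, inv_mul_eq_iff_eq_mul, ← mul_assoc, hopf_mul_jGen, hopf_mul_circ,
    hopf_mul_circ] at hk
  have hθ : π * ρ' / 4 < π / 2 := by nlinarith
  rcases hk with hk | hk
  · obtain ⟨e, ⟨m, hm⟩, h3⟩ := hopf_eq (by positivity) hθ (by positivity) (by nlinarith) hk
    have hρ : ρ' = ρ := by
      have : π * ρ' = π * ρ := by linarith
      exact mul_left_cancel₀ hπ.ne' this
    subst hρ
    have ea : a' = a + k + 2 * r * m := by
      field_simp at hm
      linarith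
    -- On the axis c and c' vanish by hypothesis, so l = 0 serves; elsewhere sin θ is positive and l
    -- counts full turns.
    rcases eq_or_ne ρ' 0 with hz | hz
    · refine ⟨rfl, k + 2 * r * m, 0, Or.inl ⟨by rw [ea]; push_cast; ring, ?_⟩⟩
      rw [hc hz, hc' hz, hz]; simp
    · rcases h3 with h3 | ⟨m', hm'⟩
      · exfalso
        have : 0 < sin (π * ρ' / 4) := sin_pos_of_pos_of_lt_pi (by positivity) (by nlinarith)
        exact this.ne' h3
      · refine ⟨rfl, k + 2 * r * m, - (m + m'), Or.inl ⟨by rw [ea]; push_cast; ring, ?_⟩⟩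
        rw [ea] at hm'
        push_cast
        field_simp at hm'
        linear_combination (-1) * hm'
  · obtain ⟨e, ⟨m, hm⟩, h3⟩ := hopf_eq (by positivity) hθ (by nlinarith)
      (by linarith [show 0 ≤ π * ρ / 4 by positivity]) hk
    -- An element involving j reflects θ in π/4; as both radii are at most 1, it can only identify
    -- boundary points.
    have hs : ρ' + ρ = 2 := by
      have : π * (ρ' + ρ) = π * 2 := by linarith
      exact mul_left_cancel₀ hπ.ne' this
    obtain rfl : ρ = 1 := by linarith
    obtain rfl : ρ' = 1 := by linarith
    rcases h3 with h3 | ⟨m', hm'⟩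
    · exfalso
      have : 0 < sin (π * 1 / 4) := sin_pos_of_pos_of_lt_pi (by positivity) (by linarith)
      exact this.ne' h3
    · have ea : a' = a - c + r + k + 2 * r * m := by
        field_simp at hm
        linarith
      refine ⟨rfl, k + 2 * r * m, - (m + m'), Or.inr ⟨rfl, by rw [ea]; push_cast; ring, ?_⟩⟩
      rw [ea] at hm'
      push_cast
      field_simp at hm'
      linear_combination (-1) * hm'

theorem exists_hopf (q : S3) : ∃ θ α β, 0 ≤ θ ∧ θ ≤ π / 2 ∧ q = hopf θ α β := by
  let z : ℂ := ⟨q.1.re, q.1.imI⟩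
  let w : ℂ := ⟨q.1.imJ, q.1.imK⟩
  have hn : ‖z‖ ^ 2 + ‖w‖ ^ 2 = 1 := by
    have h1 : Quaternion.normSq q.1 = 1 := by
      rw [Quaternion.normSq_eq_norm_mul_self, mem_sphere_zero_iff_norm.1 q.2, one_mul]
    rw [Quaternion.normSq_def'] at h1
    rw [← Complex.normSq_eq_norm_sq, ← Complex.normSq_eq_norm_sq, Complex.normSq_apply,
      Complex.normSq_apply]
    linear_combination h1
  have hz1 : ‖z‖ ≤ 1 := by nlinarith [norm_nonneg z, sq_nonneg ‖w‖]
  have hcos : cos (arccos ‖z‖) = ‖z‖ := cos_arccos (by linarith [norm_nonneg z]) hz1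
  have hsin : sin (arccos ‖z‖) = ‖w‖ := by
    rw [sin_arccos, show 1 - ‖z‖ ^ 2 = ‖w‖ ^ 2 by linarith, sqrt_sq (norm_nonneg w)]
  refine ⟨arccos ‖z‖, z.arg, w.arg, arccos_nonneg _, arccos_le_pi_div_two.2 (norm_nonneg z), ?_⟩
  apply S3_ext
  · simp [hopf, hcos, z]
  · simp [hopf, hcos, z]
  · simp [hopf, hsin, w]
  · simp [hopf, hsin, w]

theorem prismMap_surjective {r : ℕ} (hr : r ≠ 0) (y : PrismSpace r) :
    ∃ a ρ c : ℝ, ∃ n : ℤ, ρ ≤ 1 ∧ 0 ≤ c - n * ρ ∧ c - n * ρ ≤ ρ ∧ prismMap r (a, ρ, c) = y := by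
  have hr' : (r : ℝ) ≠ 0 := Nat.cast_ne_zero.2 hr
  have hπ := pi_pos
  have key : ∀ θ α β : ℝ, 0 ≤ θ → θ ≤ π / 4 → ∃ a ρ c : ℝ, ∃ n : ℤ, ρ ≤ 1 ∧ 0 ≤ c - n * ρ ∧
      c - n * ρ ≤ ρ ∧ prismMap r (a, ρ, c) = (hopf θ α β : S3) := by
    intro θ α β h0 h1
    -- The angular coordinate c / ρ; its integral part is the sector.
    let t := α * r / π - β * r / π
    let ρ := 4 * θ / π
    have hρ : 0 ≤ ρ := by positivity
    refine ⟨α * r / π, ρ, t * ρ, ⌊t⌋, ?_, ?_, ?_, ?_⟩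
    · exact (div_le_one hπ).2 (by linarith)
    · rw [← sub_mul]
      exact mul_nonneg (by linarith [Int.floor_le t]) hρ
    · rw [← sub_mul]
      nlinarith [Int.lt_floor_add_one t]
    · unfold prismMap
      have e : π * ρ / 4 = θ := by simp only [ρ]; field_simp
      simp only [e]
      congr 1
      refine hopf_congr (m := 0) (m' := 0) (by simp; field_simp) ?_
      rcases eq_or_ne ρ 0 with hz | hz
      · left
        rw [← e, hz]; simp
      · right
        rw [mul_div_cancel_right₀ _ hz]
        simp only [t]
        field_simp
        simp
  obtain ⟨q, rfl⟩ := QuotientGroup.mk_surjective y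
  obtain ⟨θ, α, β, h0, h1, rfl⟩ := exists_hopf q
  rcases le_total θ (π / 4) with h2 | h2
  · exact key θ α β h0 h2
  -- Beyond π/4, the representative multiplied by j has angle π/2 − θ ≤ π/4.
  · rw [← mk_mul_jGen, hopf_mul_jGen]
    exact key _ _ _ (by linarith) (by linarith)

/-- Applied to the cosine and sine of the angle containing c / ρ, which need not be continuous on
the axis: the factor sin θ tends to 0 there, and boundedness of g suffices. -/
theorem continuous_sin_mul {g : ℝ × ℝ × ℝ → ℝ} (hb : ∀ p, |g p| ≤ 1)
    (hg : ∀ p, p.2.1 ≠ 0 → ContinuousAt g p) :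
    Continuous fun p : ℝ × ℝ × ℝ => sin (π * p.2.1 / 4) * g p := by
  have hs : Continuous fun p : ℝ × ℝ × ℝ => sin (π * p.2.1 / 4) := by fun_prop
  rw [continuous_iff_continuousAt]
  intro p
  by_cases hp : p.2.1 = 0
  · have h0 : sin (π * p.2.1 / 4) = 0 := by simp [hp]
    have ht := hs.tendsto p
    rw [h0] at ht
    change Filter.Tendsto _ _ (nhds (sin (π * p.2.1 / 4) * g p))
    rw [h0, zero_mul]
    refine squeeze_zero_norm (fun x => ?_) (tendsto_zero_iff_norm_tendsto_zero.1 ht)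
    rw [norm_mul]
    exact mul_le_of_le_one_right (norm_nonneg _) (hb x)
  · exact hs.continuousAt.mul (hg p hp)

theorem continuous_prismMap (r : ℕ) : Continuous (prismMap r) := by
  refine continuous_quotient_mk'.comp (Continuous.subtype_mk ?_ _)
  have hd : ∀ p : ℝ × ℝ × ℝ, p.2.1 ≠ 0 →
      ContinuousAt (fun p : ℝ × ℝ × ℝ => π * (p.1 - p.2.2 / p.2.1) / r) p := fun p hp => by
    refine ContinuousAt.div_const (continuousAt_const.mul (continuousAt_fst.sub ?_)) _
    exact ContinuousAt.div (by fun_prop) (by fun_prop) hp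
  have h1 := continuous_sin_mul (fun p => abs_cos_le_one _)
    fun p hp => continuous_cos.continuousAt.comp (hd p hp)
  have h2 := continuous_sin_mul (fun p => abs_sin_le_one _)
    fun p hp => continuous_sin.continuousAt.comp (hd p hp)
  have h3 : Continuous fun p : ℝ × ℝ × ℝ => Quaternion.linearIsometryEquivTuple.symm
      (!₂[cos (π * p.2.1 / 4) * cos (π * p.1 / r), cos (π * p.2.1 / 4) * sin (π * p.1 / r),
        sin (π * p.2.1 / 4) * cos (π * (p.1 - p.2.2 / p.2.1) / r),
        sin (π * p.2.1 / 4) * sin (π * (p.1 - p.2.2 / p.2.1) / r)] : EuclideanSpace ℝ (Fin 4)) := by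
    refine Quaternion.linearIsometryEquivTuple.symm.continuous.comp
      ((PiLp.continuous_toLp 2 _).comp (continuous_pi fun i => ?_))
    fin_cases i
    · simp; fun_prop
    · simp; fun_prop
    · exact h1
    · exact h2
  refine h3.congr fun p => ?_
  apply Quaternion.ext <;> rfl

end Prism

/-! ### Realizations of finite complexes: compactness and continuity cell by cell. -/

namespace AbstractSimplicialComplex

variable {V : Type*} [Fintype V]

/-- The closed simplex spanned by `s`, as a set of barycentric coordinates. -/
def closedCell (s : Finset V) : Set (V → ℝ) := {x | x ∈ stdSimplex ℝ V ∧ ∀ v, x v ≠ 0 → v ∈ s}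

theorem isClosed_closedCell (s : Finset V) : IsClosed (closedCell s) := by
  have : closedCell s = stdSimplex ℝ V ∩ ⋂ v, ⋂ (_ : v ∉ s), {x | x v = 0} := by
    ext x
    simp only [closedCell, Set.mem_ofPred_eq, Set.mem_inter_iff, Set.mem_iInter]
    refine and_congr_right fun _ => forall_congr' fun v => ?_
    tauto
  rw [this]
  refine (isClosed_stdSimplex ℝ V).inter (isClosed_iInter fun v => isClosed_iInter fun _ => ?_)
  exact isClosed_eq (continuous_apply v) continuous_const

theorem realization_eq (K : AbstractSimplicialComplex V) :
    K.realization = ⋃ s : {s // s ∈ K.faces}, closedCell s.1 := by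
  ext x
  simp only [realization, closedCell, Set.mem_ofPred_eq, Set.mem_iUnion, Subtype.exists]
  constructor
  · rintro ⟨h, s, hs, h'⟩; exact ⟨s, hs, h, h'⟩
  · rintro ⟨s, hs, h, h'⟩; exact ⟨h, s, hs, h'⟩

instance (K : AbstractSimplicialComplex V) : CompactSpace K.realization := by
  rw [← isCompact_iff_compactSpace]
  refine (isCompact_stdSimplex ℝ V).of_isClosed_subset ?_ fun x hx => hx.1
  rw [realization_eq]
  exact isClosed_iUnion_of_finite fun s => isClosed_closedCell _

theorem continuous_of_closedCell {K : AbstractSimplicialComplex V} {Y : Type*} [TopologicalSpace Y]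
    {f : K.realization → Y} (h : ∀ s ∈ K.faces, ContinuousOn f {x | x.1 ∈ closedCell s}) :
    Continuous f := by
  refine (locallyFinite_of_finite fun s : {s // s ∈ K.faces} =>
    {x : K.realization | x.1 ∈ closedCell s.1}).continuous ?_ ?_ fun s => h s.1 s.2
  · ext ⟨x, hx⟩
    have h := hx
    rw [realization_eq, Set.mem_iUnion] at h
    simp only [Set.mem_iUnion, Set.mem_univ, iff_true]
    exact h
  · exact fun s => (isClosed_closedCell s.1).preimage continuous_subtype_val

end AbstractSimplicialComplex

/-! ### The quotient complex triangulates the prism space. -/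

namespace Prism

open AbstractSimplicialComplex

/-- The position of a point in the solid torus. -/
def pos (x : LVert →₀ ℝ) : ℝ × ℝ × ℝ := (posA x, posR x, posC x)

theorem LPoint.pos_mem {x : LVert →₀ ℝ} (hx : LPoint x) :
    0 ≤ posR x ∧ posR x ≤ 1 ∧ (posR x = 0 → posC x = 0) := by
  have hc : ∀ v, 0 ≤ crho (col v) ∧ crho (col v) ≤ 1 ∧ (crho (col v) = 0 → cang (col v) = 0) := by
    intro v
    cases v <;> norm_num [col, crho, cang]
  have h0 : ∀ v ∈ x.support, 0 ≤ x v * crho (col v) := fun v _ => mul_nonneg (hx.2.1 v) (hc v).1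
  refine ⟨Finset.sum_nonneg h0, ?_, fun h => ?_⟩
  · rw [← lin_one hx]
    exact Finset.sum_le_sum fun v _ => mul_le_mul_of_nonneg_left (hc v).2.1 (hx.2.1 v)
  · have h1 := (Finset.sum_eq_zero_iff_of_nonneg h0).1 h
    refine Finset.sum_eq_zero fun v hv => ?_
    rcases mul_eq_zero.1 (h1 v hv) with h2 | h2
    · rw [h2, zero_mul]
    · simp only [(hc v).2.2 h2, mul_zero]

/-- The radius is a convex combination of column radii, so the maximum 1 forces all weight onto the
boundary columns. This licenses `fold` when `prismMap` identifies two boundary points. -/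
theorem LPoint.isBd {x : LVert →₀ ℝ} (hx : LPoint x) (h : posR x = 1) :
    ∀ v ∈ x.support, IsBd v := by
  have hc : ∀ v, crho (col v) ≤ 1 ∧ (crho (col v) = 1 → IsBd v) := by
    intro v
    cases v <;> norm_num [col, crho, IsBd]
  have h1 : ∑ v ∈ x.support, x v * crho (col v) = ∑ v ∈ x.support, x v * 1 :=
    h.trans (lin_one hx).symm
  have h2 := (Finset.sum_eq_sum_iff_of_le fun v _ =>
    mul_le_mul_of_nonneg_left (hc v).1 (hx.2.1 v)).1 h1
  intro v hv
  exact (hc v).2 (mul_left_cancel₀ (Finsupp.mem_support_iff.1 hv) (h2 v hv))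

theorem pos_shift {x : LVert →₀ ℝ} (hx : lin (fun _ => 1) x = 1) (k q : ℤ) :
    pos (x.mapDomain (shift k q)) = (posA x + q, posR x, posC x + k * posR x) := by
  rw [pos, posA_shift hx, posR_shift, posC_shift]

theorem pos_shift_fold {x : LVert →₀ ℝ} (hx : LPoint x) (hb : ∀ v ∈ x.support, IsBd v)
    (r k q : ℤ) : pos (x.mapDomain (shift k q ∘ fold r)) =
      (posA x - posC x + r + q, 1, r - posC x + k * 1) := by
  have h1 : lin (fun _ => 1) (x.mapDomain (fold r)) = 1 := by
    rw [lin_mapDomain]; exact lin_one hx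
  have h2 : posR (x.mapDomain (fold r)) = 1 := by
    rw [posR, lin_mapDomain, ← lin_one hx]
    refine lin_congr fun v hv => ?_
    have := hb v hv
    cases v <;> simp [IsBd, fold, crho, col] at this ⊢
  rw [Finsupp.mapDomain_comp, pos_shift h1, h2, posA_fold hx hb, posC_fold hx hb]

/-- The projection to the quotient complex and the projection to the prism space identify the
same points. -/
theorem mapDomain_proj_eq_iff {r : ℕ} (hr : 2 ≤ r) {x x' : LVert →₀ ℝ} (hx : LPoint x)
    (hx' : LPoint x') : x.mapDomain (proj r) = x'.mapDomain (proj r) ↔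
      prismMap r (pos x) = prismMap r (pos x') := by
  have hr0 : r ≠ 0 := by omega
  constructor
  · intro h
    obtain ⟨γ, hγ, rfl⟩ := exists_deck_of_mapDomain_eq hr hx hx' h
    obtain ⟨q, l, rfl | ⟨hb, rfl⟩⟩ := hγ
    · rw [pos_shift (lin_one hx), prismMap_shift hr0, pos]
    · rw [pos_shift_fold hx hb, prismMap_shift hr0, Int.cast_natCast, prismMap_fold r hr0, pos,
        posR_of_isBd hx hb]
  · intro h
    obtain ⟨h0, h1, h2⟩ := hx.pos_mem
    obtain ⟨h0', h1', h2'⟩ := hx'.pos_mem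
    obtain ⟨hR, q, l, ⟨hA, hC⟩ | ⟨h1, hA, hC⟩⟩ :=
      prismMap_eq hr0 h0 h1 h0' h1' h2 h2' (show prismMap r (pos x') = prismMap r (pos x) from h.symm)
    · have hγ : Deck r x.support (shift (2 * q + 2 * (r * l)) q) := ⟨q, l, Or.inl rfl⟩
      have e := pos_shift (lin_one hx) (2 * q + 2 * (r * l)) q
      simp only [pos, Prod.mk.injEq] at e
      rw [← hγ.mapDomain_proj, (hγ.lPoint hx).eq_of_pos_eq hx' (by rw [e.1, hA])
        (by rw [e.2.1, hR]) (by rw [e.2.2, hC])]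
    · have hb := hx.isBd h1
      have hγ : Deck r x.support (shift (2 * q + 2 * (r * l)) q ∘ fold r) :=
        ⟨q, l, Or.inr ⟨hb, rfl⟩⟩
      have e := pos_shift_fold hx hb r (2 * q + 2 * (r * l)) q
      simp only [pos, Prod.mk.injEq] at e
      rw [← hγ.mapDomain_proj, (hγ.lPoint hx).eq_of_pos_eq hx' (by rw [e.1, hA]; simp)
        (by rw [e.2.1, hR, h1]) (by rw [e.2.2, hC, h1]; simp)]

/-- The quotient of the lifted complex. -/
def quotComplex (r : ℕ) : AbstractSimplicialComplex (QVert r) where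
  faces := {s | ∃ T, LFace T ∧ T.image (proj r) = s}
  isRelLowerSet_faces := by
    rintro _ ⟨T, hT, rfl⟩
    refine ⟨hT.1.image _, fun s hs hn => ?_⟩
    obtain ⟨T', hT', rfl⟩ := Finset.subset_image_iff.1 hs
    exact ⟨T', hT.mono (by exact_mod_cast hT') (Finset.image_nonempty.1 hn), rfl⟩
  singleton_mem v := by
    obtain ⟨u, rfl⟩ := proj_surjective r v
    exact ⟨{u}, ⟨Finset.singleton_nonempty u, by simp [Near.refl]⟩, by simp⟩

/-- The lift of a point with respect to a face of the lifted complex. -/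
def liftPoint {r : ℕ} (T : Finset LVert) (y : QVert r → ℝ) : LVert →₀ ℝ :=
  Finsupp.onFinset T (fun v => if v ∈ T then y (proj r v) else 0) fun v h => by
    by_contra hv
    simp [hv] at h

theorem lin_liftPoint {r : ℕ} (f : LVert → ℝ) (T : Finset LVert) (y : QVert r → ℝ) :
    lin f (liftPoint T y) = ∑ v ∈ T, y (proj r v) * f v := by
  rw [lin_eq_sum, liftPoint, Finsupp.onFinset_sum _ fun v => zero_mul _]
  exact Finset.sum_congr rfl fun v hv => by rw [if_pos hv]

variable {r : ℕ} [NeZero r]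

theorem lPoint_liftPoint (hr : 2 ≤ r) {T : Finset LVert} (hT : LFace T) {y : QVert r → ℝ}
    (hy : y ∈ closedCell (T.image (proj r))) :
    LPoint (liftPoint T y) ∧ ⇑((liftPoint T y).mapDomain (proj r)) = y := by
  have hi := hT.proj_injOn hr
  have hsub : (liftPoint T y).support ⊆ T := Finsupp.support_onFinset_subset
  have hsum : lin (fun _ => 1) (liftPoint T y) = 1 := by
    rw [lin_liftPoint]
    simp only [mul_one]
    rw [← Finset.sum_image (f := y) hi]
    refine (Finset.sum_subset (Finset.subset_univ _) fun w _ hw => ?_).trans hy.1.2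
    by_contra h
    exact hw (hy.2 w h)
  refine ⟨⟨hT.mono hsub ?_, fun v => ?_, ?_⟩, ?_⟩
  · rw [Finset.nonempty_iff_ne_empty]
    intro h0
    simp [lin, h0] at hsum
  · rw [liftPoint, Finsupp.onFinset_apply]
    split_ifs
    · exact hy.1.1 _
    · exact le_rfl
  · rw [← hsum, lin_eq_sum]
    simp
  · funext w
    by_cases hw : w ∈ T.image (proj r)
    · obtain ⟨v, hv, rfl⟩ := Finset.mem_image.1 hw
      rw [Finsupp.mapDomain_apply' (↑T) _ (by exact_mod_cast hsub) hi (by exact_mod_cast hv),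
        liftPoint, Finsupp.onFinset_apply, if_pos hv]
    · have h1 : y w = 0 := by
        by_contra h
        exact hw (hy.2 w h)
      rw [h1, ← Finsupp.notMem_support_iff]
      exact fun h => hw (Finset.image_subset_image hsub (Finsupp.mapDomain_support h))

theorem mapDomain_mem_realization {x : LVert →₀ ℝ} (hx : LPoint x) :
    ⇑(x.mapDomain (proj r)) ∈ (quotComplex r).realization := by
  refine ⟨⟨fun w => ?_, ?_⟩, _, ⟨_, hx.1, rfl⟩, fun w hw =>
    Finsupp.mapDomain_support (Finsupp.mem_support_iff.2 hw)⟩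
  · rw [Finsupp.mapDomain, Finsupp.sum_apply]
    refine Finset.sum_nonneg fun v _ => ?_
    simp only [Finsupp.single_apply]
    split_ifs
    · exact hx.2.1 v
    · exact le_rfl
  · have : (x.mapDomain (proj r)).sum (fun _ t => t) = 1 := by
      rw [Finsupp.sum_mapDomain_index (fun _ => rfl) (fun _ _ _ => rfl)]
      exact hx.2.2
    rwa [Finsupp.sum_fintype _ _ fun _ => rfl] at this

theorem exists_lift (hr : 2 ≤ r) (y : (quotComplex r).realization) :
    ∃ x, LPoint x ∧ ⇑(x.mapDomain (proj r)) = y.1 := by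
  obtain ⟨h1, _, ⟨T, hT, rfl⟩, h2⟩ := y.2
  exact ⟨_, lPoint_liftPoint hr hT ⟨h1, h2⟩⟩

/-- The map from the realization of the quotient complex to the prism space. -/
def toPrism (hr : 2 ≤ r) (y : (quotComplex r).realization) : PrismSpace r :=
  prismMap r (pos (exists_lift hr y).choose)

/-- Independence of the chosen lift, so that each argument can use the lift that suits it. -/
theorem toPrism_eq (hr : 2 ≤ r) {y : (quotComplex r).realization} {x : LVert →₀ ℝ} (hx : LPoint x)
    (h : ⇑(x.mapDomain (proj r)) = y.1) : toPrism hr y = prismMap r (pos x) := by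
  have hs := (exists_lift hr y).choose_spec
  exact (mapDomain_proj_eq_iff hr hs.1 hx).1 (DFunLike.coe_injective (hs.2.trans h.symm))

theorem toPrism_bijective (hr : 2 ≤ r) : Function.Bijective (toPrism hr) := by
  constructor
  · intro y y' h
    obtain ⟨x, hx, e⟩ := exists_lift hr y
    obtain ⟨x', hx', e'⟩ := exists_lift hr y'
    rw [toPrism_eq hr hx e, toPrism_eq hr hx' e'] at h
    rw [Subtype.ext_iff, ← e, ← e', (mapDomain_proj_eq_iff hr hx hx').2 h]
  · intro z
    obtain ⟨a, ρ, c, n, h1, h2, h3, rfl⟩ := prismMap_surjective (by omega) z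
    obtain ⟨x, hx, e1, e2, e3⟩ := exists_lPoint (a := a) h1 h2 h3
    refine ⟨⟨_, mapDomain_mem_realization hx⟩, ?_⟩
    rw [toPrism_eq hr hx rfl, pos, e1, e2, e3]

/-- On the closed cell of a projected face T, the lift `liftPoint T` is available for all points at
once, and its position depends linearly on the barycentric coordinates. -/
theorem continuous_toPrism (hr : 2 ≤ r) : Continuous (toPrism hr) := by
  refine continuous_of_closedCell ?_
  rintro _ ⟨T, hT, rfl⟩
  have h1 : Continuous fun y : (quotComplex r).realization => prismMap r (pos (liftPoint T y.1)) := by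
    refine (continuous_prismMap r).comp ?_
    simp only [pos, posA, posR, posC, lin_liftPoint]
    have h2 : ∀ f : LVert → ℝ, Continuous fun y : (quotComplex r).realization =>
        ∑ v ∈ T, y.1 (proj r v) * f v := fun f => continuous_finsetSum _ fun v _ =>
      ((continuous_apply _).comp continuous_subtype_val).mul continuous_const
    exact (h2 _).prodMk ((h2 _).prodMk (h2 _))
  refine h1.continuousOn.congr fun y hy => ?_
  have := lPoint_liftPoint hr hT hy
  exact toPrism_eq hr this.1 this.2

theorem nonempty_homeomorph_quotComplex (hr : 2 ≤ r) :
    Nonempty ((quotComplex r).realization ≃ₜ PrismSpace r) := by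
  have := t2Space_prismSpace (r := r) (by omega)
  exact ⟨Continuous.homeoOfEquivCompactToT2 (f := Equiv.ofBijective _ (toPrism_bijective hr))
    (continuous_toPrism hr)⟩

end Prism

/-! ### Simultaneous bistellar flips preserve the realization. -/

namespace AbstractSimplicialComplex

variable {V : Type*}

theorem mem_realization_iff [Fintype V] (K : AbstractSimplicialComplex V) (x : V → ℝ) :
    x ∈ K.realization ↔ x ∈ stdSimplex ℝ V ∧ ({v | x v ≠ 0} : Finset V) ∈ K.faces := by
  constructor
  · rintro ⟨h, s, hs, h'⟩
    refine ⟨h, (K.isRelLowerSet_faces hs).2 (fun v hv => h' v (by simpa using hv)) ?_⟩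
    rw [Finset.nonempty_iff_ne_empty]
    intro h0
    have h1 : ∀ v, x v = 0 := fun v => by
      by_contra hv
      have : v ∈ ({v | x v ≠ 0} : Finset V) := by simpa using hv
      simp [h0] at this
    have := h.2
    simp [h1] at this
  · rintro ⟨h, h'⟩
    exact ⟨h, _, h', fun v hv => by simpa using hv⟩

theorem pos_iff [Fintype V] {x : V → ℝ} (hx : x ∈ stdSimplex ℝ V) (v : V) :
    0 < x v ↔ v ∈ ({v | x v ≠ 0} : Finset V) := by
  simp only [Finset.mem_filter, Finset.mem_univ, true_and]
  exact ⟨fun h => h.ne', fun h => lt_of_le_of_ne (hx.1 v) (Ne.symm h)⟩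

theorem min_eq_zero [Fintype V] {x : V → ℝ} (hx : x ∈ stdSimplex ℝ V) {a b : V}
    (h : ¬ (a ∈ ({v | x v ≠ 0} : Finset V) ∧ b ∈ ({v | x v ≠ 0} : Finset V))) :
    min (x a) (x b) = 0 := by
  rw [← pos_iff hx, ← pos_iff hx, ← lt_min_iff, not_lt] at h
  exact le_antisymm h (le_min (hx.1 a) (hx.1 b))

theorem min₃_eq_zero [Fintype V] {x : V → ℝ} (hx : x ∈ stdSimplex ℝ V) {a b c : V}
    (h : ¬ (a ∈ ({v | x v ≠ 0} : Finset V) ∧ b ∈ ({v | x v ≠ 0} : Finset V) ∧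
      c ∈ ({v | x v ≠ 0} : Finset V))) :
    min (x a) (min (x b) (x c)) = 0 := by
  rw [← pos_iff hx, ← pos_iff hx, ← pos_iff hx, ← lt_min_iff, ← lt_min_iff, not_lt] at h
  exact le_antisymm h (le_min (hx.1 a) (le_min (hx.1 b) (hx.1 c)))

variable {ι : Type*} [DecidableEq V]

/-- `K` arises from `K₀` by a family of bistellar flips, which replace the triangles `X Y Z`
with apexes `P` and `Q` by the edges `P Q`. -/
structure IsFlip (K₀ K : AbstractSimplicialComplex V) (P Q X Y Z : ι → V) : Prop where
  ne : ∀ i, P i ≠ Q i ∧ P i ≠ X i ∧ P i ≠ Y i ∧ P i ≠ Z i ∧ Q i ≠ X i ∧ Q i ≠ Y i ∧ Q i ≠ Z i ∧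
    X i ≠ Y i ∧ X i ≠ Z i ∧ Y i ≠ Z i
  subset_of_mem : ∀ s ∈ K₀.faces, ∀ i, X i ∈ s → Y i ∈ s → Z i ∈ s →
    s ⊆ {P i, X i, Y i, Z i} ∨ s ⊆ {Q i, X i, Y i, Z i}
  not_mem : ∀ s ∈ K₀.faces, ∀ i, P i ∈ s → Q i ∉ s
  mem₀ : ∀ i, {P i, X i, Y i, Z i} ∈ K₀.faces ∧ {Q i, X i, Y i, Z i} ∈ K₀.faces
  mem_iff : ∀ s, s ∈ K.faces ↔ (s ∈ K₀.faces ∧ ∀ i, ¬ (X i ∈ s ∧ Y i ∈ s ∧ Z i ∈ s)) ∨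
    ∃ i, P i ∈ s ∧ Q i ∈ s ∧ s ⊆ {P i, Q i, X i, Y i, Z i} ∧ ¬ (X i ∈ s ∧ Y i ∈ s ∧ Z i ∈ s)
  disj : ∀ i j, i ≠ j → ¬ (P j ∈ ({P i, Q i, X i, Y i, Z i} : Finset V) ∧
    Q j ∈ ({P i, Q i, X i, Y i, Z i} : Finset V)) ∧
    ¬ (X j ∈ ({P i, Q i, X i, Y i, Z i} : Finset V) ∧
    Y j ∈ ({P i, Q i, X i, Y i, Z i} : Finset V) ∧ Z j ∈ ({P i, Q i, X i, Y i, Z i} : Finset V))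

/-- The complex obtained from `K₀` by replacing the triangles `X Y Z` with apexes `P` and `Q` by the
edges `P Q`. -/
def flip (K₀ : AbstractSimplicialComplex V) (P Q X Y Z : ι → V) (hXY : ∀ i, X i ≠ Y i)
    (mem₀ : ∀ i, {P i, X i, Y i, Z i} ∈ K₀.faces ∧ {Q i, X i, Y i, Z i} ∈ K₀.faces)
    (disj : ∀ i j, i ≠ j → ¬ (X j ∈ ({P i, Q i, X i, Y i, Z i} : Finset V) ∧
      Y j ∈ ({P i, Q i, X i, Y i, Z i} : Finset V) ∧
      Z j ∈ ({P i, Q i, X i, Y i, Z i} : Finset V))) : AbstractSimplicialComplex V where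
  faces := {s | (s ∈ K₀.faces ∧ ∀ i, ¬ (X i ∈ s ∧ Y i ∈ s ∧ Z i ∈ s)) ∨
    ∃ i, P i ∈ s ∧ Q i ∈ s ∧ s ⊆ {P i, Q i, X i, Y i, Z i} ∧ ¬ (X i ∈ s ∧ Y i ∈ s ∧ Z i ∈ s)}
  isRelLowerSet_faces := by
    rintro s (⟨hs, hn⟩ | ⟨i, hP, hQ, hs, hn⟩)
    · refine ⟨(K₀.isRelLowerSet_faces hs).1, fun t ht h0 => Or.inl
        ⟨(K₀.isRelLowerSet_faces hs).2 ht h0, fun i hi => hn i ⟨ht hi.1, ht hi.2.1, ht hi.2.2⟩⟩⟩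
    · refine ⟨⟨_, hP⟩, fun t ht h0 => ?_⟩
      have ht' := Finset.Subset.trans ht hs
      have hnt : ¬ (X i ∈ t ∧ Y i ∈ t ∧ Z i ∈ t) := fun hi => hn ⟨ht hi.1, ht hi.2.1, ht hi.2.2⟩
      have hn' : ∀ j, ¬ (X j ∈ t ∧ Y j ∈ t ∧ Z j ∈ t) := fun j hj => by
        rcases eq_or_ne i j with rfl | hij
        · exact hnt hj
        · exact disj i j hij ⟨ht' hj.1, ht' hj.2.1, ht' hj.2.2⟩
      by_cases hPt : P i ∈ t
      · by_cases hQt : Q i ∈ t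
        · exact Or.inr ⟨i, hPt, hQt, ht', hnt⟩
        · refine Or.inl ⟨(K₀.isRelLowerSet_faces (mem₀ i).1).2 (fun v hv => ?_) h0, hn'⟩
          have h1 := ht' hv
          have h2 : v ≠ Q i := fun e => hQt (e ▸ hv)
          simp only [Finset.mem_insert, Finset.mem_singleton] at h1 ⊢
          tauto
      · refine Or.inl ⟨(K₀.isRelLowerSet_faces (mem₀ i).2).2 (fun v hv => ?_) h0, hn'⟩
        have h1 := ht' hv
        have h2 : v ≠ P i := fun e => hPt (e ▸ hv)
        simp only [Finset.mem_insert, Finset.mem_singleton] at h1 ⊢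
        tauto
  singleton_mem v := Or.inl ⟨K₀.singleton_mem v, fun i hi => hXY i
    ((Finset.mem_singleton.1 hi.1).trans (Finset.mem_singleton.1 hi.2.1).symm)⟩

/-- The affine dependence between the vertices of a flip. -/
def flipVec (P Q X Y Z : V) (a : V) : ℝ :=
  3 / 2 * ((if a = P then 1 else 0) + (if a = Q then 1 else 0)) - ((if a = X then 1 else 0) +
    (if a = Y then 1 else 0) + (if a = Z then 1 else 0))

theorem sum_flipVec [Fintype V] (P Q X Y Z : V) : ∑ a, flipVec P Q X Y Z a = 0 := by
  simp only [flipVec, Finset.sum_sub_distrib, Finset.sum_add_distrib, ← Finset.mul_sum,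
    Finset.sum_ite_eq', Finset.mem_univ, if_true]
  norm_num

namespace IsFlip

variable {K₀ K : AbstractSimplicialComplex V} {P Q X Y Z : ι → V}

/-- Moves the weight of the triangles to their apexes. -/
def fwd [Fintype ι] (P Q X Y Z : ι → V) (x : V → ℝ) : V → ℝ := fun a =>
  x a + ∑ i, min (x (X i)) (min (x (Y i)) (x (Z i))) * flipVec (P i) (Q i) (X i) (Y i) (Z i) a

/-- Moves the weight of the apexes to the triangles. -/
def bwd [Fintype ι] (P Q X Y Z : ι → V) (x : V → ℝ) : V → ℝ := fun a =>
  x a - ∑ i, 2 / 3 * min (x (P i)) (x (Q i)) * flipVec (P i) (Q i) (X i) (Y i) (Z i) a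

theorem continuous_fwd [Fintype ι] (P Q X Y Z : ι → V) : Continuous (fwd P Q X Y Z) := by
  unfold fwd
  fun_prop

theorem continuous_bwd [Fintype ι] (P Q X Y Z : ι → V) : Continuous (bwd P Q X Y Z) := by
  unfold bwd
  fun_prop

theorem flipVec_apply (h : IsFlip K₀ K P Q X Y Z) (i : ι) :
    (flipVec (P i) (Q i) (X i) (Y i) (Z i) (P i) = 3 / 2 ∧
    flipVec (P i) (Q i) (X i) (Y i) (Z i) (Q i) = 3 / 2) ∧
    flipVec (P i) (Q i) (X i) (Y i) (Z i) (X i) = -1 ∧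
    flipVec (P i) (Q i) (X i) (Y i) (Z i) (Y i) = -1 ∧
    flipVec (P i) (Q i) (X i) (Y i) (Z i) (Z i) = -1 := by
  obtain ⟨h1, h2, h3, h4, h5, h6, h7, h8, h9, h10⟩ := h.ne i
  simp [flipVec, h1, h2, h3, h4, h5, h6, h7, h8, h9, h10, h1.symm, h2.symm, h3.symm, h4.symm,
    h5.symm, h6.symm, h7.symm, h8.symm, h9.symm, h10.symm]

theorem flipVec_eq_zero {P Q X Y Z a : V} (h : a ∉ ({P, Q, X, Y, Z} : Finset V)) :
    flipVec P Q X Y Z a = 0 := by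
  simp only [Finset.mem_insert, Finset.mem_singleton, not_or] at h
  simp [flipVec, h]

/-- If the carrier contains the triangle i, it lies in the bipyramid i, and by `disj` all other
terms vanish. With w the least weight on the triangle, the map takes w from each of X, Y, Z and
gives 3w/2 to each apex: one triangle vertex is exhausted and both apexes become positive. No face
of `K₀` contains both apexes, so one of them had weight 0 and the minimum over P, Q is now 3w/2,
from which `bwd` recovers w. -/
theorem fwd_spec [Fintype V] [Fintype ι] [DecidableEq ι] (h : IsFlip K₀ K P Q X Y Z) {x : V → ℝ} (hx : x ∈ K₀.realization) :
    fwd P Q X Y Z x ∈ K.realization ∧ bwd P Q X Y Z (fwd P Q X Y Z x) = x := by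
  rw [mem_realization_iff] at hx
  obtain ⟨hx, hs⟩ := hx
  by_cases hi : ∃ i, X i ∈ ({v | x v ≠ 0} : Finset V) ∧ Y i ∈ ({v | x v ≠ 0} : Finset V) ∧
      Z i ∈ ({v | x v ≠ 0} : Finset V)
  · obtain ⟨i, hX, hY, hZ⟩ := hi
    have hsub := h.subset_of_mem _ hs i hX hY hZ
    have hsub' : ({v | x v ≠ 0} : Finset V) ⊆ {P i, Q i, X i, Y i, Z i} := by
      rcases hsub with h1 | h1 <;>
      · refine h1.trans fun v => ?_
        simp only [Finset.mem_insert, Finset.mem_singleton]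
        tauto
    obtain ⟨w, hw⟩ : ∃ w, w = min (x (X i)) (min (x (Y i)) (x (Z i))) := ⟨_, rfl⟩
    have hw0 : 0 < w := by
      rw [hw, lt_min_iff, lt_min_iff, pos_iff hx, pos_iff hx, pos_iff hx]
      exact ⟨hX, hY, hZ⟩
    have hF : ∀ a, fwd P Q X Y Z x a = x a + w * flipVec (P i) (Q i) (X i) (Y i) (Z i) a := by
      intro a
      rw [fwd, Finset.sum_eq_single i, ← hw]
      · intro j _ hj
        rw [min₃_eq_zero hx, zero_mul]
        intro hc
        exact (h.disj i j hj.symm).2 ⟨hsub' hc.1, hsub' hc.2.1, hsub' hc.2.2⟩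
      · simp
    obtain ⟨⟨vP, vQ⟩, vX, vY, vZ⟩ := h.flipVec_apply i
    have hout : ∀ a, a ∉ ({P i, Q i, X i, Y i, Z i} : Finset V) → fwd P Q X Y Z x a = 0 := by
      intro a ha
      rw [hF, flipVec_eq_zero ha, mul_zero, add_zero]
      by_contra hne
      exact ha (hsub' (by simpa using hne))
    have wX : w ≤ x (X i) := hw ▸ min_le_left _ _
    have wY : w ≤ x (Y i) := hw ▸ (min_le_right _ _).trans (min_le_left _ _)
    have wZ : w ≤ x (Z i) := hw ▸ (min_le_right _ _).trans (min_le_right _ _)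
    have hstd : fwd P Q X Y Z x ∈ stdSimplex ℝ V := by
      constructor
      · intro a
        by_cases ha : a ∈ ({P i, Q i, X i, Y i, Z i} : Finset V)
        · have h0 := hx.1 a
          rw [hF]
          simp only [Finset.mem_insert, Finset.mem_singleton] at ha
          rcases ha with rfl | rfl | rfl | rfl | rfl
          · rw [vP]; linarith
          · rw [vQ]; linarith
          · rw [vX]; linarith
          · rw [vY]; linarith
          · rw [vZ]; linarith
        · rw [hout a ha]
      · simp only [hF, Finset.sum_add_distrib, ← Finset.mul_sum, sum_flipVec, hx.2]
        ring
    have hFsub : ({v | fwd P Q X Y Z x v ≠ 0} : Finset V) ⊆ {P i, Q i, X i, Y i, Z i} := by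
      intro a ha
      by_contra hna
      rw [Finset.mem_filter] at ha
      exact ha.2 (hout a hna)
    constructor
    · rw [mem_realization_iff]
      refine ⟨hstd, (h.mem_iff _).2 (Or.inr ⟨i, ?_, ?_, hFsub, ?_⟩)⟩
      · rw [← pos_iff hstd, hF, vP]
        linarith [hx.1 (P i)]
      · rw [← pos_iff hstd, hF, vQ]
        linarith [hx.1 (Q i)]
      · rw [← pos_iff hstd, ← pos_iff hstd, ← pos_iff hstd, hF, hF, hF, vX, vY, vZ]
        rintro ⟨g1, g2, g3⟩
        have : w < min (x (X i)) (min (x (Y i)) (x (Z i))) :=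
          lt_min (by linarith) (lt_min (by linarith) (by linarith))
        linarith
    · funext a
      have hm : min (fwd P Q X Y Z x (P i)) (fwd P Q X Y Z x (Q i)) = w * (3 / 2) := by
        rw [hF, hF, vP, vQ, min_add_add_right, min_eq_zero hx (fun hc => h.not_mem _ hs i hc.1 hc.2),
          zero_add]
      rw [bwd, Finset.sum_eq_single i, hm, hF]
      · ring
      · intro j _ hj
        rw [min_eq_zero hstd, mul_zero, zero_mul]
        intro hc
        exact (h.disj i j hj.symm).1 ⟨hFsub hc.1, hFsub hc.2⟩
      · simp
  · push Not at hi
    have hF : fwd P Q X Y Z x = x := by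
      funext a
      rw [fwd, Finset.sum_eq_zero, add_zero]
      intro i _
      rw [min₃_eq_zero hx fun hc => hi i hc.1 hc.2.1 hc.2.2, zero_mul]
    rw [hF]
    constructor
    · rw [mem_realization_iff, h.mem_iff]
      exact ⟨hx, Or.inl ⟨hs, fun i hc => hi i hc.1 hc.2.1 hc.2.2⟩⟩
    · funext a
      rw [bwd, Finset.sum_eq_zero, sub_zero]
      intro i _
      rw [min_eq_zero hx fun hc => h.not_mem _ hs i hc.1 hc.2, mul_zero, zero_mul]

/-- If both apexes carry weight, with minimum u, the map empties the lighter apex and adds 2u/3 to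
each of X, Y, Z. One of these three had weight 0, so their new minimum is 2u/3 and `fwd` undoes the
move. -/
theorem bwd_spec [Fintype V] [Fintype ι] [DecidableEq ι] (h : IsFlip K₀ K P Q X Y Z) {x : V → ℝ} (hx : x ∈ K.realization) :
    bwd P Q X Y Z x ∈ K₀.realization ∧ fwd P Q X Y Z (bwd P Q X Y Z x) = x := by
  rw [mem_realization_iff] at hx
  obtain ⟨hx, hs⟩ := hx
  rcases (h.mem_iff _).1 hs with ⟨hs, hi⟩ | ⟨i, hP, hQ, hsub, hXYZ⟩
  · have hF : bwd P Q X Y Z x = x := by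
      funext a
      rw [bwd, Finset.sum_eq_zero, sub_zero]
      intro i _
      rw [min_eq_zero hx fun hc => h.not_mem _ hs i hc.1 hc.2, mul_zero, zero_mul]
    rw [hF]
    constructor
    · rw [mem_realization_iff]
      exact ⟨hx, hs⟩
    · funext a
      rw [fwd, Finset.sum_eq_zero, add_zero]
      intro i _
      rw [min₃_eq_zero hx (hi i), zero_mul]
  · obtain ⟨u, hu⟩ : ∃ u, u = min (x (P i)) (x (Q i)) := ⟨_, rfl⟩
    have hu0 : 0 < u := by
      rw [hu, lt_min_iff, pos_iff hx, pos_iff hx]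
      exact ⟨hP, hQ⟩
    have hF : ∀ a, bwd P Q X Y Z x a =
        x a - 2 / 3 * u * flipVec (P i) (Q i) (X i) (Y i) (Z i) a := by
      intro a
      rw [bwd, Finset.sum_eq_single i, ← hu]
      · intro j _ hj
        rw [min_eq_zero hx, mul_zero, zero_mul]
        intro hc
        exact (h.disj i j hj.symm).1 ⟨hsub hc.1, hsub hc.2⟩
      · simp
    obtain ⟨⟨vP, vQ⟩, vX, vY, vZ⟩ := h.flipVec_apply i
    have hout : ∀ a, a ∉ ({P i, Q i, X i, Y i, Z i} : Finset V) → bwd P Q X Y Z x a = 0 := by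
      intro a ha
      rw [hF, flipVec_eq_zero ha, mul_zero, sub_zero]
      by_contra hne
      exact ha (hsub (by simpa using hne))
    have uP : u ≤ x (P i) := hu ▸ min_le_left _ _
    have uQ : u ≤ x (Q i) := hu ▸ min_le_right _ _
    have hstd : bwd P Q X Y Z x ∈ stdSimplex ℝ V := by
      constructor
      · intro a
        by_cases ha : a ∈ ({P i, Q i, X i, Y i, Z i} : Finset V)
        · have h0 := hx.1 a
          rw [hF]
          simp only [Finset.mem_insert, Finset.mem_singleton] at ha
          rcases ha with rfl | rfl | rfl | rfl | rfl
          · rw [vP]; linarith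
          · rw [vQ]; linarith
          · rw [vX]; linarith
          · rw [vY]; linarith
          · rw [vZ]; linarith
        · rw [hout a ha]
      · simp only [hF, Finset.sum_sub_distrib, ← Finset.mul_sum, sum_flipVec, hx.2]
        ring
    have hFsub : ({v | bwd P Q X Y Z x v ≠ 0} : Finset V) ⊆ {P i, Q i, X i, Y i, Z i} := by
      intro a ha
      by_contra hna
      rw [Finset.mem_filter] at ha
      exact ha.2 (hout a hna)
    constructor
    · rw [realization]
      refine ⟨hstd, ?_⟩
      rcases le_total (x (P i)) (x (Q i)) with hle | hle
      · refine ⟨_, (h.mem₀ i).2, fun a ha => ?_⟩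
        have h1 := hFsub (by simpa using ha)
        have h2 : a ≠ P i := by
          rintro rfl
          apply ha
          rw [hF, vP, hu, min_eq_left hle]; ring
        simp only [Finset.mem_insert, Finset.mem_singleton] at h1 ⊢
        tauto
      · refine ⟨_, (h.mem₀ i).1, fun a ha => ?_⟩
        have h1 := hFsub (by simpa using ha)
        have h2 : a ≠ Q i := by
          rintro rfl
          apply ha
          rw [hF, vQ, hu, min_eq_right hle]; ring
        simp only [Finset.mem_insert, Finset.mem_singleton] at h1 ⊢
        tauto
    · funext a
      have hm : min (bwd P Q X Y Z x (X i)) (min (bwd P Q X Y Z x (Y i)) (bwd P Q X Y Z x (Z i))) =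
          2 / 3 * u := by
        rw [hF, hF, hF, vX, vY, vZ, min_sub_sub_right, min_sub_sub_right,
          min₃_eq_zero hx hXYZ]
        ring
      rw [fwd, Finset.sum_eq_single i, hm, hF]
      · ring
      · intro j _ hj
        rw [min₃_eq_zero hstd, zero_mul]
        intro hc
        exact (h.disj i j hj.symm).2 ⟨hFsub hc.1, hFsub hc.2.1, hFsub hc.2.2⟩
      · simp

/-- Bistellar flips do not change the geometric realization. -/
def homeomorph [Fintype V] [Fintype ι] [DecidableEq ι] (h : IsFlip K₀ K P Q X Y Z) : K₀.realization ≃ₜ K.realization where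
  toFun x := ⟨fwd P Q X Y Z x.1, (h.fwd_spec x.2).1⟩
  invFun x := ⟨bwd P Q X Y Z x.1, (h.bwd_spec x.2).1⟩
  left_inv x := Subtype.ext (h.fwd_spec x.2).2
  right_inv x := Subtype.ext (h.bwd_spec x.2).2
  continuous_toFun := ((continuous_fwd P Q X Y Z).comp continuous_subtype_val).subtype_mk _
  continuous_invFun := ((continuous_bwd P Q X Y Z).comp continuous_subtype_val).subtype_mk _

end IsFlip

end AbstractSimplicialComplex

/-! ### The cyclic action and the orbit of flips that yields the final complex. -/

namespace Prism

open LVert AbstractSimplicialComplex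

/-- The action of `ℤ / 2r` on the vertices of the quotient complex. -/
def rot (r : ℕ) (d : ZMod (2 * r)) : QVert r → QVert r
  | .inl (.inl i) => .inl (.inl i)
  | .inl (.inr (j, k)) => .inl (.inr (j, k + d))
  | .inr (.inl k) => .inr (.inl (k + d))
  | .inr (.inr (h, k)) => .inr (.inr (h, k + ZMod.castHom (Dvd.intro_left 2 rfl) (ZMod r) d))

theorem rot_zero (r : ℕ) (x : QVert r) : rot r 0 x = x := by
  rcases x with (i | ⟨j, k⟩) | (k | ⟨h, k⟩) <;> simp [rot]

theorem rot_rot (r : ℕ) (d e : ZMod (2 * r)) (x : QVert r) :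
    rot r d (rot r e x) = rot r (d + e) x := by
  rcases x with (i | ⟨j, k⟩) | (k | ⟨h, k⟩) <;> simp only [rot, map_add] <;> ring_nf

theorem rot_intCast (r : ℕ) (d : ℤ) (x : QVert r) : rot r d x = act r d x := by
  rcases x with (i | ⟨j, k⟩) | (k | ⟨h, k⟩) <;> simp [rot, act]

theorem rot_injective (r : ℕ) (d : ZMod (2 * r)) : Function.Injective (rot r d) := by
  intro x y h
  have := congrArg (rot r (-d)) h
  simpa [rot_rot, rot_zero] using this

theorem rot_proj (r : ℕ) (n : ℤ) (u : LVert) : rot r n (proj r u) = proj r (shift (-n) 0 u) := by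
  rw [rot_intCast, proj_shift]
  simp

theorem image_shift_lFace {T : Finset LVert} (hT : LFace T) (k q : ℤ) :
    LFace (T.image (shift k q)) := by
  refine ⟨hT.1.image _, ?_⟩
  simp only [Finset.mem_image]
  rintro _ ⟨u, hu, rfl⟩ _ ⟨v, hv, rfl⟩
  exact (near_shift _ _ _ _).2 (hT.2 u hu v hv)

/-- A translate of the projection of a set of lifted vertices. -/
def spot (r : ℕ) (d : ZMod (2 * r)) (T : Finset LVert) : Finset (QVert r) :=
  T.image fun u => rot r d (proj r u)

theorem spot_intCast (r : ℕ) (n : ℤ) (T : Finset LVert) :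
    spot r n T = (T.image (shift (-n) 0)).image (proj r) := by
  rw [Finset.image_image]
  exact Finset.image_congr fun u _ => rot_proj r n u

theorem image_rot_spot (r : ℕ) (d e : ZMod (2 * r)) (T : Finset LVert) :
    (spot r e T).image (rot r d) = spot r (d + e) T := by
  rw [spot, Finset.image_image]
  exact Finset.image_congr fun u _ => rot_rot r d e _

variable {r : ℕ}

theorem spot_mem {T : Finset LVert} (hT : LFace T) (d : ZMod (2 * r)) :
    spot r d T ∈ (quotComplex r).faces := by
  obtain ⟨n, rfl⟩ := ZMod.intCast_surjective d
  exact ⟨_, image_shift_lFace hT _ _, (spot_intCast r n T).symm⟩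

theorem image_rot_mem {s : Finset (QVert r)} (hs : s ∈ (quotComplex r).faces) (d : ZMod (2 * r)) :
    s.image (rot r d) ∈ (quotComplex r).faces := by
  obtain ⟨T, hT, rfl⟩ := hs
  have : T.image (proj r) = spot r 0 T := Finset.image_congr fun u _ => (rot_zero r _).symm
  rw [this, image_rot_spot]
  exact spot_mem hT _

/-- A lift of a face can be chosen to contain a given lift of an inner vertex. -/
theorem exists_lift_mem {T : Finset LVert} (hT : LFace T) {u : LVert} (hu : IsIn u)
    (h : proj r u ∈ T.image (proj r)) :
    ∃ T', LFace T' ∧ T'.image (proj r) = T.image (proj r) ∧ u ∈ T' := by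
  obtain ⟨v, hv, he⟩ := Finset.mem_image.1 h
  obtain ⟨q, l, rfl | ⟨hb, -⟩⟩ := exists_of_proj_eq r he
  · refine ⟨_, image_shift_lFace hT _ _, ?_, Finset.mem_image_of_mem _ hv⟩
    rw [Finset.image_image]
    exact Finset.image_congr fun w _ => Deck.proj_eq (T := T) ⟨q, l, Or.inl rfl⟩ w
  · exact absurd hb (not_isBd_of_isIn ((type_of_proj_eq he).1.2 hu))

/-- The first apex of a flipped triangle. -/
def ptP (r : ℕ) (d : ZMod (2 * r)) : QVert r := rot r d (proj r (O 3))

/-- The second apex of a flipped triangle. -/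
def ptQ (r : ℕ) (d : ZMod (2 * r)) : QVert r := rot r d (proj r (M 0 1))

/-- The first vertex of a flipped triangle. -/
def ptX (r : ℕ) (d : ZMod (2 * r)) : QVert r := rot r d (proj r (A 0 2))

/-- The second vertex of a flipped triangle. -/
def ptY (r : ℕ) (d : ZMod (2 * r)) : QVert r := rot r d (proj r (A 1 2))

/-- The third vertex of a flipped triangle. -/
def ptZ (r : ℕ) (d : ZMod (2 * r)) : QVert r := rot r d (proj r (A 1 3))

/-- All pairs except the two apexes are edges of the lifted complex, on which `proj` is injective;
the apexes are of different kinds. -/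
theorem pt_ne (hr : 2 ≤ r) (d : ZMod (2 * r)) : ptP r d ≠ ptQ r d ∧ ptP r d ≠ ptX r d ∧
    ptP r d ≠ ptY r d ∧ ptP r d ≠ ptZ r d ∧ ptQ r d ≠ ptX r d ∧ ptQ r d ≠ ptY r d ∧
    ptQ r d ≠ ptZ r d ∧ ptX r d ≠ ptY r d ∧ ptX r d ≠ ptZ r d ∧ ptY r d ≠ ptZ r d := by
  have key : ∀ u v, Near u v → u ≠ v → rot r d (proj r u) ≠ rot r d (proj r v) :=
    fun u v h h' e => h' (proj_near_injective hr h (rot_injective r d e))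
  refine ⟨?_, key _ _ (by decide) (by decide), key _ _ (by decide) (by decide),
    key _ _ (by decide) (by decide), key _ _ (by decide) (by decide), key _ _ (by decide) (by decide),
    key _ _ (by decide) (by decide), key _ _ (by decide) (by decide), key _ _ (by decide) (by decide),
    key _ _ (by decide) (by decide)⟩
  simp [ptP, ptQ, rot, proj]

/-- Among the five vertices of a flip only `ptQ` is an M vertex, and rotations act freely on those.
-/
theorem eq_of_ptQ_mem {i j : ZMod (2 * r)}
    (h : ptQ r j ∈ ({ptP r i, ptQ r i, ptX r i, ptY r i, ptZ r i} : Finset (QVert r))) : i = j := by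
  simp only [ptP, ptQ, ptX, ptY, ptZ, rot, proj, Finset.mem_insert, Finset.mem_singleton,
    reduceCtorEq, Sum.inr.injEq, Sum.inl.injEq, false_or, or_false, add_right_inj] at h
  exact h.symm

/-- The height 3 of Z differs modulo 3 from the height 2 of X and Y, so Z can only coincide with
another Z. -/
theorem eq_of_ptZ_mem {i j : ZMod (2 * r)}
    (h : ptZ r j ∈ ({ptP r i, ptQ r i, ptX r i, ptY r i, ptZ r i} : Finset (QVert r))) : i = j := by
  have h1 : ((3 : ℤ) : ZMod 3) ≠ ((2 : ℤ) : ZMod 3) := by decide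
  simp only [ptP, ptQ, ptX, ptY, ptZ, rot, proj, Finset.mem_insert, Finset.mem_singleton,
    reduceCtorEq, Sum.inr.injEq, Sum.inl.injEq, false_or, Prod.mk.injEq, h1, false_and, true_and,
    add_right_inj] at h
  exact h.symm

theorem pt_mem (d : ZMod (2 * r)) :
    {ptP r d, ptX r d, ptY r d, ptZ r d} ∈ (quotComplex r).faces ∧
      {ptQ r d, ptX r d, ptY r d, ptZ r d} ∈ (quotComplex r).faces := by
  constructor
  · have := spot_mem (r := r) (T := {O 3, A 0 2, A 1 2, A 1 3}) ⟨by simp, by decide⟩ d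
    simpa [spot, Finset.image_insert, ptP, ptQ, ptX, ptY, ptZ] using this
  · have := spot_mem (r := r) (T := {M 0 1, A 0 2, A 1 2, A 1 3}) ⟨by simp, by decide⟩ d
    simpa [spot, Finset.image_insert, ptP, ptQ, ptX, ptY, ptZ] using this

/-- The triangulation of the prism space. -/
def prismComplex (r : ℕ) (hr : 2 ≤ r) : AbstractSimplicialComplex (QVert r) :=
  (quotComplex r).flip (ptP r) (ptQ r) (ptX r) (ptY r) (ptZ r)
    (fun d => (pt_ne hr d).2.2.2.2.2.2.2.1) pt_mem
    fun _ _ h h' => h (eq_of_ptZ_mem h'.2.2)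

/-- The only further common neighbours of the triangle are O 3 and M n 1, and these are not joined
to each other. -/
theorem lift_subset {n : ℤ} {T : Finset LVert} (hT : LFace T) (hX : A n 2 ∈ T)
    (hY : A (n + 1) 2 ∈ T) (hZ : A (n + 1) 3 ∈ T) :
    T ⊆ {O 3, A n 2, A (n + 1) 2, A (n + 1) 3} ∨ T ⊆ {M n 1, A n 2, A (n + 1) 2, A (n + 1) 3} := by
  have key : ∀ v ∈ T, v ∈ ({O 3, M n 1, A n 2, A (n + 1) 2, A (n + 1) 3} : Finset LVert) := by
    intro v hv
    have h1 := hT.2 _ hX _ hv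
    have h2 := hT.2 _ hY _ hv
    have h3 := hT.2 _ hZ _ hv
    cases v <;> simp only [Near, Finset.mem_insert, Finset.mem_singleton, O.injEq, A.injEq, M.injEq,
      reduceCtorEq] at h1 h2 h3 ⊢ <;> omega
  by_cases hO : O 3 ∈ T
  · left
    intro v hv
    have h1 := key v hv
    have h2 : v ≠ M n 1 := fun e => (show ¬ Near (O 3) (M n 1) from id) (hT.2 _ hO _ (e ▸ hv))
    simp only [Finset.mem_insert, Finset.mem_singleton] at h1 ⊢
    tauto
  · right
    intro v hv
    have h1 := key v hv
    have h2 : v ≠ O 3 := fun e => hO (e ▸ hv)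
    simp only [Finset.mem_insert, Finset.mem_singleton] at h1 ⊢
    tauto

/-- A face containing a flipped triangle has a lift containing the corresponding lifted triangle. -/
theorem exists_lift_flip (hr : 2 ≤ r) {s : Finset (QVert r)} (hs : s ∈ (quotComplex r).faces) {n : ℤ}
    (hX : ptX r (-n : ℤ) ∈ s) (hY : ptY r (-n : ℤ) ∈ s) (hZ : ptZ r (-n : ℤ) ∈ s) :
    ∃ T, LFace T ∧ T.image (proj r) = s ∧ A n 2 ∈ T ∧ A (n + 1) 2 ∈ T ∧ A (n + 1) 3 ∈ T := by
  obtain ⟨T₀, hT₀, rfl⟩ := hs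
  rw [ptX, rot_proj, neg_neg] at hX
  rw [ptY, rot_proj, neg_neg] at hY
  rw [ptZ, rot_proj, neg_neg] at hZ
  simp only [shift, mul_zero, add_zero, zero_add, add_comm 1 n] at hX hY hZ
  obtain ⟨T, hT, he, hX'⟩ := exists_lift_mem hT₀ (by trivial) hX
  rw [← he] at hY hZ
  have key : ∀ v, proj r v ∈ T.image (proj r) → Near (A n 2) v → v ∈ T := by
    intro v hv h1
    obtain ⟨w, hw, e⟩ := Finset.mem_image.1 hv
    rwa [← proj_star_injective hr (hT.2 _ hX' _ hw) h1 (Or.inl trivial) e]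
  refine ⟨T, hT, he, hX', key _ hY ?_, key _ hZ ?_⟩ <;> simp [Near]

theorem isFlip_prismComplex (hr : 2 ≤ r) : IsFlip (quotComplex r) (prismComplex r hr) (ptP r)
    (ptQ r) (ptX r) (ptY r) (ptZ r) where
  ne := pt_ne hr
  subset_of_mem s hs d hX hY hZ := by
    obtain ⟨n, rfl⟩ : ∃ n : ℤ, ((-n : ℤ) : ZMod (2 * r)) = d := by
      obtain ⟨n, rfl⟩ := ZMod.intCast_surjective d
      exact ⟨-n, by simp⟩
    obtain ⟨T, hT, rfl, h1, h2, h3⟩ := exists_lift_flip hr hs hX hY hZ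
    simp only [ptP, ptQ, ptX, ptY, ptZ, rot_proj, shift, neg_neg, zero_add, mul_zero, add_zero,
      add_comm 1 n]
    refine (lift_subset hT h1 h2 h3).imp (fun h => ?_) fun h => ?_ <;>
      simpa [Finset.image_insert] using Finset.image_subset_image (f := proj r) h
  not_mem := by
    rintro _ ⟨T, hT, rfl⟩ d hP hQ
    obtain ⟨u, hu, h1⟩ := Finset.mem_image.1 hP
    obtain ⟨v, hv, h2⟩ := Finset.mem_image.1 hQ
    have h3 := hT.2 u hu v hv
    cases u <;> cases v <;> simp_all [proj, ptP, ptQ, rot, Near]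
  mem₀ := pt_mem
  mem_iff s := Iff.rfl
  disj i j h := ⟨fun h' => h (eq_of_ptQ_mem h'.2), fun h' => h (eq_of_ptZ_mem h'.2.2)⟩

theorem nonempty_homeomorph_prismComplex [NeZero r] (hr : 2 ≤ r) :
    Nonempty ((prismComplex r hr).realization ≃ₜ PrismSpace r) :=
  ⟨(isFlip_prismComplex hr).homeomorph.symm.trans (nonempty_homeomorph_quotComplex hr).some⟩

/-- Rotation by d carries flip i to flip i + d; the symmetry survives because the whole orbit is
flipped. -/
theorem image_rot_mem_prismComplex (hr : 2 ≤ r) {s : Finset (QVert r)}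
    (hs : s ∈ (prismComplex r hr).faces) (d : ZMod (2 * r)) :
    s.image (rot r d) ∈ (prismComplex r hr).faces := by
  have hm : ∀ (i : ZMod (2 * r)) (u : LVert), rot r i (proj r u) ∈ s.image (rot r d) ↔
      rot r (i - d) (proj r u) ∈ s := by
    intro i u
    rw [← (rot_injective r d).mem_finset_image (s := s), rot_rot, add_sub_cancel]
  rcases hs with ⟨hs, hn⟩ | ⟨i, hP, hQ, hs, hn⟩
  · refine Or.inl ⟨image_rot_mem hs d, fun i => ?_⟩
    have := hn (i - d)
    simpa only [ptX, ptY, ptZ, hm] using this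
  · refine Or.inr ⟨i + d, ?_, ?_, ?_, ?_⟩
    · simpa only [ptP, hm, add_sub_cancel_right] using hP
    · simpa only [ptQ, hm, add_sub_cancel_right] using hQ
    · have := Finset.image_subset_image (f := rot r d) hs
      simpa only [Finset.image_insert, Finset.image_singleton, ptP, ptQ, ptX, ptY, ptZ, rot_rot,
        add_comm d i] using this
    · simpa only [ptX, ptY, ptZ, hm, add_sub_cancel_right] using hn


/-! ### Normal forms of faces modulo rotation and deck transformations. -/

open LVert AbstractSimplicialComplex

/-- The first vertices of normalized faces. -/
def root : Fin 4 → LVert := ![A 0 0, A 0 1, A 0 2, M 0 1]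

/-- The vertices of the normalized faces with a given first vertex. -/
def link : Fin 4 → Finset LVert :=
  ![{A 0 0, O 0, O 1, A 0 1, A 1 0, A 1 1, M 0 (-1), M 0 0, M (-1) (-1), B 0 (-2), B 0 (-1), B 0 0},
    {A 0 1, O 1, O 2, A 0 2, A 1 1, A 1 2, M 0 0, M 0 1, M (-1) (-1), M (-1) 0, B 0 0, B 0 1},
    {A 0 2, O 2, O 3, A 0 3, A 1 2, A 1 3, M 0 1, M (-1) 0, M (-1) 1, B 0 1, B 0 2},
    {M 0 1, M 0 2, B 0 0, B 0 1, B 0 2, B 1 2, B 1 3, B 1 4}]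

/-- The normalized faces with `c` vertices that do not contain a flipped triangle. -/
def normalFaces (c : ℕ) (t : Fin 4) : Finset (Finset LVert) :=
  ((link t).powersetCard c).filter fun T => (root t ∈ T ∧ ∀ u ∈ T, ∀ v ∈ T, Near u v) ∧
    ¬ (A 0 2 ∈ T ∧ A 1 2 ∈ T ∧ A 1 3 ∈ T)

/-- The new faces with `c` vertices of a flip. -/
def flipFaces (c : ℕ) : Finset (Finset LVert) :=
  (({O 3, M 0 1, A 0 2, A 1 2, A 1 3} : Finset LVert).powersetCard c).filter fun T =>
    (O 3 ∈ T ∧ M 0 1 ∈ T) ∧ ¬ (A 0 2 ∈ T ∧ A 1 2 ∈ T ∧ A 1 3 ∈ T)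

/-- These count free rotation orbits. The value for five vertices, together with that in
`card_flipFaces`, bounds the dimension. -/
theorem card_normalFaces : ∑ t, (normalFaces 2 t).card = 39 ∧ ∑ t, (normalFaces 3 t).card = 69 ∧
    ∑ t, (normalFaces 4 t).card = 33 ∧ ∑ t, (normalFaces 5 t).card = 0 := by
  decide +kernel

theorem card_flipFaces : (flipFaces 2).card = 1 ∧ (flipFaces 3).card = 3 ∧
    (flipFaces 4).card = 3 ∧ (flipFaces 5).card = 0 := by
  decide +kernel

variable {r : ℕ}

theorem mem_spot (d : ZMod (2 * r)) {T : Finset LVert} {u : LVert} (hu : u ∈ T) :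
    rot r d (proj r u) ∈ spot r d T := Finset.mem_image_of_mem _ hu

theorem image_proj_eq_spot (T : Finset LVert) (k q : ℤ) :
    T.image (proj r) = spot r (k - 2 * q : ℤ) (T.image (shift k q)) := by
  rw [spot, Finset.image_image]
  refine Finset.image_congr fun u _ => ?_
  rw [Function.comp_apply, rot_intCast, proj_shift, act_act,
    show k - 2 * q + (2 * q - k) = 0 by ring, act_zero]

/-- A normalized face is determined by its projection. -/
theorem normal_unique (hr : 2 ≤ r) {t t' : Fin 4} {T T' : Finset LVert} {d d' : ZMod (2 * r)}
    (hT : LFace T) (hT' : LFace T') (ht : root t ∈ T) (ht' : root t' ∈ T') (hl : T ⊆ link t)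
    (hl' : T' ⊆ link t') (h : spot r d T = spot r d' T') : t = t' ∧ T = T' ∧ d = d' := by
  obtain ⟨n, rfl⟩ := ZMod.intCast_surjective d
  obtain ⟨n', rfl⟩ := ZMod.intCast_surjective d'
  rw [spot_intCast, spot_intCast] at h
  obtain ⟨γ, ⟨q, l, rfl | ⟨hb, rfl⟩⟩, he⟩ :=
    exists_deck hr (image_shift_lFace hT _ _) (image_shift_lFace hT' _ _) h
  · have e : T' = T.image (shift (2 * q + 2 * (r * l) - n + n') q) := by
      apply Finset.image_injective (shift_injective (-n') 0)
      rw [← he, Finset.image_image, Finset.image_image]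
      refine Finset.image_congr fun u _ => ?_
      simp only [Function.comp_apply, shift_shift]
      congr 1 <;> ring
    obtain ⟨k, hk⟩ : ∃ k, k = 2 * q + 2 * (r * l) - n + n' := ⟨_, rfl⟩
    rw [← hk] at e
    have h1 : shift k q (root t) ∈ link t' := hl' (e ▸ Finset.mem_image_of_mem _ ht)
    have h2 : shift (-k) (-q) (root t') ∈ link t := by
      rw [e] at ht'
      obtain ⟨u, hu, hu'⟩ := Finset.mem_image.1 ht'
      rw [← hu', shift_shift]
      simpa [shift_zero] using hl hu
    -- Only the trivial shift takes one root into the link of the other while its inverse does the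
    -- same in return, since `link` keeps no neighbour that precedes the root.
    have h3 : t = t' ∧ k = 0 ∧ q = 0 := by
      fin_cases t <;> fin_cases t' <;> simp [root, link, shift] at h1 h2 ⊢ <;> omega
    obtain ⟨rfl, rfl, rfl⟩ := h3
    refine ⟨rfl, ?_, ?_⟩
    · rw [e]
      conv_lhs => rw [← Finset.image_id (s := T)]
      exact Finset.image_congr fun u _ => (shift_zero u).symm
    · rw [zmod_eq_iff]
      exact ⟨-l, by push_cast; linarith⟩
  -- Here both roots are M 0 1. As `fold` reverses the parity of heights on M columns, the
  -- transformation would have to interchange the heights 1 and 2, but it moves all vertices of one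
  -- M column by the same amount.
  · exfalso
    have h1 : shift (2 * q + 2 * (r * l)) q (fold r (shift (-n) 0 (root t))) ∈
        T'.image (shift (-n') 0) :=
      he ▸ Finset.mem_image_of_mem _ (Finset.mem_image_of_mem _ ht)
    have h2 := Finset.mem_image_of_mem (shift (-n') 0) ht'
    rw [← he, Finset.image_image] at h2
    obtain ⟨u, hu, e⟩ := Finset.mem_image.1 h2
    obtain ⟨u', hu', e'⟩ := Finset.mem_image.1 h1
    have hb1 := hb _ (Finset.mem_image_of_mem _ hu)
    have hb2 := hb _ (Finset.mem_image_of_mem _ ht)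
    replace hu := hl hu
    replace hu' := hl' hu'
    clear h h1 h2 he hT hT' hl hl' ht ht' hb
    generalize (r : ℤ) * l = x at e e'
    fin_cases t <;> simp [root, shift, IsBd] at hb2
    fin_cases t' <;> cases u <;> simp [root, shift, fold, IsBd] at hb1 e
    cases u' <;> simp [root, shift, fold] at e'
    simp [link] at hu hu'
    omega

/-- The two hypotheses express minimality of the root: no inner vertex has smaller n + j, and for t
= 3 there are no inner vertices and no M vertices of smaller height. -/
theorem mem_link {t : Fin 4} {v : LVert} (h : Near (root t) v)
    (hA : ∀ a l, v = A a l → t ≠ 3 ∧ (t : ℤ) ≤ a + l) (hM : t = 3 → ∀ a m, v = M a m → 1 ≤ m) :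
    v ∈ link t := by
  fin_cases t <;> cases v <;> simp [root, link, Near] at h hA hM ⊢ <;> omega

theorem exists_normal_of_isIn {T : Finset LVert} (hT : LFace T) (h : ∃ u ∈ T, IsIn u) :
    ∃ (t : Fin 4) (T' : Finset LVert) (d : ZMod (2 * r)), LFace T' ∧ root t ∈ T' ∧ T' ⊆ link t ∧
      T.image (proj r) = spot r d T' := by
  -- Distinct inner vertices joined by an edge have different values of n + j, so the minimizer in a
  -- face is unique.
  let key : LVert → ℤ := fun v => match v with
    | A n j => n + j
    | _ => 0
  obtain ⟨u, hu, hmin⟩ := Finset.exists_min_image (T.filter IsIn) key (by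
    obtain ⟨u, hu, hi⟩ := h
    exact ⟨u, Finset.mem_filter.2 ⟨hu, hi⟩⟩)
  obtain ⟨hu, hi⟩ := Finset.mem_filter.1 hu
  obtain ⟨n, j, rfl⟩ : ∃ n j, u = A n j := by
    cases u <;> simp_all [IsIn]
  have hlt : (j % 3).toNat < 4 := by omega
  have hroot : root ⟨(j % 3).toNat, hlt⟩ = A 0 (j % 3) := by
    have h1 : j % 3 = 0 ∨ j % 3 = 1 ∨ j % 3 = 2 := by omega
    rcases h1 with h1 | h1 | h1 <;> simp [h1, root]
  have hs : shift (-n) (-(j / 3)) (A n j) = A 0 (j % 3) := by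
    simp only [shift, A.injEq]
    omega
  have hmem : A 0 (j % 3) ∈ T.image (shift (-n) (-(j / 3))) := hs ▸ Finset.mem_image_of_mem _ hu
  refine ⟨⟨(j % 3).toNat, hlt⟩, _, _, image_shift_lFace hT _ _, hroot ▸ hmem, fun v hv => ?_,
    image_proj_eq_spot T (-n) (-(j / 3))⟩
  refine mem_link (hroot ▸ (image_shift_lFace hT _ _).2 _ hmem _ hv) ?_ ?_
  · rintro a l rfl
    obtain ⟨w, hw, e⟩ := Finset.mem_image.1 hv
    cases w <;> simp only [shift, A.injEq, reduceCtorEq] at e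
    have h2 := hmin _ (Finset.mem_filter.2 ⟨hw, trivial⟩)
    simp only [key] at h2
    rw [Ne, Fin.ext_iff]
    change ¬ (j % 3).toNat = 3 ∧ ((j % 3).toNat : ℤ) ≤ a + l
    omega
  · intro h3
    rw [Fin.ext_iff] at h3
    change (j % 3).toNat = 3 at h3
    omega

theorem exists_normal_of_odd {T : Finset LVert} (hT : LFace T) (hA : ∀ u ∈ T, ¬ IsIn u) {n m : ℤ}
    (hu : M n (2 * m + 1) ∈ T) (hmin : ∀ n' m', M n' m' ∈ T → 2 * m + 1 ≤ m') :
    ∃ (t : Fin 4) (T' : Finset LVert) (d : ZMod (2 * r)), LFace T' ∧ root t ∈ T' ∧ T' ⊆ link t ∧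
      T.image (proj r) = spot r d T' := by
  have hmem : M 0 1 ∈ T.image (shift (-n) (-m)) := by
    refine Finset.mem_image.2 ⟨_, hu, ?_⟩
    simp only [shift, M.injEq]
    omega
  refine ⟨3, _, _, image_shift_lFace hT _ _, hmem, fun v hv => ?_,
    image_proj_eq_spot T (-n) (-m)⟩
  refine mem_link ((image_shift_lFace hT _ _).2 _ hmem _ hv) ?_ ?_
  · rintro a l rfl
    obtain ⟨w, hw, e⟩ := Finset.mem_image.1 hv
    cases w <;> simp only [shift, reduceCtorEq] at e
    exact absurd trivial (hA _ hw)
  · rintro - a l rfl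
    obtain ⟨w, hw, e⟩ := Finset.mem_image.1 hv
    cases w <;> simp only [shift, M.injEq, reduceCtorEq] at e
    have := hmin _ _ hw
    omega

theorem exists_normal_of_M {T : Finset LVert} (hT : LFace T) (hA : ∀ u ∈ T, ¬ IsIn u)
    (h : ∃ n m, M n m ∈ T) :
    ∃ (t : Fin 4) (T' : Finset LVert) (d : ZMod (2 * r)), LFace T' ∧ root t ∈ T' ∧ T' ⊆ link t ∧
      T.image (proj r) = spot r d T' := by
  classical
  let key : LVert → ℤ := fun v => match v with
    | M _ m => m
    | _ => 0
  obtain ⟨u, hu, hmin⟩ := Finset.exists_min_image (T.filter fun v => ∃ n m, v = M n m) key (by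
    obtain ⟨n, m, hu⟩ := h
    exact ⟨_, Finset.mem_filter.2 ⟨hu, n, m, rfl⟩⟩)
  obtain ⟨hu, n, m, rfl⟩ := Finset.mem_filter.1 hu
  replace hmin : ∀ n' m', M n' m' ∈ T → m ≤ m' := fun n' m' hm =>
    hmin _ (Finset.mem_filter.2 ⟨hm, n', m', rfl⟩)
  rcases Int.even_or_odd' m with ⟨b, rfl | rfl⟩
  -- An even lowest M vertex is made odd by `fold`. All M vertices of a face lie in one column, so
  -- their heights change by the same amount and the lowest stays lowest.
  · have hb : ∀ u ∈ T, IsBd u := (hT.isBd_or_isAx hA).resolve_right fun h => h _ hu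
    have he : (T.image (fold r)).image (proj r) = T.image (proj r) := by
      rw [Finset.image_image]
      exact Finset.image_congr fun u _ => proj_fold r u
    rw [← he]
    refine exists_normal_of_odd ⟨hT.1.image _, ?_⟩ ?_ (n := r - n - 1) (m := b - n - 1 + r)
      (Finset.mem_image.2 ⟨_, hu, ?_⟩) ?_
    · simp only [Finset.mem_image]
      rintro _ ⟨u, hu, rfl⟩ _ ⟨v, hv, rfl⟩
      exact (near_fold _ (hb u hu) (hb v hv)).2 (hT.2 u hu v hv)
    · intro v hv
      obtain ⟨u, hu, rfl⟩ := Finset.mem_image.1 hv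
      have := hb u hu
      cases u <;> simp_all [fold, IsIn, IsBd]
    · simp only [fold, M.injEq, true_and]
      omega
    · intro n' m' hm
      obtain ⟨v, hv, e⟩ := Finset.mem_image.1 hm
      cases v <;> simp only [fold, M.injEq, reduceCtorEq] at e
      have h1 := hT.2 _ hu _ hv
      have h2 := hmin _ _ hv
      simp only [Near] at h1
      omega
  · exact exists_normal_of_odd hT hA hu hmin

/-- Vertices of normalized faces that a flip triangle occurs in. -/
theorem normal_flip (hr : 2 ≤ r) {t : Fin 4} {T : Finset LVert} (hT : LFace T) (hl : T ⊆ link t)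
    {d i : ZMod (2 * r)} (hX : ptX r i ∈ spot r d T) (hY : ptY r i ∈ spot r d T)
    (hZ : ptZ r i ∈ spot r d T) : A 0 2 ∈ T ∧ A 1 2 ∈ T ∧ A 1 3 ∈ T := by
  obtain ⟨n, e⟩ := ZMod.intCast_surjective (i - d)
  have hm : ∀ u, rot r i (proj r u) ∈ spot r d T → ∃ v ∈ T, proj r (shift (-n) 0 u) = proj r v := by
    intro u hu
    obtain ⟨v, hv, h⟩ := Finset.mem_image.1 hu
    refine ⟨v, hv, rot_injective r d ?_⟩
    rw [h, ← rot_proj, e, rot_rot, add_sub_cancel]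
  obtain ⟨x, hx, ex⟩ := hm _ hX
  obtain ⟨y, hy, ey⟩ := hm _ hY
  obtain ⟨z, hz, ez⟩ := hm _ hZ
  obtain ⟨q, l, hxe | ⟨hb, -⟩⟩ := exists_of_proj_eq r ex
  swap
  · exact hb.elim
  have hγ : ∀ u, proj r (shift (2 * q + 2 * (r * l)) q u) = proj r u :=
    Deck.proj_eq (T := ∅) ⟨q, l, Or.inl rfl⟩
  have key : ∀ u v, v ∈ T → proj r (shift (-n) 0 u) = proj r v → Near (A 0 2) u →
      v = shift (2 * q + 2 * (r * l)) q (shift (-n) 0 u) := by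
    intro u v hv h1 h2
    refine proj_star_injective hr (hT.2 x hx v hv) ?_ (Or.inl ?_) (by rw [hγ, h1])
    · rw [hxe, near_shift, near_shift]; exact h2
    · rw [hxe, (type_shift _ _ _).1, (type_shift _ _ _).1]; trivial
  have hye := key _ y hy ey (by decide)
  have hze := key _ z hz ez (by decide)
  subst hxe hye hze
  simp only [shift_shift, add_zero] at hx hy hz
  generalize 2 * q + 2 * (r * l) + -n = k at hx hy hz
  have h1 := hl hx
  have h2 := hl hy
  have h3 := hl hz
  have h4 : k = 0 ∧ q = 0 := by
    fin_cases t <;> simp [link, shift] at h1 h2 h3 <;> omega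
  obtain ⟨rfl, rfl⟩ := h4
  simp only [shift_zero] at hx hy hz
  exact ⟨hx, hy, hz⟩


/-! ### Counting the main, new and side faces. -/

open LVert AbstractSimplicialComplex

variable {r : ℕ}

theorem LFace.card_spot (hr : 2 ≤ r) {T : Finset LVert} (hT : LFace T) (d : ZMod (2 * r)) :
    (spot r d T).card = T.card :=
  Finset.card_image_of_injOn fun _ hu _ hv h => hT.proj_injOn hr hu hv (rot_injective r d h)

theorem mem_normalFaces {c : ℕ} {t : Fin 4} {T : Finset LVert} : T ∈ normalFaces c t ↔
    T ⊆ link t ∧ T.card = c ∧ root t ∈ T ∧ LFace T ∧ ¬ (A 0 2 ∈ T ∧ A 1 2 ∈ T ∧ A 1 3 ∈ T) := by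
  rw [normalFaces, Finset.mem_filter, Finset.mem_powersetCard]
  constructor
  · rintro ⟨⟨h1, h2⟩, ⟨h3, h4⟩, h5⟩
    exact ⟨h1, h2, h3, ⟨⟨_, h3⟩, h4⟩, h5⟩
  · rintro ⟨h1, h2, h3, h4, h5⟩
    exact ⟨⟨h1, h2⟩, ⟨h3, h4.2⟩, h5⟩

/-- The faces of the first kind with `c` vertices: those of the quotient complex that contain an
inner vertex or a boundary vertex `M`. -/
def mainFaces (r c : ℕ) : Set (Finset (QVert r)) :=
  {s | (∃ T, LFace T ∧ T.image (proj r) = s ∧ ((∃ u ∈ T, IsIn u) ∨ ∃ n m, M n m ∈ T)) ∧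
    (∀ i, ¬ (ptX r i ∈ s ∧ ptY r i ∈ s ∧ ptZ r i ∈ s)) ∧ s.card = c}

theorem isIn_or_of_root (t : Fin 4) : IsIn (root t) ∨ ∃ n m, root t = M n m := by
  fin_cases t <;> simp [root, IsIn]

theorem mainFaces_eq (hr : 2 ≤ r) (c : ℕ) : mainFaces r c =
    (fun p : (Σ _ : Fin 4, Finset LVert) × ZMod (2 * r) => spot r p.2 p.1.2) ''
      ↑(Finset.univ.sigma (normalFaces c) ×ˢ (Set.univ : Set (ZMod (2 * r)))) := by
  ext s
  simp only [Set.mem_image, Set.mem_prod, Finset.mem_coe, Finset.mem_sigma, Finset.mem_univ,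
    true_and, Set.mem_univ, and_true, mem_normalFaces, Prod.exists, Sigma.exists]
  constructor
  · rintro ⟨⟨T, hT, rfl, h⟩, hn, rfl⟩
    obtain ⟨t, T', d, hT', ht, hl, e⟩ : ∃ (t : Fin 4) (T' : Finset LVert) (d : ZMod (2 * r)),
        LFace T' ∧ root t ∈ T' ∧ T' ⊆ link t ∧ T.image (proj r) = spot r d T' := by
      by_cases hi : ∃ u ∈ T, IsIn u
      · exact exists_normal_of_isIn hT hi
      · exact exists_normal_of_M hT (by simpa using hi) (h.resolve_left hi)
    refine ⟨t, T', d, ⟨hl, ?_, ht, hT', fun h' => hn d ?_⟩, e.symm⟩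
    · rw [e, hT'.card_spot hr]
    · rw [e]
      exact ⟨mem_spot d h'.1, mem_spot d h'.2.1, mem_spot d h'.2.2⟩
  · rintro ⟨t, T, d, ⟨hl, hc, ht, hT, hn⟩, rfl⟩
    refine ⟨?_, fun i hi => hn (normal_flip hr hT hl hi.1 hi.2.1 hi.2.2), ?_⟩
    · obtain ⟨n, rfl⟩ := ZMod.intCast_surjective d
      refine ⟨_, image_shift_lFace hT _ _, (spot_intCast r n T).symm, ?_⟩
      have hm := Finset.mem_image_of_mem (shift (-n) 0) ht
      rcases isIn_or_of_root t with h | ⟨a, b, h⟩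
      · exact Or.inl ⟨_, hm, (type_shift _ _ _).1.2 h⟩
      · rw [h] at hm
        exact Or.inr ⟨_, _, hm⟩
    · rw [hT.card_spot hr, hc]

/-- By `normal_unique` a face determines its normal form and its rotation, which accounts for the
factor 2r. -/
theorem ncard_mainFaces (hr : 2 ≤ r) (c : ℕ) :
    (mainFaces r c).ncard = (∑ t, (normalFaces c t).card) * (2 * r) := by
  rw [mainFaces_eq hr, Set.InjOn.ncard_image, Set.ncard_prod, Set.ncard_coe_finset,
    Finset.card_sigma, Set.ncard_univ, Nat.card_zmod]
  rintro ⟨⟨t, T⟩, d⟩ h ⟨⟨t', T'⟩, d'⟩ h' e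
  simp only [Set.mem_prod, Finset.mem_coe, Finset.mem_sigma, Finset.mem_univ,
    true_and, Set.mem_univ, and_true, mem_normalFaces] at h h'
  obtain ⟨rfl, rfl, rfl⟩ := normal_unique hr h.2.2.2.1 h'.2.2.2.1 h.2.2.1 h'.2.2.1 h.1 h'.1 e
  rfl

/-- The faces with `c` vertices that are created by the flips. -/
def newFaces (r c : ℕ) : Set (Finset (QVert r)) :=
  {s | (∃ i, ptP r i ∈ s ∧ ptQ r i ∈ s ∧ s ⊆ {ptP r i, ptQ r i, ptX r i, ptY r i, ptZ r i} ∧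
    ¬ (ptX r i ∈ s ∧ ptY r i ∈ s ∧ ptZ r i ∈ s)) ∧ s.card = c}

theorem injOn_flip (hr : 2 ≤ r) (d : ZMod (2 * r)) : Set.InjOn (fun u => rot r d (proj r u))
    ({O 3, M 0 1, A 0 2, A 1 2, A 1 3} : Finset LVert) := by
  obtain ⟨h1, h2, h3, h4, h5, h6, h7, h8, h9, h10⟩ := pt_ne hr d
  simp only [ptP, ptQ, ptX, ptY, ptZ] at *
  intro u hu v hv e
  simp only [Finset.coe_insert, Finset.coe_singleton, Set.mem_insert_iff,
    Set.mem_singleton_iff] at hu hv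
  rcases hu with rfl | rfl | rfl | rfl | rfl <;> rcases hv with rfl | rfl | rfl | rfl | rfl <;>
    first
    | rfl
    | exact absurd e ‹_›
    | exact absurd e.symm ‹_›

theorem mem_spot_flip (hr : 2 ≤ r) (d : ZMod (2 * r)) {T : Finset LVert}
    (hT : T ⊆ {O 3, M 0 1, A 0 2, A 1 2, A 1 3}) {u : LVert}
    (hu : u ∈ ({O 3, M 0 1, A 0 2, A 1 2, A 1 3} : Finset LVert)) :
    rot r d (proj r u) ∈ spot r d T ↔ u ∈ T := by
  refine ⟨fun h => ?_, mem_spot d⟩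
  obtain ⟨v, hv, e⟩ := Finset.mem_image.1 h
  rwa [← injOn_flip hr d (hT hv) hu e]

theorem newFaces_eq (hr : 2 ≤ r) (c : ℕ) : newFaces r c =
    (fun p : Finset LVert × ZMod (2 * r) => spot r p.2 p.1) ''
      ((flipFaces c : Set (Finset LVert)) ×ˢ (Set.univ : Set (ZMod (2 * r)))) := by
  have hF (d : ZMod (2 * r)) : ({ptP r d, ptQ r d, ptX r d, ptY r d, ptZ r d} : Finset (QVert r)) =
      spot r d {O 3, M 0 1, A 0 2, A 1 2, A 1 3} := by
    simp [spot, Finset.image_insert, ptP, ptQ, ptX, ptY, ptZ]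
  ext s
  simp only [Set.mem_image, Set.mem_prod, Finset.mem_coe, Set.mem_univ, and_true, flipFaces,
    Finset.mem_filter, Finset.mem_powersetCard, Prod.exists]
  constructor
  · rintro ⟨⟨d, hP, hQ, hs, hn⟩, rfl⟩
    rw [hF] at hs
    obtain ⟨T, hT, rfl⟩ := Finset.subset_image_iff.1 hs
    have hT' : T ⊆ {O 3, M 0 1, A 0 2, A 1 2, A 1 3} := by exact_mod_cast hT
    have hm := fun u hu => mem_spot_flip hr d hT' (u := u) hu
    refine ⟨T, d, ⟨⟨hT', ?_⟩, ⟨(hm _ (by simp)).1 hP, (hm _ (by simp)).1 hQ⟩, fun h => hn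
      ⟨(hm _ (by simp)).2 h.1, (hm _ (by simp)).2 h.2.1, (hm _ (by simp)).2 h.2.2⟩⟩, rfl⟩
    exact (Finset.card_image_of_injOn ((injOn_flip hr d).mono hT)).symm
  · rintro ⟨T, d, ⟨⟨hT, rfl⟩, ⟨hP, hQ⟩, hn⟩, rfl⟩
    have hm := fun u hu => mem_spot_flip hr d hT (u := u) hu
    refine ⟨⟨d, mem_spot d hP, mem_spot d hQ, ?_, fun h => hn
      ⟨(hm _ (by simp)).1 h.1, (hm _ (by simp)).1 h.2.1, (hm _ (by simp)).1 h.2.2⟩⟩, ?_⟩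
    · rw [hF]
      exact Finset.image_subset_image hT
    · exact Finset.card_image_of_injOn ((injOn_flip hr d).mono (by exact_mod_cast hT))

theorem ncard_newFaces (hr : 2 ≤ r) (c : ℕ) :
    (newFaces r c).ncard = (flipFaces c).card * (2 * r) := by
  rw [newFaces_eq hr, Set.InjOn.ncard_image, Set.ncard_prod, Set.ncard_coe_finset,
    Set.ncard_univ, Nat.card_zmod]
  rintro ⟨T, d⟩ h ⟨T', d'⟩ h' e
  simp only [Set.mem_prod, Finset.mem_coe, Set.mem_univ, and_true, flipFaces,
    Finset.mem_filter, Finset.mem_powersetCard] at h h' e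
  have hd : d' = d := by
    refine eq_of_ptQ_mem (i := d') (j := d) ?_
    have := mem_spot d h.2.1.2
    rw [e] at this
    have := Finset.image_subset_image (f := fun u => rot r d' (proj r u)) h'.1.1 this
    simpa [Finset.image_insert, ptP, ptQ, ptX, ptY, ptZ] using this
  subst hd
  simp only [Prod.mk.injEq, and_true]
  have h1 : ∀ {S S' : Finset LVert}, S ⊆ {O 3, M 0 1, A 0 2, A 1 2, A 1 3} →
      S' ⊆ {O 3, M 0 1, A 0 2, A 1 2, A 1 3} → spot r d' S = spot r d' S' → S ⊆ S' :=
    fun hS hS' e u hu => (mem_spot_flip hr d' hS' (hS hu)).1 (e ▸ mem_spot d' hu)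
  exact Finset.Subset.antisymm (h1 h.1.1 h'.1.1 e) (h1 h'.1.1 h.1.1 e.symm)

/-- The faces with `c` vertices on the axis or in the boundary columns `B`. -/
def sideFaces (r c : ℕ) : Set (Finset (QVert r)) :=
  {s | (∃ T, LFace T ∧ T.image (proj r) = s ∧ ((∀ u ∈ T, ∃ i, u = O i) ∨
    ∀ u ∈ T, ∃ n h, u = B n h)) ∧ s.card = c}

theorem lFace_side_card_le {T : Finset LVert} (hT : LFace T) (h : (∀ u ∈ T, ∃ i, u = O i) ∨
    ∀ u ∈ T, ∃ n h, u = B n h) : T.card ≤ 2 := by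
  by_contra! h3
  obtain ⟨u, v, w, hu, hv, hw, h1, h2, h3⟩ := Finset.two_lt_card_iff.1 h3
  have n1 := hT.2 _ hu _ hv
  have n2 := hT.2 _ hu _ hw
  have n3 := hT.2 _ hv _ hw
  rcases h with h | h
  · obtain ⟨i, rfl⟩ := h _ hu
    obtain ⟨j, rfl⟩ := h _ hv
    obtain ⟨k, rfl⟩ := h _ hw
    simp only [Near, ne_eq, O.injEq] at *
    omega
  · obtain ⟨i, a, rfl⟩ := h _ hu
    obtain ⟨j, b, rfl⟩ := h _ hv
    obtain ⟨k, c, rfl⟩ := h _ hw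
    simp only [Near, ne_eq, B.injEq] at *
    omega

theorem sideFaces_eq_empty {c : ℕ} (hc : 3 ≤ c) : sideFaces r c = ∅ := by
  ext s
  simp only [Set.mem_empty_iff_false, iff_false]
  rintro ⟨⟨T, hT, rfl, h⟩, rfl⟩
  have h1 := lFace_side_card_le hT h
  have h2 := (Finset.card_image_le (s := T) (f := proj r))
  omega

/-- The edges of the axis and of the boundary columns `B`, by their lower vertices. -/
def sideEdge (r : ℕ) : ZMod 3 ⊕ ZMod 4 × ZMod r → Finset (QVert r)
  | .inl i => {.inl (.inl i), .inl (.inl (i + 1))}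
  | .inr (h, k) => {.inr (.inr (h, k)), .inr (.inr (h + 1, k + if h = 3 then 2 else 0))}

/-- In ZMod 3 and ZMod 4 two classes are never successors of each other, so an edge knows which end
is the lower one. -/
theorem sideEdge_injective : Function.Injective (sideEdge r) := by
  have h3 : ∀ i j : ZMod 3, i = j + 1 → i + 1 = j → False := by decide
  have h4 : ∀ i j : ZMod 4, i = j + 1 → i + 1 = j → False := by decide
  rintro (i | ⟨h, k⟩) (i' | ⟨h', k'⟩) e
  · have e1 : (Sum.inl (Sum.inl i) : QVert r) ∈ sideEdge r (.inl i') := e ▸ by simp [sideEdge]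
    have e2 : (Sum.inl (Sum.inl (i + 1)) : QVert r) ∈ sideEdge r (.inl i') :=
      e ▸ by simp [sideEdge]
    simp only [sideEdge, Finset.mem_insert, Finset.mem_singleton, Sum.inl.injEq,
      add_left_inj] at e1 e2 ⊢
    rcases e1 with e1 | e1
    · exact e1
    · rcases e2 with e2 | e2
      · exact (h3 _ _ e1 e2).elim
      · exact e2
  · have e1 : (Sum.inl (Sum.inl i) : QVert r) ∈ sideEdge r (.inr (h', k')) :=
      e ▸ by simp [sideEdge]
    simp [sideEdge] at e1
  · have e1 : (Sum.inl (Sum.inl i') : QVert r) ∈ sideEdge r (.inr (h, k)) :=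
      e ▸ by simp [sideEdge]
    simp [sideEdge] at e1
  · have e1 : (Sum.inr (Sum.inr (h, k)) : QVert r) ∈ sideEdge r (.inr (h', k')) :=
      e ▸ by simp [sideEdge]
    have e2 : (Sum.inr (Sum.inr (h + 1, k + if h = 3 then 2 else 0)) : QVert r) ∈
        sideEdge r (.inr (h', k')) := e ▸ by simp [sideEdge]
    simp only [sideEdge, Finset.mem_insert, Finset.mem_singleton, Sum.inr.injEq, Prod.mk.injEq,
      add_left_inj] at e1 e2 ⊢
    rcases e1 with e1 | e1
    · exact e1
    · rcases e2 with e2 | e2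
      · exact (h4 _ _ e1.1 e2.1).elim
      · obtain ⟨rfl, e2⟩ := e2
        exact ⟨rfl, add_right_cancel e2⟩

theorem sideEdge_O (i : ℤ) : sideEdge r (.inl i) = {proj r (O i), proj r (O (i + 1))} := by
  simp [sideEdge, proj]

/-- The correction 2 in `sideEdge` is the jump of 2(h / 4) when the next height is a multiple of 4.
-/
theorem sideEdge_B (n h : ℤ) : sideEdge r (.inr (h, (2 * (h / 4) - n : ℤ))) =
    {proj r (B n h), proj r (B n (h + 1))} := by
  have h3 : ((h : ZMod 4) = 3) ↔ h % 4 = 3 := by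
    rw [show (3 : ZMod 4) = ((3 : ℤ) : ZMod 4) by rfl, ZMod.intCast_eq_intCast_iff']
    rfl
  simp only [sideEdge, proj, h3]
  congr 6
  · push_cast; rfl
  split_ifs with h4
  · rw [show (h + 1) / 4 = h / 4 + 1 by omega]
    push_cast
    ring
  · rw [show (h + 1) / 4 = h / 4 by omega, add_zero]

theorem sideFaces_two (hr : 2 ≤ r) : sideFaces r 2 = Set.range (sideEdge r) := by
  ext s
  constructor
  · rintro ⟨⟨T, hT, rfl, h⟩, hc⟩
    rw [Finset.card_image_of_injOn (hT.proj_injOn hr)] at hc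
    obtain ⟨u, v, huv, rfl⟩ := Finset.card_eq_two.1 hc
    have hn := hT.2 u (by simp) v (by simp)
    simp only [Finset.image_insert, Finset.image_singleton]
    rcases h with h | h
    · obtain ⟨i, rfl⟩ := h u (by simp)
      obtain ⟨j, rfl⟩ := h v (by simp)
      simp only [Near, ne_eq, O.injEq] at hn huv
      obtain rfl | rfl : j = i + 1 ∨ i = j + 1 := by omega
      · exact ⟨_, sideEdge_O i⟩
      · exact ⟨_, (sideEdge_O j).trans (Finset.pair_comm _ _)⟩
    · obtain ⟨n, i, rfl⟩ := h u (by simp)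
      obtain ⟨n', j, rfl⟩ := h v (by simp)
      simp only [Near, ne_eq, B.injEq] at hn huv
      obtain ⟨rfl, hn⟩ := hn
      obtain rfl | rfl : j = i + 1 ∨ i = j + 1 := by omega
      · exact ⟨_, sideEdge_B _ i⟩
      · exact ⟨_, (sideEdge_B _ j).trans (Finset.pair_comm _ _)⟩
  · have hc : ∀ u v, Near u v → u ≠ v → ((∀ w ∈ ({u, v} : Finset LVert), ∃ i, w = O i) ∨
        ∀ w ∈ ({u, v} : Finset LVert), ∃ n h, w = B n h) →
        ({proj r u, proj r v} : Finset (QVert r)) ∈ sideFaces r 2 := by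
      intro u v h h' h2
      have hT : LFace {u, v} := by
        refine ⟨by simp, ?_⟩
        simp only [Finset.mem_insert, Finset.mem_singleton]
        rintro a (rfl | rfl) b (rfl | rfl)
        exacts [Near.refl _, h, h.symm, Near.refl _]
      refine ⟨⟨_, hT, by simp [Finset.image_insert], h2⟩, ?_⟩
      exact Finset.card_pair fun e => h' (proj_near_injective hr h e)
    rintro ⟨i | ⟨h, k⟩, rfl⟩
    · obtain ⟨i, rfl⟩ := ZMod.intCast_surjective i
      rw [sideEdge_O]
      exact hc _ _ (by simp [Near]; omega) (by simp) (by simp)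
    · obtain ⟨h, rfl⟩ := ZMod.intCast_surjective h
      obtain ⟨k, rfl⟩ := ZMod.intCast_surjective k
      have := sideEdge_B (r := r) (2 * (h / 4) - k) h
      rw [sub_sub_cancel] at this
      rw [this]
      exact hc _ _ (by simp [Near]; omega) (by simp) (by simp)

theorem ncard_sideFaces_two (hr : 2 ≤ r) : (sideFaces r 2).ncard = 4 * r + 3 := by
  have : NeZero r := ⟨by omega⟩
  rw [sideFaces_two hr, ← Set.image_univ, Set.ncard_image_of_injective _ sideEdge_injective,
    Set.ncard_univ, Nat.card_sum, Nat.card_prod]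
  simp
  ring


/-! ### Assembling the face numbers. -/

open LVert AbstractSimplicialComplex

variable {r : ℕ}

/-- Inner vertices and boundary vertices `M`. -/
def IsMain : QVert r → Prop
  | .inl (.inl _) => False
  | .inl (.inr _) => True
  | .inr (.inl _) => True
  | .inr (.inr _) => False

theorem isMain_proj (u : LVert) : IsMain (proj r u) ↔ IsIn u ∨ ∃ n m, u = M n m := by
  cases u <;> simp [IsMain, proj, IsIn]

/-- Flipped triangles consist of inner vertices, so excluding them restricts only the main faces;
side faces all survive. -/
theorem faces_eq (hr : 2 ≤ r) (c : ℕ) :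
    {s : Finset (QVert r) | s ∈ (prismComplex r hr).faces ∧ s.card = c} =
      (mainFaces r c ∪ sideFaces r c) ∪ newFaces r c := by
  ext s
  simp only [Set.mem_ofPred_eq, Set.mem_union]
  constructor
  · rintro ⟨⟨⟨T, hT, rfl⟩, hn⟩ | h, hc⟩
    · left
      by_cases hM : (∃ u ∈ T, IsIn u) ∨ ∃ n m, M n m ∈ T
      · exact Or.inl ⟨⟨T, hT, rfl, hM⟩, hn, hc⟩
      · right
        push Not at hM
        refine ⟨⟨T, hT, rfl, ?_⟩, hc⟩
        rcases hT.isBd_or_isAx hM.1 with h | h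
        · right
          intro u hu
          have h1 := h u hu
          cases u
          · exact h1.elim
          · exact h1.elim
          · exact absurd hu (hM.2 _ _)
          · exact ⟨_, _, rfl⟩
        · left
          intro u hu
          have h1 := h u hu
          cases u
          · exact ⟨_, rfl⟩
          all_goals exact h1.elim
    · exact Or.inr ⟨h, hc⟩
  · rintro ((⟨⟨T, hT, rfl, -⟩, hn, hc⟩ | ⟨⟨T, hT, rfl, h⟩, hc⟩) | ⟨h, hc⟩)
    · exact ⟨Or.inl ⟨⟨T, hT, rfl⟩, hn⟩, hc⟩
    · refine ⟨Or.inl ⟨⟨T, hT, rfl⟩, fun i hi => ?_⟩, hc⟩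
      obtain ⟨u, hu, e⟩ := Finset.mem_image.1 hi.1
      rcases h with h | h
      · obtain ⟨j, rfl⟩ := h u hu
        simp [proj, ptX, rot] at e
      · obtain ⟨n, j, rfl⟩ := h u hu
        simp [proj, ptX, rot] at e
    · exact ⟨Or.inr h, hc⟩

theorem disjoint_mainFaces_sideFaces (c : ℕ) : Disjoint (mainFaces r c) (sideFaces r c) := by
  rw [Set.disjoint_left]
  rintro s ⟨⟨T, -, rfl, h⟩, -⟩ ⟨⟨T', -, e, h'⟩, -⟩
  obtain ⟨u, hu, hm⟩ : ∃ u ∈ T, IsMain (proj r u) := by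
    rcases h with ⟨u, hu, h⟩ | ⟨n, m, hu⟩
    · exact ⟨u, hu, (isMain_proj u).2 (Or.inl h)⟩
    · exact ⟨_, hu, trivial⟩
  have hu' := Finset.mem_image_of_mem (proj r) hu
  rw [← e] at hu'
  obtain ⟨v, hv, e'⟩ := Finset.mem_image.1 hu'
  rw [← e', isMain_proj] at hm
  rcases h' with h' | h'
  · obtain ⟨j, rfl⟩ := h' v hv
    simp [IsIn] at hm
  · obtain ⟨n, j, rfl⟩ := h' v hv
    simp [IsIn] at hm

theorem disjoint_newFaces (hr : 2 ≤ r) (c : ℕ) :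
    Disjoint (mainFaces r c ∪ sideFaces r c) (newFaces r c) := by
  rw [Set.disjoint_left]
  rintro s h ⟨⟨i, hP, hQ, -⟩, -⟩
  have hs : s ∈ (quotComplex r).faces := by
    rcases h with ⟨⟨T, hT, rfl, -⟩, -⟩ | ⟨⟨T, hT, rfl, -⟩, -⟩ <;> exact ⟨T, hT, rfl⟩
  exact (isFlip_prismComplex hr).not_mem s hs i hP hQ

theorem fNumber_prismComplex [NeZero r] (hr : 2 ≤ r) (i : ℕ) : (prismComplex r hr).fNumber i =
    (∑ t, (normalFaces (i + 1) t).card + (flipFaces (i + 1)).card) * (2 * r) +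
      (sideFaces r (i + 1)).ncard := by
  rw [fNumber, faces_eq hr, Set.ncard_union_eq (disjoint_newFaces hr _) (Set.toFinite _)
    (Set.toFinite _), Set.ncard_union_eq (disjoint_mainFaces_sideFaces _) (Set.toFinite _)
    (Set.toFinite _), ncard_mainFaces hr, ncard_newFaces hr]
  ring

end Prism

/-! ### General face numbers and renaming of vertices. -/

namespace AbstractSimplicialComplex

variable {V : Type*}

theorem fNumber_zero (K : AbstractSimplicialComplex V) : K.fNumber 0 = Nat.card V := by
  have : {s : Finset V | s ∈ K.faces ∧ s.card = 0 + 1} = Set.range fun v => {v} := by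
    ext s
    simp only [zero_add, Finset.card_eq_one, Set.mem_ofPred_eq, Set.mem_range]
    constructor
    · rintro ⟨-, v, rfl⟩
      exact ⟨v, rfl⟩
    · rintro ⟨v, rfl⟩
      exact ⟨K.singleton_mem v, v, rfl⟩
  rw [fNumber, this, ← Set.image_univ,
    Set.ncard_image_of_injective _ Finset.singleton_injective, Set.ncard_univ]

theorem fNumber_eq_zero [Finite V] (K : AbstractSimplicialComplex V) {i j : ℕ}
    (h : K.fNumber i = 0) (hij : i ≤ j) : K.fNumber j = 0 := by
  rw [fNumber, Set.ncard_eq_zero (Set.toFinite _), Set.eq_empty_iff_forall_notMem] at h ⊢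
  rintro s ⟨hs, hc⟩
  obtain ⟨t, ht, hct⟩ := Finset.exists_subset_card_eq (show i + 1 ≤ s.card by omega)
  exact h t ⟨(K.isRelLowerSet_faces hs).2 ht (Finset.card_pos.1 (by omega)), hct⟩

/-- Renaming the vertices of a simplicial complex. -/
def transport {W : Type*} (K : AbstractSimplicialComplex V) (e : V ≃ W) :
    AbstractSimplicialComplex W where
  faces := {s | s.map e.symm.toEmbedding ∈ K.faces}
  isRelLowerSet_faces s hs := by
    refine ⟨Finset.map_nonempty.1 (K.isRelLowerSet_faces hs).1, fun t ht h0 => ?_⟩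
    exact (K.isRelLowerSet_faces hs).2 (Finset.map_subset_map.2 ht) (h0.map)
  singleton_mem v := by
    change Finset.map _ _ ∈ K.faces
    rw [Finset.map_singleton]
    exact K.singleton_mem _

variable {W : Type*} (K : AbstractSimplicialComplex V) (e : V ≃ W)

theorem mem_transport {s : Finset W} :
    s ∈ (K.transport e).faces ↔ s.map e.symm.toEmbedding ∈ K.faces := Iff.rfl

theorem fNumber_transport (i : ℕ) : (K.transport e).fNumber i = K.fNumber i := by
  have : {s | s ∈ (K.transport e).faces ∧ s.card = i + 1} =
      (Equiv.finsetCongr e) '' {s | s ∈ K.faces ∧ s.card = i + 1} := by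
    ext s
    rw [Equiv.image_eq_preimage_symm]
    simp [mem_transport, Equiv.finsetCongr]
  rw [fNumber, this, Set.ncard_image_of_injective _ (Equiv.injective _), fNumber]

theorem nonempty_homeomorph_transport [Fintype V] [Fintype W] :
    Nonempty ((K.transport e).realization ≃ₜ K.realization) := by
  refine ⟨Homeomorph.subtype (Homeomorph.piCongrLeft (Y := fun _ => ℝ) e.symm) fun x => ?_⟩
  have hx : ∀ v, (Homeomorph.piCongrLeft (Y := fun _ => ℝ) e.symm x) v = x (e v) := fun v => by
    have := Equiv.piCongrLeft_apply_apply (fun _ => ℝ) e.symm x (e v)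
    rwa [e.symm_apply_apply] at this
  constructor
  · rintro ⟨⟨h0, h1⟩, s, hs, h⟩
    refine ⟨⟨fun v => ?_, ?_⟩, _, hs, fun v hv => ?_⟩
    · rw [hx]; exact h0 _
    · simp only [hx]
      rw [← h1]
      exact e.sum_comp x
    · rw [hx] at hv
      simpa using h _ hv
  · rintro ⟨⟨h0, h1⟩, s, hs, h⟩
    refine ⟨⟨fun w => ?_, ?_⟩, s.map e.toEmbedding, ?_, fun w hw => ?_⟩
    · have := h0 (e.symm w)
      rwa [hx, e.apply_symm_apply] at this
    · rw [← h1]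
      simp only [hx]
      exact (e.sum_comp x).symm
    · rw [mem_transport, Finset.map_map]
      simpa using hs
    · have := h (e.symm w)
      rw [hx, e.apply_symm_apply] at this
      simpa using this hw

theorem exists_hom_transport {G : Type*} [Group G] (f : G →* Equiv.Perm V)
    (hf : Function.Injective f)
    (h : ∀ g, ∀ s ∈ K.faces, s.map (f g).toEmbedding ∈ K.faces) :
    ∃ φ : G →* (K.transport e).automorphismGroup, Function.Injective φ := by
  have key : ∀ g, ∀ s ∈ (K.transport e).faces,
      s.map ((e.permCongrHom.toMonoidHom.comp f) g).toEmbedding ∈ (K.transport e).faces := by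
    intro g s hs
    rw [mem_transport] at hs ⊢
    convert h g _ hs using 1
    simp only [Finset.map_map]
    congr 1
    ext v
    simp
  refine ⟨(e.permCongrHom.toMonoidHom.comp f).codRestrict _ fun g s => ⟨fun hs => ?_, key g s⟩, ?_⟩
  -- Preserving faces in one direction suffices, because the inverse element provides the other.
  · have := key g⁻¹ _ hs
    rw [Finset.map_map] at this
    convert this
    ext v
    simp
  · intro g g' hg
    apply hf
    apply e.permCongrHom.injective
    exact congrArg Subtype.val hg

end AbstractSimplicialComplex

/-! ### The faithful action, the f-vector, and the conclusion. -/

namespace Prism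

variable {r : ℕ}

/-- The action of `ℤ / 2r` as a homomorphism. -/
def rotHom (r : ℕ) : Multiplicative (ZMod (2 * r)) →* Equiv.Perm (QVert r) where
  toFun d := ⟨rot r d.toAdd, rot r (-d.toAdd), fun x => by rw [rot_rot, neg_add_cancel, rot_zero],
    fun x => by rw [rot_rot, add_neg_cancel, rot_zero]⟩
  map_one' := Equiv.ext fun x => rot_zero r x
  map_mul' d e := Equiv.ext fun x => (rot_rot r d.toAdd e.toAdd x).symm

theorem rotHom_injective (r : ℕ) : Function.Injective (rotHom r) := by
  intro d e h
  -- A rotation acts on the M vertices by addition in ZMod (2r), so the image of index 0 is the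
  -- rotation itself.
  have := DFunLike.congr_fun h (.inr (.inl 0))
  simpa [rotHom, rot] using this

theorem hasFVector_prismComplex [NeZero r] (hr : 2 ≤ r) :
    (prismComplex r hr).HasFVector [12 * r + 3, 84 * r + 3, 144 * r, 72 * r] := by
  obtain ⟨n2, n3, n4, n5⟩ := card_normalFaces
  obtain ⟨f2, f3, f4, f5⟩ := card_flipFaces
  -- No face has five vertices; all higher face numbers vanish with this one by `fNumber_eq_zero`.
  have h4 : (prismComplex r hr).fNumber 4 = 0 := by
    simp [fNumber_prismComplex, n5, f5, sideFaces_eq_empty]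
  intro i
  rcases i with _ | _ | _ | _ | i
  · rw [AbstractSimplicialComplex.fNumber_zero, Nat.card_eq_fintype_card]
    simp [ZMod.card]
    ring
  · rw [fNumber_prismComplex hr, n2, f2, ncard_sideFaces_two hr]
    simp
    ring
  · rw [fNumber_prismComplex hr, n3, f3, sideFaces_eq_empty (by simp)]
    simp
    ring
  · rw [fNumber_prismComplex hr, n4, f4, sideFaces_eq_empty (by simp)]
    simp
    ring
  · rw [AbstractSimplicialComplex.fNumber_eq_zero _ h4 (by omega)]
    simp

end Prism

end

theorem mainTheorem4 (r : ℕ) (hr : 2 ≤ r) :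
    ∃ K : AbstractSimplicialComplex (Fin (12 * r + 3)),
      Nonempty (K.realization ≃ₜ PrismSpace r) ∧
      (∃ φ : Multiplicative (ZMod (2 * r)) →* K.automorphismGroup, Function.Injective φ) ∧
      K.HasFVector [12 * r + 3, 84 * r + 3, 144 * r, 72 * r] := by
  have : NeZero r := ⟨by omega⟩
  have hf := Prism.hasFVector_prismComplex hr
  have hcard : Fintype.card (Prism.QVert r) = 12 * r + 3 := by
    rw [← Nat.card_eq_fintype_card,
      ← AbstractSimplicialComplex.fNumber_zero (Prism.prismComplex r hr), hf 0]
    rfl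
  refine ⟨(Prism.prismComplex r hr).transport (Fintype.equivFinOfCardEq hcard),
    ⟨((Prism.prismComplex r hr).nonempty_homeomorph_transport _).some.trans
      (Prism.nonempty_homeomorph_prismComplex hr).some⟩,
    AbstractSimplicialComplex.exists_hom_transport _ _ (Prism.rotHom r) (Prism.rotHom_injective r)
      fun d s hs => ?_, fun i => ?_⟩
  · rw [Finset.map_eq_image]
    exact Prism.image_rot_mem_prismComplex hr hs _
  · rw [AbstractSimplicialComplex.fNumber_transport, hf i]
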